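/- All logarithms are to base $2$, and $\log^* x$ is the number of times $\log$ must be applied to $x$ until the result is at most $1$. A uniform $(g,\ell,n)$-oNOSF source (online non-oblivious symbol fixing source) is a random variable $\mathbf X=(\mathbf X_1,\dots,\mathbf X_\ell)$ over $(\{0,1\}^n)^\ell$ for which there is a set $G\subseteq[\ell]$ of $g$ "good" indices such that the blocks $(\mathbf X_i)_{i\in G}$ are independent, each of min-entropy $n$ (i.e. uniform on $\{0,1\}^n$), and for each $i\notin G$ the "bad" block $\mathbf X_i$ is an arbitrary function of $\mathbf X_1,\dots,\mathbf X_{i-1}$. **Theorem.** There are a constant $C>0$ and an explicit family of functions $\mathsf{Ext}=\mathsf{Ext}_{\ell,n}:(\{0,1\}^n)^\ell\to\{0,1\}^n$ (explicit: a single deterministic Turing machine computes $\mathsf{Ext}_{\ell,n}(x)$ from $(\ell,n,x)$ in time polynomial in $\ell$ and $n$) such that for all integers $\ell\ge 2$, $n\ge\log \ell$ and $g\ge \ell-\dfrac{\ell}{C\log^*\ell}$, and every uniform $(g,\ell,n)$-oNOSF source $\mathbf X$, the distribution of $\mathsf{Ext}_{\ell,n}(\mathbf X)$ is within statistical distance $1/100$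 of the uniform distribution $\mathbf U_n$ on $\{0,1\}^n$. -/

import Mathlib

namespace ONOSF

/-- An `n`-bit string, i.e. an element of `{0,1}^n`. -/
abbrev Block (n : ℕ) : Type := Fin n → Bool

/-- The min-entropy `min_{a ∈ supp p} log₂ (1 / p a)` of a discrete distribution. -/
noncomputable def minEntropy {α : Type*} (p : PMF α) : ℝ :=
  ⨅ a : p.support, Real.logb 2 (1 / (p a).toReal)

/-- The statistical (total variation) distance of two distributions on a finite set. -/
noncomputable def statDist {α : Type*} [Fintype α] (p q : PMF α) : ℝ :=
  (1 / 2) * ∑ a, |(p a).toReal - (q a).toReal|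

/-- `X = (X₁, …, X_ℓ)` is a `(g, ℓ, n, k)`-oNOSF source (online non-oblivious symbol fixing source):
`g` of the blocks are independent and have min-entropy at least `k`, and every other block is a
function of the blocks with a smaller index. A source is given by its joint distribution. -/
def IsONOSF (g ℓ n : ℕ) (k : ℝ) (X : PMF (Fin ℓ → Block n)) : Prop :=
  ∃ G : Finset (Fin ℓ), G.card = g ∧
    ProbabilityTheory.iIndepFun (fun (i : G) (x : Fin ℓ → Block n) => x i) X.toMeasure ∧
    (∀ i ∈ G, k ≤ minEntropy (X.map fun x => x i)) ∧
    ∀ i ∉ G, ∃ f : ({j : Fin ℓ // j < i} → Block n) → Block n,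
      ∀ x ∈ X.support, x i = f fun j => x j

/-- A uniform `(g, ℓ, n)`-oNOSF source: the good blocks have full min-entropy `n`. -/
def IsUniformONOSF (g ℓ n : ℕ) (X : PMF (Fin ℓ → Block n)) : Prop :=
  IsONOSF g ℓ n (n : ℝ) X

/-- The iterated logarithm `log* x`: the number of times that `log₂` has to be applied to `x`
until the result is at most `1`. -/
noncomputable def logStar (x : ℝ) : ℕ :=
  sInf {k : ℕ | (Real.logb 2)^[k] x ≤ 1}

/-- The input `(ℓ, n, x)` with `x = (x₁, …, x_ℓ) ∈ ({0,1}^n)^ℓ` as a word over the three-letter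
alphabet `{0, 1, #}` (with `none` in the place of `#`): the word `1^n # x₁ # x₂ # … x_ℓ #`.
Its length is `(n + 1) * (ℓ + 1)`. -/
def encodeInput (a : Σ p : ℕ × ℕ, (Fin p.1 → Block p.2)) : List (Option Bool) :=
  (List.replicate a.1.2 (some true) ++ [none]) ++
    (List.ofFn fun i => (List.ofFn (a.2 i)).map some ++ [none]).flatten

/-- A family of functions `({0,1}^n)^ℓ → {0,1}^n` is explicit if one (multi-stack) Turing machine
computes all its members in time polynomial in `n` and `ℓ`. -/
def IsExplicit (Ext : (ℓ n : ℕ) → (Fin ℓ → Block n) → Block n) : Prop :=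
  Nonempty (Turing.TM2ComputableInPolyTime encodeInput (id : List Bool → List Bool)
    fun a => List.ofFn (Ext a.1.1 a.1.2 a.2))

end ONOSF

/-! The extractor elects a leader and outputs the next block of that leader. The blocks are arranged
in `rounds + M + 1` rows of `N = players` blocks, and player `j` owns the `j`-th block of every row.
A block is fresh if it is uniform and independent of all blocks before it. Good blocks are fresh
(`IsUniformONOSF.exists_fresh`), because on the support the preceding blocks are functions of the
preceding good ones. A player is good if all its blocks are fresh, and each bad block spoils at most
one player. If an index is determined by earlier blocks, then the block at this index is uniform up
to the probability that the index is not fresh (`statDist_ext_le`). It remains to elect a good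
player with high probability.

Halving. In each round the players of the committee vote with the first `k` bits of their blocks,
and bit after bit only the voters of the minority stay. This is a form of the lightest bin protocol:
the survivors are those whose first `k` bits equal some word `w`, and they are at most a fraction
`2^(-k)` of the committee, whatever the bad players do. For a fixed `w`, a Chernoff bound shows that
about a fraction `2^(-k)` of the good members choose `w`; a union bound over the `2^k` words covers
the word that wins (`prob_shrink_le`). So the share of good players hardly drops. The logarithm `L`
of the committee size follows `L ↦ 3 (log (L + 1) + c)`: with `L' = 3 m` the new value, the relative
loss `2^(-m)` makes the Chernoff exponent about `2^m`, far above `L`. Losses and failure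
probabilities are dominated by those of the last round (`prob_committee_le`). Two steps of the
schedule are at most one logarithm as long as `L` is large, so there are `O(log* ℓ)` rounds, and the
last committee has bounded size, of order `8^m`, with at most `6 * 4^m` bad members.

Baton. In the final committee a baton is passed: its holder names, by its block, one of the waiting
players and retires; the last holder is the leader. With `a` bad and `s` good players waiting and a
good holder, the probability of a bad leader is at most `a * weight s`, where `weight s` has order
`s^(-3/4)`. A good holder picks almost uniformly, which does not increase this bound on average
(`avg_risk_pick_le`); a bad holder cannot increase it at all, given that its state is charged as if
it had named a good player (`risk_pick_le`). As `4^m` is small against `8^(3m/4)`, the risk is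
small.

Since `N` is of order `ℓ / log* ℓ`, a bound `ℓ / (C log* ℓ)` on the number of bad blocks keeps the
share of bad players below `2^(-m)`. For small `ℓ` this bound excludes bad blocks altogether, and
then the output is exactly uniform.

Explicitness is proved with a small stack language whose programs compile to Turing machines step by
step (`Cmd.Runs.steps`), and a program in it that carries out the election with a quadratic time
bound (`Cmd.exec_extProg`). -/

namespace ONOSF

/-! ### A stack language and its compilation to Turing machines. -/

open Function Turing

/-- A small imperative language over a family of stacks. -/
inductive Cmd {K : Type} (Γ : K → Type) : Type
  | skip : Cmd Γ
  | push (k : K) (a : Γ k) : Cmd Γ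
  | pop (k : K) (f : Option (Γ k) → Cmd Γ) : Cmd Γ
  | seq (c d : Cmd Γ) : Cmd Γ
  | loop (k : K) (halt : Γ k → Bool) (body : Γ k → Cmd Γ) : Cmd Γ

namespace Cmd

variable {K : Type} {Γ : K → Type}

/-- The contents of the stacks. -/
abbrev Store (Γ : K → Type) : Type := ∀ k, List (Γ k)

/-- `Runs c S t S'`: the program `c`, started on the stacks `S`, ends with `S'` after `t` steps. -/
inductive Runs [DecidableEq K] : Cmd Γ → Store Γ → ℕ → Store Γ → Prop
  | skip (S) : Runs skip S 1 S
  | push (k a S) : Runs (push k a) S 1 (update S k (a :: S k))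
  | pop_nil {k f S t S'} : S k = [] → Runs (f none) S t S' → Runs (pop k f) S (t + 1) S'
  | pop_cons {k f S a r t S'} : S k = a :: r → Runs (f (some a)) (update S k r) t S' →
      Runs (pop k f) S (t + 1) S'
  | seq {c d S t S' t' S''} : Runs c S t S' → Runs d S' t' S'' → Runs (seq c d) S (t + t') S''
  | loop_nil {k halt body S} : S k = [] → Runs (loop k halt body) S 1 S
  | loop_halt {k halt body S a r} : S k = a :: r → halt a = true →
      Runs (loop k halt body) S 1 (update S k r)
  | loop_cons {k halt body S a r t S' t' S''} : S k = a :: r → halt a = false →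
      Runs (body a) (update S k r) t S' → Runs (loop k halt body) S' t' S'' →
      Runs (loop k halt body) S (t + t' + 1) S''

/-- The control points of a program. -/
def Lab : Cmd Γ → Type
  | skip => Unit
  | push _ _ => Unit
  | pop _ f => Option (Σ o, Lab (f o))
  | seq c d => Lab c ⊕ Lab d
  | loop _ _ body => Option (Σ a, Lab (body a))

/-- The first control point of a program. -/
def entry : (c : Cmd Γ) → Lab c
  | skip => ()
  | push _ _ => ()
  | pop _ _ => none
  | seq c _ => Sum.inl (entry c)
  | loop _ _ _ => none

/-- The control points of a program over finite alphabets are finitely many. -/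
@[reducible]
noncomputable def labFintype [∀ k, Fintype (Γ k)] : (c : Cmd Γ) → Fintype (Lab c)
  | skip => inferInstanceAs (Fintype Unit)
  | push _ _ => inferInstanceAs (Fintype Unit)
  | pop _ f => by
      haveI := fun o => labFintype (f o)
      exact inferInstanceAs (Fintype (Option (Σ o, Lab (f o))))
  | seq c d => by
      haveI := labFintype c
      haveI := labFintype d
      exact inferInstanceAs (Fintype (Lab c ⊕ Lab d))
  | loop _ _ body => by
      haveI := fun a => labFintype (body a)
      exact inferInstanceAs (Fintype (Option (Σ a, Lab (body a))))

/-- The symbol of stack `k` that is held in the finite control. -/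
def held [DecidableEq K] (k : K) (v : Option (Σ k, Γ k)) : Option (Γ k) :=
  v.bind fun p => if h : p.1 = k then some (h ▸ p.2) else none

theorem held_map [DecidableEq K] (k : K) (o : Option (Γ k)) :
    held k (o.map (Sigma.mk k)) = o := by
  cases o <;> simp [held]

/-- Compilation: `code c inj exit` gives for each control point of `c` the machine statement, where
`inj` embeds the control points into the labels of the machine and `exit` is the label to go to at
the end. -/
def code [DecidableEq K] {L : Type} : (c : Cmd Γ) → (Lab c → L) → L → Lab c →
    TM2.Stmt Γ L (Option (Σ k, Γ k))
  | skip, _, exit, _ => .goto fun _ => exit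
  | push k a, _, exit, _ => .push k (fun _ => a) (.goto fun _ => exit)
  | pop k f, inj, exit, l =>
      match l with
      | none => .pop k (fun _ o => o.map (Sigma.mk k))
          (.goto fun v => inj (some ⟨held k v, entry (f (held k v))⟩))
      | some ⟨o, l⟩ => code (f o) (fun l => inj (some ⟨o, l⟩)) exit l
  | seq c d, inj, exit, l =>
      match l with
      | .inl l => code c (fun l => inj (.inl l)) (inj (.inr (entry d))) l
      | .inr l => code d (fun l => inj (.inr l)) exit l
  | loop k halt body, inj, exit, l =>
      match l with
      | none => .pop k (fun _ o => o.map (Sigma.mk k))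
          (.goto fun v => match held k v with
            | none => exit
            | some a => if halt a then exit else inj (some ⟨a, entry (body a)⟩))
      | some ⟨a, l⟩ => code (body a) (fun l => inj (some ⟨a, l⟩)) (inj none) l

/-- The popped symbol is parked in the finite control, tagged with its stack, and the jump branches
on it: a pop together with its case distinction costs one machine step. The form with `head?` and
`tail` covers the empty stack as well. -/
theorem step_pop [DecidableEq K] {L : Type} {m : L → TM2.Stmt Γ L (Option (Σ k, Γ k))} {l : L}
    {k : K} {g : Option (Σ k, Γ k) → L}
    (h : m l = .pop k (fun _ o => o.map (Sigma.mk k)) (.goto g)) (v) (S : Store Γ) :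
    flip bind (TM2.step m) (some ⟨some l, v, S⟩) =
      some ⟨some (g ((S k).head?.map (Sigma.mk k))), (S k).head?.map (Sigma.mk k),
        update S k (S k).tail⟩ := by
  simp [flip, h]

/-- A compiled program does what the program does, in the same number of steps. -/
theorem Runs.steps [DecidableEq K] {L : Type} {m : L → TM2.Stmt Γ L (Option (Σ k, Γ k))}
    {c : Cmd Γ} {S S' : Store Γ} {t : ℕ} (h : Runs c S t S') :
    ∀ (inj : Lab c → L) (exit : L), (∀ l, m (inj l) = code c inj exit l) →
      ∀ v, ∃ v', (flip bind (TM2.step m))^[t] (some ⟨some (inj (entry c)), v, S⟩) =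
        some ⟨some exit, v', S'⟩ := by
  induction h with
  | skip S =>
    intro inj exit hm v
    refine ⟨v, ?_⟩
    have e : m (inj (entry Cmd.skip)) = .goto fun _ => exit := hm _
    simp [flip, e]
  | push k a S =>
    intro inj exit hm v
    refine ⟨v, ?_⟩
    have e : m (inj (entry (Cmd.push k a))) = .push k (fun _ => a) (.goto fun _ => exit) := hm _
    simp [flip, e]
  | @pop_nil k f S t S' h0 h1 ih =>
    intro inj exit hm v
    obtain ⟨v', hv'⟩ := ih (fun l => inj (some ⟨none, l⟩)) exit
      (fun l => hm (some ⟨none, l⟩)) none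
    refine ⟨v', ?_⟩
    rw [iterate_succ_apply, step_pop (hm _), h0, ← hv', List.tail_nil, ← h0, update_eq_self, h0]
    rfl
  | @pop_cons k f S a r t S' h0 h1 ih =>
    intro inj exit hm v
    obtain ⟨v', hv'⟩ := ih (fun l => inj (some ⟨some a, l⟩)) exit
      (fun l => hm (some ⟨some a, l⟩)) (some ⟨k, a⟩)
    refine ⟨v', ?_⟩
    rw [iterate_succ_apply, step_pop (hm _), h0, ← hv', held_map]
    rfl
  | @seq c d S t S' t' S'' h1 h2 ih1 ih2 =>
    intro inj exit hm v
    obtain ⟨v1, hv1⟩ := ih1 (fun l => inj (.inl l)) (inj (.inr (entry d))) (fun l => hm (.inl l)) v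
    obtain ⟨v2, hv2⟩ := ih2 (fun l => inj (.inr l)) exit (fun l => hm (.inr l)) v1
    refine ⟨v2, ?_⟩
    rw [add_comm, iterate_add_apply, ← hv2]
    exact congrArg _ hv1
  | @loop_nil k halt body S h0 =>
    intro inj exit hm v
    refine ⟨none, ?_⟩
    rw [iterate_one, step_pop (hm _), h0, List.tail_nil, ← h0, update_eq_self, h0]
    rfl
  | @loop_halt k halt body S a r h0 hs =>
    intro inj exit hm v
    refine ⟨some ⟨k, a⟩, ?_⟩
    rw [iterate_one, step_pop (hm _), h0, held_map]
    simp [hs]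
  | @loop_cons k halt body S a r t S' t' S'' h0 hs h1 h2 ih1 ih2 =>
    intro inj exit hm v
    obtain ⟨v1, hv1⟩ := ih1 (fun l => inj (some ⟨a, l⟩)) (inj none)
      (fun l => hm (some ⟨a, l⟩)) (some ⟨k, a⟩)
    obtain ⟨v2, hv2⟩ := ih2 inj exit hm v1
    refine ⟨v2, ?_⟩
    rw [iterate_succ_apply, add_comm, iterate_add_apply, ← hv2, step_pop (hm _), h0, held_map]
    refine congrArg _ (Eq.trans ?_ hv1)
    simp [hs]

/-- `initList` and `haltList` describe the stacks by a dependent `if`; this translates to `update`.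
-/
theorem update_nil_eq_dite [DecidableEq K] (k₀ : K) (s : List (Γ k₀)) :
    update (fun k => ([] : List (Γ k))) k₀ s =
      fun k => if h : k = k₀ then (by rw [h]; exact s) else [] := by
  funext k
  by_cases hk : k = k₀
  · subst hk; simp
  · simp [hk]

/-- The machine of a program. -/
noncomputable def machine [DecidableEq K] [Fintype K] [∀ k, Fintype (Γ k)] (k₀ k₁ : K)
    (c : Cmd Γ) : FinTM2 :=
  letI := labFintype c
  { K := K
    k₀ := k₀
    k₁ := k₁
    Γ := Γ
    Λ := Option (Lab c)
    main := some (entry c)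
    σ := Option (Σ k, Γ k)
    initialState := none
    m := fun l =>
      match l with
      | none => .load (fun _ => none) .halt
      | some l => code c some none l }

/-- A function is computable in polynomial time if a program computes it in that time. -/
theorem computable_of_runs [DecidableEq K] [Fintype K] [∀ k, Fintype (Γ k)] (k₀ k₁ : K)
    (c : Cmd Γ) {α : Type} {A B : Type} (eA : Γ k₀ ≃ A) (eB : Γ k₁ ≃ B)
    (ea : α → List A) (f : α → List B) (time : Polynomial ℕ)
    (h : ∀ a, ∃ t ≤ time.eval (ea a).length,
      Runs c (update (fun _ => []) k₀ ((ea a).map eA.symm)) t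
        (update (fun _ => []) k₁ ((f a).map eB.symm))) :
    Nonempty (TM2ComputableInPolyTime ea (id : List B → List B) f) := by
  classical
  refine ⟨{ tm := machine k₀ k₁ c, inputAlphabet := eA, outputAlphabet := eB,
            -- The additional step is the final `.load`, which clears the held symbol: `haltList`
            -- demands the initial state of the finite control.
            time := time + 1, outputsFun := fun a => ?_ }⟩
  -- The number of steps is data of the evaluation, so it is extracted by choice.
  have ht := (h a).choose_spec
  have hex := ht.2.steps (m := (machine k₀ k₁ c).m) some none (fun l => rfl) none
  refine ⟨⟨(h a).choose + 1, ?_⟩, ?_⟩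
  · rw [add_comm, iterate_add_apply]
    obtain ⟨v', hv'⟩ := hex
    have h1 : (some (initList (machine k₀ k₁ c) (List.map eA.invFun (ea a))) :
        Option (machine k₀ k₁ c).Cfg) = some ⟨some (some (entry c)), none,
          update (fun _ => []) k₀ ((ea a).map eA.symm)⟩ := by
      congr 1
      unfold initList
      congr 1
      exact (update_nil_eq_dite (Γ := Γ) k₀ _).symm
    have h2 : (flip bind (machine k₀ k₁ c).step)^[(h a).choose]
        (some (initList (machine k₀ k₁ c) (List.map eA.invFun (ea a)))) =
        some ⟨some none, v', update (fun _ => []) k₁ ((f a).map eB.symm)⟩ := by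
      rw [h1]; exact hv'
    refine (congrArg _ h2).trans ?_
    simp only [iterate_one, flip, Option.map_some]
    change some _ = some _
    congr 1
    unfold haltList
    simp only [machine, TM2.stepAux]
    congr 1
    exact update_nil_eq_dite (Γ := Γ) k₁ _
  · simpa using ht.1

end Cmd
end ONOSF

/-! ### The extractor: halving a committee, passing a baton, reading the leader's next block. -/

namespace ONOSF

/-- The state of a player: out of the committee, in it, or holding the baton. -/
inductive Mark
  | idle | wait | hold
  deriving DecidableEq

/-- Record the vote `b` on a stack that holds the surplus of the more frequent vote. -/
def balStep (D : List Bool) (b : Bool) : List Bool :=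
  match D with
  | [] => [b]
  | d :: D' => if d = b then b :: d :: D' else D'

/-- The surplus of the votes of the waiting players. -/
def surplus (z : List (Mark × Bool)) : List Bool :=
  z.foldl (fun D p => if p.1 = .wait then balStep D p.2 else D) []

/-- A vote that at most half of the waiting players gave. -/
def minority (D : List Bool) : Bool :=
  match D with
  | [] => false
  | d :: _ => !d

/-- Keep the waiting players whose vote is in the minority. -/
def halveMask (z : List (Mark × Bool)) : List Mark :=
  z.map fun p => if p.1 = .wait ∧ p.2 = minority (surplus z) then .wait else .idle

/-- Halve the committee `k` times, according to the first `k` bits of the blocks. -/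
def shrink : ℕ → List Mark → List (List Bool) → List Mark
  | 0, m, _ => m
  | k + 1, m, row =>
      shrink k (halveMask (m.zip (row.map fun b => b.headD false))) (row.map List.tail)

/-- The number with the binary digits `l`, the most significant first. -/
def bitsVal (l : List Bool) : ℕ := l.foldl (fun a b => 2 * a + b.toNat) 0

/-- The bits of the blocks of the holders of the baton. -/
def heldBits (m : List Mark) (row : List (List Bool)) : List Bool :=
  (m.zip row).flatMap fun p => if p.1 = .hold then p.2 else []

/-- Give the baton to the waiting player number `v`, and retire its present holder. -/
def pick : Option ℕ → List Mark → List Mark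
  | _, [] => []
  | none, .wait :: m => .wait :: pick none m
  | some 0, .wait :: m => .hold :: pick none m
  | some (v + 1), .wait :: m => .wait :: pick (some v) m
  | o, _ :: m => .idle :: pick o m

/-- The holder of the baton passes it to a waiting player that its block determines. -/
def passBaton (M : ℕ) (m : List Mark) (row : List (List Bool)) : List Mark :=
  if min (m.count .wait) M = 0 then m
  else pick (some (bitsVal (heldBits m row) % M.factorial % min (m.count .wait) M)) m

/-- Row number `t` of the blocks. -/
def rowOf (N t : ℕ) (bs : List (List Bool)) : List (List Bool) := (bs.drop (t * N)).take N

/-- The players after `t` rounds: `T` rounds of halving, then rounds of passing the baton. -/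
def maskAt (M N T : ℕ) (k : ℕ → ℕ) (bs : List (List Bool)) : ℕ → List Mark
  | 0 => List.replicate N .wait
  | t + 1 =>
      if t < T then shrink (k t) (maskAt M N T k bs t) (rowOf N t bs)
      else passBaton M (maskAt M N T k bs t) (rowOf N t bs)

/-- The position of the last holder of the baton, counted from `i`, and `p` if there is none. -/
def holdPosAux : ℕ → ℕ → List Mark → ℕ
  | _, p, [] => p
  | i, p, x :: m => holdPosAux (i + 1) (if x = .hold then i else p) m

/-- The position of the holder of the baton, `0` if there is none. -/
def holdPos (m : List Mark) : ℕ := holdPosAux 0 0 m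

/-- One step of the schedule of the logarithms of the sizes of the committees. -/
def nextLevel (c L : ℕ) : ℕ := 3 * (Nat.log 2 (L + 1) + c)

/-- The logarithm of the size of the committee after `t` rounds. -/
def level (c ℓ t : ℕ) : ℕ := (nextLevel c)^[t] (Nat.log 2 (ℓ + 1))

/-- Natural numbers cannot decrease forever, so the schedule has a first round without progress;
that is where the halving stops. -/
theorem exists_level_le (c ℓ : ℕ) : ∃ t, level c ℓ t ≤ level c ℓ (t + 1) := by
  by_contra! h
  have : ∀ t, level c ℓ t + t ≤ level c ℓ 0 := by
    intro t
    induction t with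
    | zero => simp
    | succ t ih => have := h t; omega
  have := this (level c ℓ 0 + 1)
  omega

/-- The number of rounds of halving. -/
def rounds (c ℓ : ℕ) : ℕ := Nat.find (exists_level_le c ℓ)

/-- The logarithm of the number of blocks of a player. -/
def logRows (c M ℓ : ℕ) : ℕ := Nat.log 2 (rounds c ℓ + M + 1) + 1

/-- The number of players. -/
def players (c M ℓ : ℕ) : ℕ := ℓ / 2 ^ logRows c M ℓ

/-- The number of halvings in round `t`. -/
def halvings (c M ℓ t : ℕ) : ℕ :=
  -- The levels start from `ℓ`, but there are only about `ℓ / 2 ^ logRows` players: the first round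
  -- saves the halvings that this division has already done.
  level c ℓ t - level c ℓ (t + 1) - if t = 0 then logRows c M ℓ else 0

/-- The blocks of an input. -/
def blocks {ℓ n : ℕ} (x : Fin ℓ → Block n) : List (List Bool) :=
  List.ofFn fun i => List.ofFn (x i)

/-- The players after `t` rounds on the input `x`. -/
def maskOf (c M : ℕ) {ℓ n : ℕ} (x : Fin ℓ → Block n) (t : ℕ) : List Mark :=
  maskAt M (players c M ℓ) (rounds c ℓ) (halvings c M ℓ) (blocks x) t

/-- The index of the block that is the output. -/
def leaderIdx (c M : ℕ) {ℓ n : ℕ} (x : Fin ℓ → Block n) : ℕ :=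
  (rounds c ℓ + M) * players c M ℓ + holdPos (maskOf c M x (rounds c ℓ + M))

/-- The extractor: the next block of an elected leader. -/
def ext (c M ℓ n : ℕ) (x : Fin ℓ → Block n) : Block n :=
  if h : leaderIdx c M x < ℓ then x ⟨leaderIdx c M x, h⟩ else fun _ => false

end ONOSF

/-! ### The memory of the program and a calculus of running times. -/

namespace ONOSF
open Function

/-- The instructions for the main loop. -/
inductive Instr
  | bit | next | pass
  deriving DecidableEq

instance : Fintype Mark := ⟨{.idle, .wait, .hold}, fun x => by cases x <;> simp⟩

instance : Fintype Instr := ⟨{.bit, .next, .pass}, fun x => by cases x <;> simp⟩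

/-- The stacks of the program. -/
inductive Stack
  | inp | aux | out | nn | cnt | a | b | e | g | tt | flag | word | prog | mask | mq | bal | reg | sel
  deriving DecidableEq

instance : Fintype Stack :=
  ⟨{.inp, .aux, .out, .nn, .cnt, .a, .b, .e, .g, .tt, .flag, .word, .prog, .mask, .mq, .bal, .reg,
    .sel}, fun x => by cases x <;> simp⟩

/-- The alphabets of the stacks. -/
@[reducible] def Sym (M : ℕ) : Stack → Type
  | .inp | .aux => Option Bool
  | .out | .bal => Bool
  | .nn | .cnt | .a | .b | .e | .g | .tt | .flag => Unit
  | .word | .prog => Instr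
  | .mask => Mark
  | .mq => Mark × Bool
  | .reg => Fin (M + 1) × Fin M.factorial
  | .sel => Option (Fin (M + 1))

instance (M : ℕ) : ∀ k, Fintype (Sym M k)
  | .inp | .aux => inferInstanceAs (Fintype (Option Bool))
  | .out | .bal => inferInstanceAs (Fintype Bool)
  | .nn | .cnt | .a | .b | .e | .g | .tt | .flag => inferInstanceAs (Fintype Unit)
  | .word | .prog => inferInstanceAs (Fintype Instr)
  | .mask => inferInstanceAs (Fintype Mark)
  | .mq => inferInstanceAs (Fintype (Mark × Bool))
  | .reg => inferInstanceAs (Fintype (Fin (M + 1) × Fin M.factorial))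
  | .sel => inferInstanceAs (Fintype (Option (Fin (M + 1))))

/-- The contents of the stacks of the program; the unary counters are given by numbers. -/
structure Mem (M : ℕ) where
  inp : List (Option Bool) := []
  aux : List (Option Bool) := []
  out : List Bool := []
  nn : ℕ := 0
  cnt : ℕ := 0
  a : ℕ := 0
  b : ℕ := 0
  e : ℕ := 0
  g : ℕ := 0
  tt : ℕ := 0
  flag : ℕ := 0
  word : List Instr := []
  prog : List Instr := []
  mask : List Mark := []
  mq : List (Mark × Bool) := []
  bal : List Bool := []
  reg : List (Fin (M + 1) × Fin M.factorial) := []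
  sel : List (Option (Fin (M + 1))) := []

variable {M : ℕ}

/-- The stacks of a memory. -/
def Mem.store (s : Mem M) : Cmd.Store (Sym M)
  | .inp => s.inp
  | .aux => s.aux
  | .out => s.out
  | .nn => List.replicate s.nn ()
  | .cnt => List.replicate s.cnt ()
  | .a => List.replicate s.a ()
  | .b => List.replicate s.b ()
  | .e => List.replicate s.e ()
  | .g => List.replicate s.g ()
  | .tt => List.replicate s.tt ()
  | .flag => List.replicate s.flag ()
  | .word => s.word
  | .prog => s.prog
  | .mask => s.mask
  | .mq => s.mq
  | .bal => s.bal
  | .reg => s.reg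
  | .sel => s.sel

namespace Cmd

/-- `Exec c s s' B`: the program `c` takes the memory `s` to `s'` in at most `B` steps. -/
def Exec (c : Cmd (Sym M)) (s s' : Mem M) (B : ℕ) : Prop := ∃ t ≤ B, Runs c s.store t s'.store

variable {c d : Cmd (Sym M)} {s s' s'' : Mem M} {B B' : ℕ}

theorem Exec.mono (h : Exec c s s' B) (hB : B ≤ B') : Exec c s s' B' := by
  obtain ⟨t, ht, hr⟩ := h
  exact ⟨t, ht.trans hB, hr⟩

theorem Exec.seq (h : Exec c s s' B) (h' : Exec d s' s'' B') :
    Exec (c.seq d) s s'' (B + B') := by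
  obtain ⟨t, ht, hr⟩ := h
  obtain ⟨t', ht', hr'⟩ := h'
  exact ⟨t + t', by omega, hr.seq hr'⟩

theorem Exec.skip : Exec skip s s 1 := ⟨1, le_rfl, .skip _⟩

theorem Exec.push {k : Stack} {x : Sym M k} (h : s'.store = update s.store k (x :: s.store k)) :
    Exec (push k x) s s' 1 := ⟨1, le_rfl, h ▸ .push _ _ _⟩

theorem Exec.pop_nil {k : Stack} {f : Option (Sym M k) → Cmd (Sym M)} (h : s.store k = [])
    (h' : Exec (f none) s s' B) : Exec (pop k f) s s' (B + 1) := by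
  obtain ⟨t, ht, hr⟩ := h'
  exact ⟨t + 1, by omega, .pop_nil h hr⟩

/-- The premise writes the larger store as a push onto the smaller one; for concrete `Mem` records
it is then checked stack by stack with `rfl`. -/
theorem Exec.pop_cons {k : Stack} {f : Option (Sym M k) → Cmd (Sym M)} {x : Sym M k}
    (s₁ : Mem M) (h : s.store = update s₁.store k (x :: s₁.store k))
    (h' : Exec (f (some x)) s₁ s' B) : Exec (pop k f) s s' (B + 1) := by
  obtain ⟨t, ht, hr⟩ := h'
  refine ⟨t + 1, by omega, .pop_cons (a := x) (r := s₁.store k) (by simp [h]) ?_⟩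
  rwa [h, update_idem, update_eq_self]

theorem Exec.loop_nil {k : Stack} {halt : Sym M k → Bool} {body : Sym M k → Cmd (Sym M)}
    (h : s.store k = []) : Exec (loop k halt body) s s 1 := ⟨1, le_rfl, .loop_nil h⟩

theorem Exec.loop_halt {k : Stack} {halt : Sym M k → Bool} {body : Sym M k → Cmd (Sym M)}
    {x : Sym M k} (h : s.store = update s'.store k (x :: s'.store k)) (hx : halt x = true) :
    Exec (loop k halt body) s s' 1 := by
  have := Runs.loop_halt (body := body) (S := s.store) (a := x) (r := s'.store k)
    (by simp [h]) hx
  rw [h, update_idem, update_eq_self, ← h] at this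
  exact ⟨1, le_rfl, this⟩

theorem Exec.loop_cons {k : Stack} {halt : Sym M k → Bool} {body : Sym M k → Cmd (Sym M)}
    {x : Sym M k} (s₁ s₂ : Mem M) (h : s.store = update s₁.store k (x :: s₁.store k))
    (hx : halt x = false) (h₁ : Exec (body x) s₁ s₂ B)
    (h₂ : Exec (loop k halt body) s₂ s' B') : Exec (loop k halt body) s s' (B + B' + 1) := by
  obtain ⟨t, ht, hr⟩ := h₁
  obtain ⟨t', ht', hr'⟩ := h₂
  refine ⟨t + t' + 1, by omega, .loop_cons (a := x) (r := s₁.store k) (by simp [h]) hx ?_ hr'⟩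
  rwa [h, update_idem, update_eq_self]

end Cmd
end ONOSF

/-! ### Unary arithmetic and the program that writes the schedule. -/

namespace ONOSF
open Function
variable {M : ℕ}
/-- The instructions of the last `d` of `T` rounds with `k t` halvings in round `t`. -/
def roundsWord (k : ℕ → ℕ) (T : ℕ) : ℕ → List Instr
  | 0 => []
  | d + 1 => List.replicate (k (T - (d + 1))) .bit ++ .next :: roundsWord k T d

theorem level_succ (c ℓ t : ℕ) : level c ℓ (t + 1) = nextLevel c (level c ℓ t) := by
  simp only [level, iterate_succ_apply']

theorem level_lt {c ℓ t : ℕ} (h : t < rounds c ℓ) : level c ℓ (t + 1) < level c ℓ t := by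
  have := Nat.find_min (exists_level_le c ℓ) h
  omega

/-- At least one unit of the level is lost per round, so the initial level bounds the number of
rounds; the time bounds rest on this. -/
theorem level_le_zero {c ℓ t : ℕ} (h : t ≤ rounds c ℓ) : level c ℓ t + t ≤ level c ℓ 0 := by
  induction t with
  | zero => simp
  | succ t ih => have := ih (by omega); have := level_lt (c := c) (ℓ := ℓ) (t := t) (by omega); omega

namespace Cmd

variable {c d : Cmd (Sym M)} {s s' s'' : Mem M} {B B' : ℕ}

/-- Run `body` for each symbol that is popped from a stack. -/
abbrev each (k : Stack) (body : Sym M k → Cmd (Sym M)) : Cmd (Sym M) := loop k (fun _ => false) body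

/-- The loop rule: `mem l y` is the invariant, with `l` the symbols still on the stack and `y` the
state accumulated so far, so the loop computes a fold. -/
theorem Exec.each_list {k : Stack} {body : Sym M k → Cmd (Sym M)} {α : Type}
    (mem : List (Sym M k) → α → Mem M) (next : α → Sym M k → α) (T : ℕ)
    (hnil : ∀ y, (mem [] y).store k = [])
    (hcons : ∀ x l y, (mem (x :: l) y).store = update (mem l y).store k (x :: (mem l y).store k))
    (hbody : ∀ x l y, Exec (body x) (mem l y) (mem l (next y x)) T) (l : List (Sym M k)) (y : α) :
    Exec (each k body) (mem l y) (mem [] (l.foldl next y)) (l.length * (T + 1) + 1) := by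
  induction l generalizing y with
  | nil => exact (Exec.loop_nil (hnil y)).mono (by omega)
  | cons x l ih =>
    refine (Exec.loop_cons (mem l y) _ (hcons x l y) rfl (hbody x l y) (ih _)).mono ?_
    simp only [List.length_cons]
    linarith

theorem Exec.each_count {k : Stack} {body : Sym M k → Cmd (Sym M)} {α : Type} (x : Sym M k)
    (mem : ℕ → α → Mem M) (next : α → α) (T : ℕ)
    (hnil : ∀ y, (mem 0 y).store k = [])
    (hcons : ∀ n y, (mem (n + 1) y).store = update (mem n y).store k (x :: (mem n y).store k))
    (hbody : ∀ n y, Exec (body x) (mem n y) (mem n (next y)) T) (n : ℕ) (y : α) :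
    Exec (each k body) (mem n y) (mem 0 (next^[n] y)) (n * (T + 1) + 1) := by
  induction n generalizing y with
  | zero => exact (Exec.loop_nil (hnil y)).mono (by omega)
  | succ n ih =>
    refine (Exec.loop_cons (mem n y) _ (hcons n y) rfl (hbody n y) (ih _)).mono ?_
    linarith

theorem Exec.of (h : Exec c s s' B) (hs : s' = s'') (hB : B ≤ B') : Exec c s s'' B' :=
  hs ▸ h.mono hB

/-- Repeat a program a fixed number of times. -/
def reps (c : Cmd (Sym M)) : ℕ → Cmd (Sym M)
  | 0 => skip
  | n + 1 => seq c (reps c n)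

theorem exec_reps {T : ℕ} (mem : ℕ → Mem M) (h : ∀ n, Exec c (mem n) (mem (n + 1)) T) (n i : ℕ) :
    Exec (reps c n) (mem i) (mem (i + n)) (n * T + 1) := by
  induction n generalizing i with
  | zero => exact Exec.skip.of rfl (by omega)
  | succ n ih =>
    exact ((h i).seq (ih (i + 1))).of (by congr 1; omega) (by linarith)

/-- Halve the counter `a`, adding the result to `e`. -/
def half : Cmd (Sym M) :=
  each .a fun _ => pop .a fun o => match o with
    | none => skip
    | some _ => push .e ()

theorem exec_half (n : ℕ) (s : Mem M) :
    Exec half { s with a := n } { s with a := 0, e := s.e + n / 2 } (4 * n + 1) := by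
  induction n using Nat.strong_induction_on generalizing s with
  | _ n ih =>
    match n with
    | 0 => exact (Exec.loop_nil rfl).mono (by omega)
    | 1 =>
      exact (Exec.loop_cons (x := ()) { s with a := 0 } { s with a := 0 }
        (by funext k; cases k <;> rfl) rfl (.pop_nil rfl .skip) (.loop_nil rfl)).mono (by omega)
    | n + 2 =>
      refine (Exec.loop_cons (x := ()) { s with a := n + 1 } { s with a := n, e := s.e + 1 }
        (by funext k; cases k <;> rfl) rfl (.pop_cons (x := ()) { s with a := n }
          (by funext k; cases k <;> rfl) (.push (by funext k; cases k <;> rfl)))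
        (ih n (by omega) { s with e := s.e + 1 })).of ?_ (by omega)
      congr 1
      simp only
      omega

theorem exec_e_to_a (n : ℕ) (s : Mem M) :
    Exec (each .e fun _ => push .a ()) { s with e := n } { s with e := 0, a := s.a + n }
      (2 * n + 1) :=
  (Exec.each_count (k := .e) () (fun n y => { s with e := n, a := y }) (· + 1) 1 (fun _ => rfl)
    (fun n y => by funext k; cases k <;> rfl)
    (fun n y => .push (by funext k; cases k <;> rfl)) n s.a).of (by simp) (by omega)

/-- Add the logarithm of the counter `a`, increased by one, to `b`. -/
def log : Cmd (Sym M) :=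
  each .a fun _ => seq half (seq (each .e fun _ => push .a ()) (push .b ()))

theorem exec_log (n : ℕ) (s : Mem M) (he : s.e = 0) :
    Exec log { s with a := n } { s with a := 0, b := s.b + Nat.log 2 (n + 1) } (12 * n + 1) := by
  induction n using Nat.strong_induction_on generalizing s with
  | _ n ih =>
    match n with
    | 0 => exact (Exec.loop_nil rfl).of (by simp) (by omega)
    | n + 1 =>
      have h1 : Exec half { s with a := n } { s with a := 0, e := n / 2 } (4 * n + 1) :=
        (exec_half n s).of (by simp [he]) le_rfl
      have h2 := exec_e_to_a (n / 2) { s with a := 0 }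
      have h3 := ih (n / 2) (by omega) { s with b := s.b + 1 } he
      simp only [zero_add] at h2
      have h4 : Exec (push .b ()) { s with a := n / 2, e := 0 }
          { s with a := n / 2, b := s.b + 1 } 1 :=
        .push (by funext k; cases k <;> first | rfl | simp [Mem.store, he])
      have h5 := Exec.loop_cons (k := .a) (x := ()) (s := { s with a := n + 1 }) (halt := fun _ => false)
        (body := fun _ => seq half (seq (each .e fun _ => push .a ()) (push .b ())))
        { s with a := n } { s with a := n / 2, b := s.b + 1 }
        (by funext k; cases k <;> rfl) rfl (h1.seq (h2.seq h4)) h3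
      refine h5.of ?_ (by omega)
      -- Half of `n + 2` is `n / 2 + 1`. Keeping the counter one below the argument of the logarithm
      -- lets the empty stack stand for the argument `1`, where the recursion ends.
      · have : Nat.log 2 (n + 1 + 1) = Nat.log 2 (n / 2 + 1) + 1 := by
          rw [Nat.log_of_one_lt_of_le (by norm_num) (by omega)]
          congr 2
          omega
        simp only [this]
        congr 1
        omega

/-- Replace the level in `b` by the next level, and put the difference on `g`. -/
def advance (c : ℕ) : Cmd (Sym M) :=
  seq (each .b fun _ => seq (push .a ()) (push .g ())) <|
  seq log <|
  seq (reps (push .b ()) c) <|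
  seq (each .b fun _ => seq (push .a ()) (seq (push .a ()) (push .a ()))) <|
  each .a fun _ => seq (push .b ()) (pop .g fun _ => skip)

theorem exec_advance (c L : ℕ) (s : Mem M) (ha : s.a = 0) (he : s.e = 0) (hg : s.g = 0) :
    Exec (advance c) { s with b := L }
      { s with b := nextLevel c L, g := L - nextLevel c L } (50 * (L + c + 1)) := by
  have h1 := Exec.each_count (k := .b) (M := M) ()
    (body := fun _ => seq (push .a ()) (push .g ()))
    (fun n y => { s with b := n, a := y, g := y }) (· + 1) 2 (fun _ => rfl)
    (fun n y => by funext k; cases k <;> rfl)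
    (fun n y => (Exec.push (s' := { s with b := n, a := y + 1, g := y })
      (by funext k; cases k <;> rfl)).seq (.push (by funext k; cases k <;> rfl))) L 0
  have h2 := exec_log L { s with b := 0, g := L } he
  have h3 := exec_reps (c := push .b ()) (M := M) (T := 1) (fun n => { s with b := n, a := 0, g := L })
    (fun n => .push (by funext k; cases k <;> rfl)) c (Nat.log 2 (L + 1))
  have h4 := Exec.each_count (k := .b) (M := M) ()
    (body := fun _ => seq (push .a ()) (seq (push .a ()) (push .a ())))
    (fun n y => { s with b := n, a := y, g := L }) (· + 3) 3 (fun _ => rfl)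
    (fun n y => by funext k; cases k <;> rfl)
    (fun n y => (Exec.push (s' := { s with b := n, a := y + 1, g := L })
      (by funext k; cases k <;> rfl)).seq ((Exec.push (s' := { s with b := n, a := y + 2, g := L })
      (by funext k; cases k <;> rfl)).seq (.push (by funext k; cases k <;> rfl))))
    (Nat.log 2 (L + 1) + c) 0
  -- Every unit that enters `b` removes one from `g` if there is one, so `g` ends with the truncated
  -- difference of the levels. An empty `g` is the signal that the levels have stopped decreasing.
  have h5 := Exec.each_count (k := .a) (M := M) ()
    (body := fun _ => seq (push .b ()) (pop .g fun _ => skip))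
    (fun n y => { s with a := n, b := y, g := L - y }) (· + 1) 3 (fun _ => rfl)
    (fun n y => by funext k; cases k <;> rfl)
    (fun n y => by
        have h1 : Exec (push .b ()) { s with a := n, b := y, g := L - y }
            { s with a := n, b := y + 1, g := L - y } 1 := .push (by funext k; cases k <;> rfl)
        refine Exec.seq (B' := 2) h1 ?_
        rcases hy : L - y with _ | z
        · exact Exec.of (Exec.pop_nil rfl .skip) (by congr 1; omega) (by omega)
        · exact Exec.of (Exec.pop_cons (x := ()) { s with a := n, b := y + 1, g := z }
            (by funext k; cases k <;> rfl) .skip) (by congr 1; omega) (by omega))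
    (nextLevel c L) 0
  have hL : Nat.log 2 (L + 1) ≤ L := by
    have := Nat.log_lt_self 2 (x := L + 1) (by omega)
    omega
  simp only [add_right_iterate, zero_add, mul_one, tsub_zero, smul_eq_mul]
    at h1 h2 h3 h4 h5
  rw [show (Nat.log 2 (L + 1) + c) * 3 = nextLevel c L by rw [nextLevel]; ring] at h4
  have h6 := h1.seq (h2.seq (h3.seq (h4.seq h5)))
  have e1 : ({ s with b := L, a := 0, g := 0 } : Mem M) = { s with b := L } := by
    cases s; simp_all
  have e2 : ({ s with b := nextLevel c L, a := 0, g := L - nextLevel c L } : Mem M) =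
      { s with b := nextLevel c L, g := L - nextLevel c L } := by
    cases s; simp_all
  rw [e1, e2] at h6
  refine h6.mono ?_
  simp only [nextLevel]
  omega

/-- Write the instructions for the rounds, in reverse order, on `word`, and count the rounds. -/
def plan (c : ℕ) : Cmd (Sym M) :=
  each .flag fun _ => seq (advance c) <| pop .g fun o => match o with
    | none => each .b fun _ => skip
    | some _ => seq (push .g ()) <| seq (each .g fun _ => push .word .bit) <|
        seq (push .word .next) <| seq (push .tt ()) (push .flag ())

/-- The program does not know the number of rounds beforehand: it goes on until `g` comes out empty,
which by minimality happens exactly after `rounds c ℓ` rounds. The instructions are pushed, hence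
stored in reverse. -/
theorem exec_plan (c ℓ : ℕ) (d : ℕ) (hd : d ≤ rounds c ℓ) (s : Mem M) (ha : s.a = 0)
    (he : s.e = 0) (hg : s.g = 0) :
    Exec (plan c) { s with flag := 1, b := level c ℓ (rounds c ℓ - d) }
      { s with
        flag := 0, b := 0, tt := s.tt + d
        word := (roundsWord (fun t => level c ℓ t - level c ℓ (t + 1)) (rounds c ℓ) d).reverse ++
          s.word }
      ((d + 1) * (70 * (level c ℓ 0 + c + 1) + 20)) := by
  induction d generalizing s with
  | zero =>
    have hle : level c ℓ (rounds c ℓ) ≤ nextLevel c (level c ℓ (rounds c ℓ)) := by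
      rw [← level_succ]; exact Nat.find_spec (exists_level_le c ℓ)
    have hl0 := level_le_zero (c := c) (ℓ := ℓ) le_rfl
    set L := level c ℓ (rounds c ℓ) with hL
    have h1 := exec_advance c L { s with flag := 0 } ha he hg
    rw [Nat.sub_eq_zero_of_le hle] at h1
    have h2 := Exec.each_count (k := .b) (M := M) ()
      (body := fun _ => skip)
      (fun n (_ : Unit) => { s with b := n, g := 0, flag := 0 }) id 1 (fun _ => rfl)
      (fun n y => by funext k; cases k <;> rfl)
      (fun n y => .skip) (nextLevel c L) ()
    have hlog : Nat.log 2 (L + 1) ≤ L := by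
      have := Nat.log_lt_self 2 (x := L + 1) (by omega)
      omega
    refine (Exec.loop_cons (x := ()) { s with b := L, flag := 0 } _
        (by funext k; cases k <;> rfl) rfl (h1.seq (.pop_nil rfl h2)) (.loop_nil rfl)).of ?_ ?_
    · cases s; simp_all [roundsWord]
    · simp only [nextLevel]; omega
  | succ d ih =>
    obtain ⟨t, ht⟩ : ∃ t, t = rounds c ℓ - (d + 1) := ⟨_, rfl⟩
    have hlt := level_lt (c := c) (ℓ := ℓ) (t := t) (by omega)
    have hl0 := level_le_zero (c := c) (ℓ := ℓ) (t := t) (by omega)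
    rw [level_succ] at hlt
    rw [← ht]
    have h1 := exec_advance c (level c ℓ t) { s with flag := 0 } ha he hg
    obtain ⟨z, hz⟩ : ∃ z, level c ℓ t - nextLevel c (level c ℓ t) = z + 1 :=
      ⟨level c ℓ t - nextLevel c (level c ℓ t) - 1, by omega⟩
    rw [hz] at h1
    have h2 := Exec.each_count (k := .g) (M := M) () (body := fun _ => push .word .bit)
      (fun n y => { s with b := level c ℓ (t + 1), g := n, word := y, flag := 0 })
      (fun y => .bit :: y) 1 (fun _ => rfl)
      (fun n y => by funext k; cases k <;> rfl)
      (fun n y => .push (by funext k; cases k <;> rfl)) (z + 1) s.word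
    have h3 := ih (by omega) { s with
      tt := s.tt + 1
      word := .next :: (List.replicate (z + 1) .bit ++ s.word) } ha he hg
    have hit : ∀ n (w : List Instr), (fun y => Instr.bit :: y)^[n] w = List.replicate n .bit ++ w := by
      intro n
      induction n with
      | zero => simp
      | succ n ih => intro w; rw [iterate_succ_apply', ih]; rfl
    rw [hit] at h2
    rw [show rounds c ℓ - d = t + 1 by omega] at h3
    rw [level_succ] at h2 h3
    refine (Exec.loop_cons (x := ()) { s with b := level c ℓ t, flag := 0 } _
        (by funext k; cases k <;> rfl) rfl (h1.seq (.pop_cons (x := ())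
          { s with b := nextLevel c (level c ℓ t), g := z, flag := 0 }
          (by funext k; cases k <;> rfl)
          ((Exec.push (s' := { s with b := nextLevel c (level c ℓ t), g := z + 1, flag := 0 })
            (by funext k; cases k <;> rfl)).seq (h2.seq
          ((Exec.push (s' := { s with
              b := nextLevel c (level c ℓ t), g := 0, flag := 0
              word := .next :: (List.replicate (z + 1) .bit ++ s.word) })
            (by funext k; cases k <;> rfl)).seq
          ((Exec.push (s' := { s with
              b := nextLevel c (level c ℓ t), g := 0, flag := 0, tt := s.tt + 1
              word := .next :: (List.replicate (z + 1) .bit ++ s.word) })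
            (by funext k; cases k <;> rfl)).seq
          (.push (s' := { s with
              b := nextLevel c (level c ℓ t), flag := 1, tt := s.tt + 1
              word := .next :: (List.replicate (z + 1) .bit ++ s.word) })
            (by funext k; cases k <;> first | rfl | simp [Mem.store, hg])))))))) h3).of ?_ ?_
    · simp only [roundsWord, ← ht, level_succ, hz]
      congr 1
      · omega
      · simp
    · have : (d + 1 + 1) * (70 * (level c ℓ 0 + c + 1) + 20) =
        (d + 1) * (70 * (level c ℓ 0 + c + 1) + 20) + (70 * (level c ℓ 0 + c + 1) + 20) := by ring
      omega

end Cmd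
end ONOSF

/-! ### The program for one halving. -/

namespace ONOSF
open Function
variable {M : ℕ}

/-- The word of a list of blocks. -/
def enc (bs : List (List Bool)) : List (Option Bool) := bs.flatMap fun b => b.map some ++ [none]

@[simp] theorem enc_nil : enc [] = [] := rfl

theorem enc_cons (b : List Bool) (bs : List (List Bool)) :
    enc (b :: bs) = b.map some ++ none :: enc bs := by
  simp [enc]

theorem enc_append (bs bs' : List (List Bool)) : enc (bs ++ bs') = enc bs ++ enc bs' := by
  simp [enc]

theorem length_enc_tail (bs : List (List Bool)) :
    (enc (bs.map List.tail)).length ≤ (enc bs).length := by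
  induction bs with
  | nil => simp
  | cons b bs ih =>
    simp only [List.map_cons, enc_cons, List.length_append, List.length_map, List.length_tail,
      List.length_cons]
    omega

theorem length_balStep (D : List Bool) (b : Bool) : (balStep D b).length ≤ D.length + 1 := by
  unfold balStep
  split
  · simp
  · split <;> simp <;> omega

theorem length_foldl_balStep (z : List (Mark × Bool)) (D : List Bool) :
    (z.foldl (fun D p => if p.1 = .wait then balStep D p.2 else D) D).length ≤
      D.length + z.length := by
  induction z generalizing D with
  | nil => simp
  | cons p z ih =>
    refine (ih _).trans ?_
    have := length_balStep D p.2
    simp only [List.length_cons]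
    split <;> omega

namespace Cmd
variable {c d : Cmd (Sym M)} {s s' s'' : Mem M} {B B' : ℕ}

/-- Move the rest of a block from `inp` to `aux`. -/
def moveBlock : Cmd (Sym M) :=
  seq (loop .inp Option.isNone fun o => push .aux o) (push .aux none)

theorem exec_moveBlock (l : List Bool) (r y : List (Option Bool)) (s : Mem M) :
    Exec moveBlock { s with inp := l.map some ++ none :: r, aux := y }
      { s with inp := r, aux := none :: (l.map some).reverse ++ y } (2 * l.length + 2) := by
  suffices h : ∀ y, Exec (loop .inp Option.isNone fun o => push .aux o)
      { s with inp := l.map some ++ none :: r, aux := y }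
      { s with inp := r, aux := (l.map some).reverse ++ y } (2 * l.length + 1) from
    Exec.of (Exec.seq (h y) (Exec.push
      (s' := { s with inp := r, aux := none :: (l.map some).reverse ++ y })
      (by funext k; cases k <;> rfl))) rfl (by omega)
  induction l with
  | nil =>
    intro y
    exact Exec.of (Exec.loop_halt (x := none) (s' := { s with inp := r, aux := y })
      (by funext k; cases k <;> rfl) rfl) (by simp) (by omega)
  | cons b l ih =>
    intro y
    have h1 : Exec (push .aux (some b)) { s with inp := l.map some ++ none :: r, aux := y }
        { s with inp := l.map some ++ none :: r, aux := some b :: y } 1 :=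
      .push (by funext k; cases k <;> rfl)
    refine Exec.of (Exec.loop_cons (x := some b)
      { s with inp := l.map some ++ none :: r, aux := y } _
      (by funext k; cases k <;> rfl) rfl h1 (ih (some b :: y))) (by simp) ?_
    simp only [List.length_cons]
    omega

/-- Record a vote. -/
def vote (b : Bool) : Cmd (Sym M) :=
  pop .bal fun o => match o with
    | none => push .bal b
    | some d => if d = b then seq (push .bal d) (push .bal b) else skip

theorem exec_vote (b : Bool) (s : Mem M) :
    Exec (vote b) s { s with bal := balStep s.bal b } 3 := by
  rcases h : s.bal with _ | ⟨d, D⟩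
  · exact Exec.of (Exec.pop_nil h (Exec.push (s' := { s with bal := [b] })
      (by funext k; cases k <;> first | rfl | simp [Mem.store, h]))) (by simp [balStep]) (by omega)
  · have h0 : s.store = update (Mem.store { s with bal := D }) .bal (d :: D) := by
      funext k; cases k <;> first | rfl | simp [Mem.store, h]
    by_cases hd : d = b
    · refine Exec.of (Exec.pop_cons (x := d) { s with bal := D } h0
        (B := 2) (s' := { s with bal := b :: d :: D }) ?_) (by simp [balStep, hd]) (by omega)
      simp only [hd, if_true]
      exact (Exec.push (s' := { s with bal := b :: D })
        (by funext k; cases k <;> rfl)).seq (.push (by funext k; cases k <;> rfl))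
    · refine Exec.of (Exec.pop_cons (x := d) { s with bal := D } h0
        (B := 2) (s' := { s with bal := D }) ?_) (by simp [balStep, hd]) (by omega)
      simp only [hd, if_false]
      exact Exec.skip.mono (by omega)

/-- Read the vote of a player in the state `m`. -/
def readVote (m : Mark) : Cmd (Sym M) :=
  pop .inp fun o =>
    seq (match o with
      | some none => push .inp none
      | _ => skip) <|
    seq moveBlock <| seq (push .mq (m, (o.getD none).getD false)) <|
    if m = .wait then vote ((o.getD none).getD false) else skip

theorem exec_readVote (m : Mark) (bl : List Bool) (bs : List (List Bool)) (s : Mem M) :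
    Exec (readVote m) { s with inp := enc (bl :: bs) }
      { s with
        inp := enc bs
        aux := (enc [bl.tail]).reverse ++ s.aux
        mq := (m, bl.headD false) :: s.mq
        bal := if m = .wait then balStep s.bal (bl.headD false) else s.bal }
      (2 * bl.length + 8) := by
  have key : ∀ b : Bool, Exec (seq moveBlock <| seq (push .mq (m, b)) <|
      if m = .wait then vote b else skip) { s with inp := enc (bl.tail :: bs) }
      { s with
        inp := enc bs
        aux := (enc [bl.tail]).reverse ++ s.aux
        mq := (m, b) :: s.mq
        bal := if m = .wait then balStep s.bal b else s.bal }
      (2 * bl.tail.length + 2 + (1 + 3)) := by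
    intro b
    have h1 := exec_moveBlock bl.tail (enc bs) s.aux s
    have h2 : Exec (push .mq (m, b))
      { s with inp := enc bs, aux := (enc [bl.tail]).reverse ++ s.aux }
      { s with inp := enc bs, aux := (enc [bl.tail]).reverse ++ s.aux, mq := (m, b) :: s.mq } 1 :=
      .push (by funext k; cases k <;> rfl)
    rw [enc_cons]
    refine Exec.seq (s' := { s with inp := enc bs, aux := (enc [bl.tail]).reverse ++ s.aux })
      (by simpa [enc_cons] using h1) (h2.seq ?_)
    by_cases hm : m = .wait
    · simp only [hm, if_true]
      exact exec_vote b _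
    · simp only [hm, if_false]
      exact Exec.skip.mono (by omega)
  -- An empty block shows its separator at once. The separator is pushed back for `moveBlock`, and
  -- the vote defaults to `false`, in agreement with `headD`.
  rcases bl with _ | ⟨b, l⟩
  · refine Exec.of (Exec.pop_cons (x := none) { s with inp := enc bs }
      (by funext k; cases k <;> rfl) (Exec.seq (B := 1)
      (s' := { s with inp := enc ([] :: bs) }) ?_ (key false))) rfl (by simp)
    exact .push (by funext k; cases k <;> rfl)
  · refine Exec.of (Exec.pop_cons (x := some b) { s with inp := enc (l :: bs) }
      (by funext k; cases k <;> rfl) (Exec.skip.seq (key b))) rfl ?_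
    simp only [List.tail_cons, List.length_cons]
    omega

theorem exec_readVotes (m : List Mark) (row rest : List (List Bool)) (s : Mem M)
    (hm : m.length = row.length) :
    Exec (each .mask readVote) { s with mask := m, inp := enc (row ++ rest) }
      { s with
        mask := []
        inp := enc rest
        aux := (enc (row.map List.tail)).reverse ++ s.aux
        mq := (m.zip (row.map fun b => b.headD false)).reverse ++ s.mq
        bal := (m.zip (row.map fun b => b.headD false)).foldl
          (fun D p => if p.1 = .wait then balStep D p.2 else D) s.bal }
      (2 * (enc row).length + 9 * m.length + 1) := by
  induction m generalizing row s with
  | nil =>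
    obtain rfl : row = [] := by simpa using hm.symm
    exact Exec.of (Exec.loop_nil rfl) (by simp) (by omega)
  | cons x m ih =>
    obtain ⟨bl, row, rfl⟩ : ∃ a l, row = a :: l := by
      rcases row with _ | ⟨a, l⟩
      · simp at hm
      · exact ⟨a, l, rfl⟩
    have h1 := exec_readVote x bl (row ++ rest) { s with mask := m }
    have h2 := ih row { s with
        aux := (enc [bl.tail]).reverse ++ s.aux
        mq := (x, bl.headD false) :: s.mq
        bal := if x = .wait then balStep s.bal (bl.headD false) else s.bal } (by simpa using hm)
    refine Exec.of (Exec.loop_cons (x := x) { s with mask := m, inp := enc (bl :: (row ++ rest)) } _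
      (by funext k; cases k <;> rfl) rfl h1 h2) ?_ ?_
    · simp [enc_cons]
    · simp only [enc_cons, List.length_append, List.length_map, List.length_cons]
      omega

theorem exec_aux_to_inp (s : Mem M) (y : List (Option Bool)) :
    Exec (each .aux fun o => push .inp o) { s with aux := y }
      { s with inp := y.reverse ++ s.inp, aux := [] } (2 * y.length + 1) :=
  Exec.of (Exec.each_list (k := .aux) (fun l y => { s with aux := l, inp := y }) (fun y o => o :: y)
    1 (fun _ => rfl) (fun x l y => by funext k; cases k <;> rfl)
    (fun x l y => .push (by funext k; cases k <;> rfl)) y s.inp)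
    (by simp) (by omega)

theorem exec_clear_bal (s : Mem M) (D : List Bool) :
    Exec (each .bal fun _ => skip) { s with bal := D } { s with bal := [] } (2 * D.length + 1) :=
  Exec.of (Exec.each_list (k := .bal) (fun l (_ : Unit) => { s with bal := l }) (fun y _ => y)
    1 (fun _ => rfl) (fun x l y => by funext k; cases k <;> rfl)
    (fun x l y => .skip) D ()) rfl (by omega)

theorem exec_mq_to_mask (f : Mark × Bool → Mark) (s : Mem M) (z : List (Mark × Bool)) :
    Exec (each .mq fun p => push .mask (f p)) { s with mq := z.reverse }
      { s with mask := z.map f ++ s.mask, mq := [] } (2 * z.length + 1) :=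
  Exec.of (Exec.each_list (k := .mq) (fun l y => { s with mq := l, mask := y })
    (fun y p => f p :: y) 1 (fun _ => rfl) (fun x l y => by funext k; cases k <;> rfl)
    (fun x l y => .push (by funext k; cases k <;> rfl)) z.reverse s.mask)
    (by
      congr 1
      rw [List.foldl_reverse]
      induction z with
      | nil => rfl
      | cons p z ih => simp [ih]) (by rw [List.length_reverse]; omega)

/-- Halve the committee. -/
def halvePass : Cmd (Sym M) :=
  seq (each .mask readVote) <| seq (each .aux fun o => push .inp o) <|
  pop .bal fun o => seq (each .bal fun _ => skip) <|
    each .mq fun p => push .mask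
      (if p.1 = .wait ∧ p.2 = (match o with | none => false | some d => !d) then .wait else .idle)

/-- The minority is known only after all votes have been read, so players and votes wait on `mq` and
the shortened blocks on `aux`. Both are stored in reverse, and pouring them back restores the order.
-/
theorem exec_halvePass (m : List Mark) (row rest : List (List Bool)) (n Z : ℕ) (p : List Instr)
    (hm : m.length = row.length) (hZ : (enc (row ++ rest)).length ≤ Z) (hZ' : m.length ≤ Z) :
    Exec (M := M) halvePass { nn := n, mask := m, inp := enc (row ++ rest), prog := p }
      { nn := n
        mask := halveMask (m.zip (row.map fun b => b.headD false))
        inp := enc (row.map List.tail ++ rest)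
        prog := p } (20 * Z + 10) := by
  have h1 := exec_readVotes (M := M) m row rest { nn := n, prog := p } hm
  set z := m.zip (row.map fun b => b.headD false) with hz
  have hl : z.length = m.length := by simp [hz, hm]
  have h2 := exec_aux_to_inp (M := M)
    { nn := n, inp := enc rest, mq := z.reverse, bal := surplus z, prog := p } (enc (row.map List.tail)).reverse
  rw [List.reverse_reverse, ← enc_append] at h2
  have hbl : (surplus z).length ≤ z.length := by
    exact (length_foldl_balStep z []).trans (by simp)
  have h3 : ∀ (D : List Bool) (v : Bool), D.length ≤ z.length →
      Exec (M := M) (seq (each .bal fun _ => skip) <| each .mq fun p => push .mask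
      (if p.1 = .wait ∧ p.2 = v then .wait else .idle))
      { nn := n, inp := enc (row.map List.tail ++ rest), mq := z.reverse, bal := D, prog := p }
      { nn := n
        mask := z.map fun p => if p.1 = .wait ∧ p.2 = v then .wait else .idle
        inp := enc (row.map List.tail ++ rest)
        prog := p } (4 * Z + 2) := by
    intro D v hD
    exact Exec.of (Exec.seq (exec_clear_bal
      { nn := n, inp := enc (row.map List.tail ++ rest), mq := z.reverse, prog := p } D)
      (exec_mq_to_mask _ { nn := n, inp := enc (row.map List.tail ++ rest), prog := p } z)) (by simp) (by omega)
  have h4 : Exec (M := M) (pop .bal fun o => seq (each .bal fun _ => skip) <|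
      each .mq fun p => push .mask
      (if p.1 = .wait ∧ p.2 = (match o with | none => false | some d => !d) then .wait else .idle))
      { nn := n
        inp := enc (row.map List.tail ++ rest)
        mq := z.reverse
        bal := surplus z
        prog := p }
      { nn := n, mask := halveMask z, inp := enc (row.map List.tail ++ rest), prog := p } (4 * Z + 2 + 1) := by
    rcases hD : surplus z with _ | ⟨d, D⟩
    · refine Exec.pop_nil rfl (Exec.of (h3 [] false (by simp)) ?_ le_rfl)
      simp only [halveMask, hD]
      rfl
    · rw [hD] at hbl
      refine Exec.pop_cons (x := d)
        { nn := n, inp := enc (row.map List.tail ++ rest), mq := z.reverse, bal := D, prog := p } (by funext k; cases k <;> rfl)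
        (Exec.of (h3 D (!d) (by simp at hbl; omega)) ?_ le_rfl)
      simp only [halveMask, hD]
      rfl
  simp only [List.append_nil] at h1
  refine (h1.seq (h2.seq h4)).mono ?_
  have := length_enc_tail row
  rw [enc_append, List.length_append] at hZ
  simp only [List.length_reverse]
  omega

end Cmd
end ONOSF

/-! ### The programs that drop a row and pass the baton. -/

namespace ONOSF
open Function
variable {M : ℕ}

theorem bitsVal_append (l : List Bool) (b : Bool) :
    bitsVal (l ++ [b]) = 2 * bitsVal l + b.toNat := by
  simp [bitsVal]

namespace Cmd
variable {c d : Cmd (Sym M)} {s s' s'' : Mem M} {B B' : ℕ}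

/-- Drop a block of `inp`. -/
def dropBlock : Cmd (Sym M) := loop .inp Option.isNone fun _ => skip

theorem exec_dropBlock (bs : List (List Bool)) (s : Mem M) :
    Exec dropBlock { s with inp := enc bs } { s with inp := enc bs.tail }
      (2 * (bs.headD []).length + 1) := by
  rcases bs with _ | ⟨bl, bs⟩
  · exact Exec.of (Exec.loop_nil rfl) rfl (by simp)
  simp only [enc_cons, List.tail_cons, List.headD_cons]
  induction bl with
  | nil =>
    exact Exec.of (Exec.loop_halt (x := none) (s' := { s with inp := enc bs })
      (by funext k; cases k <;> rfl) rfl) rfl (by simp)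
  | cons b bl ih =>
    refine Exec.of (Exec.loop_cons (x := some b)
      { s with inp := bl.map some ++ none :: enc bs }
      { s with inp := bl.map some ++ none :: enc bs }
      (by funext k; cases k <;> rfl) rfl .skip ih) rfl ?_
    simp only [List.length_cons]
    omega

/-- Drop the blocks of a row. -/
def dropRow : Cmd (Sym M) :=
  seq (each .mask fun m => seq (push .mq (m, false)) dropBlock)
    (each .mq fun p => push .mask p.1)

theorem exec_dropRow (m : List Mark) (row rest : List (List Bool)) (n Z : ℕ) (p : List Instr)
    (hm : m.length = row.length) (hZ : (enc (row ++ rest)).length ≤ Z) (hZ' : m.length ≤ Z) :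
    Exec (M := M) dropRow { nn := n, mask := m, inp := enc (row ++ rest), prog := p }
      { nn := n, mask := m, inp := enc rest, prog := p } (20 * Z + 10) := by
  have h1 : ∀ q : List (Mark × Bool),
      Exec (M := M) (each .mask fun m => seq (push .mq (m, false)) dropBlock)
      { nn := n, mask := m, inp := enc (row ++ rest), mq := q, prog := p }
      { nn := n, mq := (m.map fun x => (x, false)).reverse ++ q, inp := enc rest, prog := p }
      (2 * (enc row).length + 3 * m.length + 1) := by
    clear hZ hZ'
    induction m generalizing row with
    | nil =>
      obtain rfl : row = [] := by simpa using hm.symm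
      intro q
      exact Exec.of (Exec.loop_nil rfl) (by simp) (by omega)
    | cons x m ih =>
      intro q
      obtain ⟨bl, row, rfl⟩ : ∃ a l, row = a :: l := by
        rcases row with _ | ⟨a, l⟩
        · simp at hm
        · exact ⟨a, l, rfl⟩
      have h2 := exec_dropBlock (M := M) (bl :: (row ++ rest))
        { nn := n, mask := m, mq := (x, false) :: q, prog := p }
      have h3 : Exec (M := M) (push .mq (x, false))
          { nn := n, mask := m, inp := enc (bl :: (row ++ rest)), mq := q, prog := p }
          { nn := n
            mask := m
            inp := enc (bl :: (row ++ rest))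
            mq := (x, false) :: q
            prog := p } 1 := .push (by funext k; cases k <;> rfl)
      refine Exec.of (Exec.loop_cons (x := x) _ _
        (by funext k; cases k <;> rfl) rfl (h3.seq h2) (ih row (by simpa using hm) _)) ?_ ?_
      · simp
      · simp only [enc_cons, List.length_append, List.length_map, List.length_cons,
          List.headD_cons]
        omega
  have h4 := exec_mq_to_mask (M := M) Prod.fst { nn := n, inp := enc rest, prog := p }
    (m.map fun x => (x, false))
  refine Exec.of (Exec.seq (h1 []) (by simpa using h4)) (by simp [comp_def]) ?_
  rw [enc_append, List.length_append] at hZ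
  omega

/-- Change the content of the register. -/
def modReg (f : Fin (M + 1) × Fin M.factorial → Fin (M + 1) × Fin M.factorial) : Cmd (Sym M) :=
  pop .reg fun o => match o with
    | none => skip
    | some r => push .reg (f r)

theorem exec_modReg (f : Fin (M + 1) × Fin M.factorial → Fin (M + 1) × Fin M.factorial) (r)
    (s : Mem M) : Exec (modReg f) { s with reg := [r] } { s with reg := [f r] } 2 :=
  Exec.pop_cons (x := r) { s with reg := [] } (by funext k; cases k <;> rfl)
    (.push (by funext k; cases k <;> rfl))

/-- The register after `k` waiting players were seen and the bits `l` were read. -/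
def regOf (M k : ℕ) (l : List Bool) : Fin (M + 1) × Fin M.factorial :=
  (⟨min k M, by omega⟩, ⟨bitsVal l % M.factorial, Nat.mod_lt _ M.factorial_pos⟩)

/-- Count a waiting player. -/
def regIncr (r : Fin (M + 1) × Fin M.factorial) : Fin (M + 1) × Fin M.factorial :=
  (⟨min (r.1 + 1) M, by omega⟩, r.2)

/-- Read a bit. -/
def regBit (b : Bool) (r : Fin (M + 1) × Fin M.factorial) : Fin (M + 1) × Fin M.factorial :=
  (r.1, ⟨(2 * r.2 + b.toNat) % M.factorial, Nat.mod_lt _ M.factorial_pos⟩)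

theorem regIncr_regOf (k : ℕ) (l : List Bool) : regIncr (regOf M k l) = regOf M (k + 1) l := by
  simp only [regIncr, regOf, Prod.mk.injEq, Fin.mk.injEq, and_true]
  omega

/-- Horner's rule commutes with reduction modulo `M!`, so one symbol of a finite alphabet can hold
the value of a block of any length. -/
theorem regBit_regOf (k : ℕ) (l : List Bool) (b : Bool) :
    regBit b (regOf M k l) = regOf M k (l ++ [b]) := by
  simp only [regBit, regOf, bitsVal_append]
  congr 2
  rw [Nat.add_mod, Nat.mul_mod, Nat.mod_mod, ← Nat.mul_mod, ← Nat.add_mod]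

/-- Scan the block of a player in the state `m`. -/
def scanBlock (m : Mark) : Cmd (Sym M) :=
  seq (push .mq (m, false)) <| seq (if m = .wait then modReg regIncr else skip) <|
    loop .inp Option.isNone fun o => if m = .hold then modReg (regBit (o.getD false)) else skip

theorem exec_scanBlock (x : Mark) (bl : List Bool) (bs : List (List Bool)) (k : ℕ) (l : List Bool)
    (s : Mem M) :
    Exec (scanBlock x) { s with inp := enc (bl :: bs), reg := [regOf M k l] }
      { s with
        inp := enc bs
        mq := (x, false) :: s.mq
        reg := [regOf M (if x = .wait then k + 1 else k) (if x = .hold then l ++ bl else l)] }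
      (3 * bl.length + 5) := by
  have h1 : Exec (push .mq (x, false)) { s with inp := enc (bl :: bs), reg := [regOf M k l] }
      { s with inp := enc (bl :: bs), mq := (x, false) :: s.mq, reg := [regOf M k l] } 1 :=
    .push (by funext k; cases k <;> rfl)
  have h2 : Exec (if x = .wait then modReg regIncr else skip)
      { s with inp := enc (bl :: bs), mq := (x, false) :: s.mq, reg := [regOf M k l] }
      { s with
        inp := enc (bl :: bs)
        mq := (x, false) :: s.mq
        reg := [regOf M (if x = .wait then k + 1 else k) l] } 2 := by
    by_cases hx : x = .wait
    · simp only [hx, if_true]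
      rw [← regIncr_regOf]
      exact exec_modReg regIncr _ { s with inp := enc (bl :: bs), mq := (.wait, false) :: s.mq }
    · simp only [hx, if_false]
      exact Exec.skip.mono (by omega)
  have h3 : ∀ k l (s : Mem M), Exec (loop .inp Option.isNone fun o => if x = .hold then
        modReg (regBit (o.getD false)) else skip)
      { s with inp := bl.map some ++ none :: enc bs, reg := [regOf M k l] }
      { s with inp := enc bs, reg := [regOf M k (if x = .hold then l ++ bl else l)] }
      (3 * bl.length + 1) := by
    clear h1 h2
    intro k
    induction bl with
    | nil =>
      intro l s
      exact Exec.of (Exec.loop_halt (x := none) (s' := { s with inp := enc bs, reg := [regOf M k l] })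
        (by funext k; cases k <;> rfl) rfl) (by simp) (by simp)
    | cons b bl ih =>
      intro l s
      refine Exec.of (Exec.loop_cons (x := some b) (B := 2)
        { s with inp := bl.map some ++ none :: enc bs, reg := [regOf M k l] }
        { s with
          inp := bl.map some ++ none :: enc bs
          reg := [regOf M k (if x = .hold then l ++ [b] else l)] }
        (by funext k; cases k <;> rfl) rfl ?_ (ih _ s)) ?_ ?_
      · by_cases hx : x = .hold
        · simp only [hx, if_true]
          rw [← regBit_regOf]
          exact exec_modReg _ _ { s with inp := bl.map some ++ none :: enc bs }
        · simp only [hx, if_false]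
          exact Exec.skip.mono (by omega)
      · by_cases hx : x = .hold <;> simp [hx]
      · simp only [List.length_cons]; omega
  have h4 := h3 (if x = .wait then k + 1 else k) l { s with mq := (x, false) :: s.mq }
  rw [← enc_cons] at h4
  exact Exec.of (h1.seq (h2.seq h4)) rfl (by omega)

theorem exec_scanBlocks (m : List Mark) (row rest : List (List Bool)) (k : ℕ) (l : List Bool)
    (s : Mem M) (hm : m.length = row.length) :
    Exec (each .mask scanBlock) { s with mask := m, inp := enc (row ++ rest), reg := [regOf M k l] }
      { s with
        mask := []
        inp := enc rest
        mq := (m.map fun x => (x, false)).reverse ++ s.mq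
        reg := [regOf M (k + m.count .wait) (l ++ heldBits m row)] }
      (3 * (enc row).length + 6 * m.length + 1) := by
  induction m generalizing row k l s with
  | nil =>
    obtain rfl : row = [] := by simpa using hm.symm
    exact Exec.of (Exec.loop_nil rfl) (by simp [heldBits]) (by omega)
  | cons x m ih =>
    obtain ⟨bl, row, rfl⟩ : ∃ a l, row = a :: l := by
      rcases row with _ | ⟨a, l⟩
      · simp at hm
      · exact ⟨a, l, rfl⟩
    have h1 := exec_scanBlock x bl (row ++ rest) k l { s with mask := m }
    have h2 := ih row (if x = .wait then k + 1 else k) (if x = .hold then l ++ bl else l)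
      { s with mq := (x, false) :: s.mq } (by simpa using hm)
    refine Exec.of (Exec.loop_cons (x := x)
      { s with mask := m, inp := enc (bl :: (row ++ rest)), reg := [regOf M k l] } _
      (by funext k; cases k <;> rfl) rfl h1 h2) ?_ ?_
    · congr 1
      · simp
      · cases x <;> simp [heldBits, add_comm, add_left_comm]
    · simp only [enc_cons, List.length_append, List.length_map, List.length_cons]
      omega

/-- Update the state `m` of a player when the baton is passed. -/
def pickOne (m : Mark) : Cmd (Sym M) :=
  match m with
  | .wait => pop .sel fun o => match o with
    | none => skip
    | some none => seq (push .mq (.wait, false)) (push .sel none)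
    | some (some v) =>
      if v.val = 0 then seq (push .mq (.hold, false)) (push .sel none)
      else seq (push .mq (.wait, false)) (push .sel (some ⟨v.val - 1, by omega⟩))
  | _ => push .mq (.idle, false)

/-- The symbol `o'` left on `sel` plays no role; it is only known to be a single one, to be cleared
afterwards. -/
theorem exec_pickOnes (m : List Mark) (o : Option (Fin (M + 1))) (s : Mem M) :
    ∃ o', Exec (each .mask pickOne) { s with mask := m, sel := [o] }
      { s with
        mask := []
        mq := ((pick (o.map Fin.val) m).map fun x => (x, false)).reverse ++ s.mq
        sel := [o'] } (4 * m.length + 1) := by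
  induction m generalizing o s with
  | nil => exact ⟨o, Exec.of (Exec.loop_nil rfl) (by simp [pick]) (by omega)⟩
  | cons x m ih =>
    have step : ∀ (x y : Mark) (o o1 : Option (Fin (M + 1))),
        Exec (pickOne x) { s with mask := m, sel := [o] }
          { s with mask := m, mq := (y, false) :: s.mq, sel := [o1] } 3 →
        pick (o.map Fin.val) (x :: m) = y :: pick (o1.map Fin.val) m →
        ∃ o', Exec (each .mask pickOne) { s with mask := x :: m, sel := [o] }
          { s with
            mask := []
            mq := ((pick (o.map Fin.val) (x :: m)).map fun x => (x, false)).reverse ++ s.mq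
            sel := [o'] } (4 * (m.length + 1) + 1) := by
      intro x y o o1 h hp
      obtain ⟨o', h'⟩ := ih o1 { s with mq := (y, false) :: s.mq }
      refine ⟨o', Exec.of (Exec.loop_cons (x := x) { s with mask := m, sel := [o] } _
        (by funext k; cases k <;> rfl) rfl h h') ?_ (by omega)⟩
      simp [hp]
    have idle : ∀ x : Mark, x ≠ .wait → Exec (pickOne x) { s with mask := m, sel := [o] }
          { s with mask := m, mq := (.idle, false) :: s.mq, sel := [o] } 3 := by
      intro x hx
      have h : Exec (push .mq (.idle, false)) { s with mask := m, sel := [o] }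
          { s with mask := m, mq := (.idle, false) :: s.mq, sel := [o] } 1 :=
        .push (by funext k; cases k <;> rfl)
      cases x
      · exact h.mono (by omega)
      · simp at hx
      · exact h.mono (by omega)
    have wait : ∀ (o o1 : Option (Fin (M + 1))) (y : Mark),
        Exec (seq (push .mq (y, false)) (push .sel o1)) { s with mask := m, sel := [] }
          { s with mask := m, mq := (y, false) :: s.mq, sel := [o1] } 2 := by
      intro o o1 y
      exact (Exec.push (s' := { s with mask := m, mq := (y, false) :: s.mq, sel := [] })
        (by funext k; cases k <;> rfl)).seq (.push (by funext k; cases k <;> rfl))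
    have hpop : ∀ o, Mem.store { s with mask := m, sel := [o] } = update
        (Mem.store { s with mask := m, sel := [] }) .sel (o :: []) := by
      intro o; funext k; cases k <;> rfl
    rcases x with _ | _ | _
    · exact step .idle .idle o o (idle _ (by simp)) (by simp [pick])
    · rcases o with _ | ⟨v, hv⟩
      · exact step .wait .wait none none
          (Exec.pop_cons (x := none) _ (hpop _) (wait none none _)) (by simp [pick])
      · rcases v with _ | v
        · exact step .wait .hold _ none
            (Exec.pop_cons (x := some ⟨0, hv⟩) _ (hpop _) (wait none none _)) (by simp [pick])
        · exact step .wait .wait _ (some ⟨v, by omega⟩)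
            (Exec.pop_cons (x := some ⟨v + 1, hv⟩) _ (hpop _) (wait none _ _)) (by simp [pick])
    · exact step .hold .idle o o (idle _ (by simp)) (by simp [pick])

/-- Pass the baton. -/
def batonPass : Cmd (Sym M) :=
  seq (push .reg (regOf M 0 [])) <| seq (each .mask scanBlock) <|
  seq (each .mq fun p => push .mask p.1) <|
  pop .reg fun o => match o with
    | none => skip
    | some r => if r.1.val = 0 then skip else
      seq (push .sel (some ⟨min (r.2.val % r.1.val) M, by omega⟩)) <|
      seq (each .mask pickOne) <| seq (each .mq fun p => push .mask p.1) <| each .sel fun _ => skip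

theorem exec_batonPass (m : List Mark) (row rest : List (List Bool)) (n Z : ℕ) (p : List Instr)
    (hm : m.length = row.length) (hZ : (enc (row ++ rest)).length ≤ Z) (hZ' : m.length ≤ Z) :
    Exec (M := M) batonPass { nn := n, mask := m, inp := enc (row ++ rest), prog := p }
      { nn := n, mask := passBaton M m row, inp := enc rest, prog := p } (20 * Z + 10) := by
  have h1 : Exec (M := M) (push .reg (regOf M 0 []))
      { nn := n, mask := m, inp := enc (row ++ rest), prog := p }
      { nn := n, mask := m, inp := enc (row ++ rest), prog := p, reg := [regOf M 0 []] } 1 :=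
    .push (by funext k; cases k <;> rfl)
  have h2 := exec_scanBlocks (M := M) m row rest 0 [] { nn := n, prog := p } hm
  simp only [zero_add, List.nil_append, List.append_nil] at h2
  have h3 : ∀ (m : List Mark) (s : Mem M), Exec (M := M) (each .mq fun p => push .mask p.1)
      { s with mask := [], mq := (m.map fun x => (x, false)).reverse }
      { s with mask := m, mq := [] } (2 * m.length + 1) := by
    intro m s
    have h := exec_mq_to_mask (M := M) Prod.fst { s with mask := [] } (m.map fun x => (x, false))
    exact h.of (by simp [comp_def]) (by simp)
  have h4 := h3 m
    { nn := n, prog := p, inp := enc rest, reg := [regOf M (m.count .wait) (heldBits m row)] }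
  refine Exec.of (Exec.seq h1 (Exec.seq h2 (Exec.seq h4 (Exec.pop_cons (B := 8 * m.length + 6)
    (s' := { nn := n, mask := passBaton M m row, inp := enc rest, prog := p })
    (x := regOf M (m.count .wait) (heldBits m row))
    { nn := n, mask := m, inp := enc rest, prog := p } (by funext k; cases k <;> rfl) ?_)))) rfl ?_
  · by_cases h0 : min (m.count .wait) M = 0
    · simp only [passBaton, h0, regOf, if_true]
      exact Exec.skip.mono (by omega)
    · simp only [passBaton, h0, regOf, if_false]
      set v := bitsVal (heldBits m row) % M.factorial % min (m.count .wait) M with hv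
      have hvM : v < M := (Nat.mod_lt _ (by omega)).trans_le (min_le_right _ _)
      have h5 : Exec (M := M) (push .sel (some ⟨min v M, by omega⟩))
        { nn := n, mask := m, inp := enc rest, prog := p }
        { nn := n, mask := m, inp := enc rest, prog := p, sel := [some ⟨min v M, by omega⟩] } 1 :=
        .push (by funext k; cases k <;> rfl)
      obtain ⟨o', h6⟩ := exec_pickOnes (M := M) m (some ⟨min v M, by omega⟩)
        { nn := n, inp := enc rest, prog := p }
      have hs : Option.map Fin.val (some (⟨min v M, by omega⟩ : Fin (M + 1))) = some v := by
        simp [hvM.le]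
      rw [hs] at h6
      simp only [List.append_nil] at h6
      have h7 := h3 (pick (some v) m) { nn := n, inp := enc rest, prog := p, sel := [o'] }
      have hlen : ∀ o (m : List Mark), (pick o m).length = m.length := by
        intro o m
        fun_induction pick o m <;> simp_all
      have h8 : Exec (M := M) (each .sel fun _ => skip)
          { nn := n, mask := pick (some v) m, inp := enc rest, prog := p, sel := [o'] }
          { nn := n, mask := pick (some v) m, inp := enc rest, prog := p } 3 :=
        Exec.loop_cons (x := o') _ { nn := n, mask := pick (some v) m, inp := enc rest, prog := p }
          (by funext k; cases k <;> rfl) rfl .skip (.loop_nil rfl)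
      rw [hlen] at h7
      have h9 := h5.seq (h6.seq (h7.seq h8))
      exact h9.of rfl (by omega)
  · rw [enc_append, List.length_append] at hZ
    omega

end Cmd
end ONOSF

/-! ### The main loop and its preparation. -/

namespace ONOSF
open Function
variable {M : ℕ}

@[simp] theorem length_halveMask (z : List (Mark × Bool)) : (halveMask z).length = z.length := by
  simp [halveMask]

theorem length_shrink (k : ℕ) (m : List Mark) (row : List (List Bool)) (h : m.length = row.length) :
    (shrink k m row).length = m.length := by
  induction k generalizing m row with
  | zero => rfl
  | succ k ih => rw [shrink, ih] <;> simp [h]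

theorem length_pick (o : Option ℕ) (m : List Mark) : (pick o m).length = m.length := by
  fun_induction pick o m <;> simp_all

theorem length_passBaton (m : List Mark) (row : List (List Bool)) :
    (passBaton M m row).length = m.length := by
  unfold passBaton
  split
  · rfl
  · rw [length_pick]

theorem length_rowOf {N t : ℕ} {bs : List (List Bool)} (h : (t + 1) * N ≤ bs.length) :
    (rowOf N t bs).length = N := by
  rw [add_mul, one_mul] at h
  simp [rowOf]
  omega

theorem length_maskAt {N T t : ℕ} {k : ℕ → ℕ} {bs : List (List Bool)} (h : t * N ≤ bs.length) :
    (maskAt M N T k bs t).length = N := by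
  induction t with
  | zero => simp [maskAt]
  | succ t ih =>
    have hr := length_rowOf h
    have := ih (by nlinarith)
    unfold maskAt
    split
    · rw [length_shrink _ _ _ (by omega), this]
    · rw [length_passBaton, this]

theorem rowOf_append_drop (N t : ℕ) (bs : List (List Bool)) :
    rowOf N t bs ++ bs.drop ((t + 1) * N) = bs.drop (t * N) := by
  have := List.take_append_drop N (bs.drop (t * N))
  rwa [List.drop_drop, show t * N + N = (t + 1) * N by ring] at this

theorem length_enc_drop (i : ℕ) (bs : List (List Bool)) :
    (enc (bs.drop i)).length ≤ (enc bs).length := by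
  conv_rhs => rw [← List.take_append_drop i bs, enc_append]
  simp

/-- Delete an instruction to halve. -/
def dropBit : List Instr → List Instr
  | .bit :: w => w
  | w => w

theorem dropBit_iterate_replicate (τ k : ℕ) (w : List Instr) :
    dropBit^[τ] (List.replicate k .bit ++ .next :: w) =
      List.replicate (k - τ) .bit ++ .next :: w := by
  induction τ with
  | zero => rfl
  | succ τ ih =>
    rw [iterate_succ_apply', ih]
    rcases h : k - τ with _ | j
    · simp [show k - (τ + 1) = 0 by omega, dropBit]
    · simp [show k - (τ + 1) = j by omega, dropBit, List.replicate_succ]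

theorem roundsWord_congr {k k' : ℕ → ℕ} {T d : ℕ} (h : ∀ t, T - d ≤ t → k t = k' t) :
    roundsWord k T d = roundsWord k' T d := by
  induction d with
  | zero => rfl
  | succ d ih => rw [roundsWord, roundsWord, h _ le_rfl, ih fun t ht => h t (by omega)]

/-- The number of rows is known only after the schedule has been written, so the first round is
shortened afterwards, by deleting leading `.bit` instructions. The `.next` behind them stops the
deletion, which gives truncated subtraction; with no rounds at all the word starts with a pass, or
is empty, and stays as it is. -/
theorem dropBit_iterate_word (τ T R : ℕ) (k : ℕ → ℕ) :
    dropBit^[τ] (roundsWord k T T ++ List.replicate R .pass) =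
      roundsWord (fun t => k t - if t = 0 then τ else 0) T T ++ List.replicate R .pass := by
  rcases T with _ | T
  · have : ∀ R, dropBit (List.replicate R .pass) = List.replicate R .pass := by
      intro R
      cases R <;> rfl
    simp only [roundsWord, List.nil_append]
    exact iterate_fixed (this R) τ
  · rw [roundsWord, roundsWord, List.append_assoc, List.cons_append, dropBit_iterate_replicate]
    rw [roundsWord_congr (k := k) (k' := fun t => k t - if t = 0 then τ else 0)]
    · simp
    · intro t ht
      simp [show t ≠ 0 by omega]

namespace Cmd
variable {c d : Cmd (Sym M)} {s s' s'' : Mem M} {B B' : ℕ}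

/-- Obey an instruction. -/
def obey : Instr → Cmd (Sym M)
  | .bit => halvePass
  | .next => dropRow
  | .pass => batonPass

/-- The run after the row enters as a hypothesis. The induction on the number of halvings can then
change mask and row while the final memory stays fixed. -/
theorem exec_obey_bits (j : ℕ) (m : List Mark) (row rest : List (List Bool)) (n Z W : ℕ)
    (p : List Instr) (s : Mem M)
    (hm : m.length = row.length) (hZ : (enc (row ++ rest)).length ≤ Z) (hZ' : m.length ≤ Z)
    (h : Exec (each .prog obey) { nn := n, mask := shrink j m row, inp := enc rest, prog := p } s
      W) :
    Exec (each .prog obey)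
      { nn := n
        mask := m
        inp := enc (row ++ rest)
        prog := List.replicate j .bit ++ .next :: p } s ((j + 1) * (20 * Z + 11) + W) := by
  induction j generalizing m row with
  | zero =>
    have h1 := exec_dropRow (M := M) m row rest n Z p hm hZ hZ'
    exact (Exec.loop_cons (x := Instr.next) _ _ (by funext k; cases k <;> rfl) rfl h1 h).mono
      (by omega)
  | succ j ih =>
    rw [shrink] at h
    have h1 := exec_halvePass (M := M) m row rest n Z (List.replicate j .bit ++ .next :: p) hm hZ hZ'
    have h2 := ih (halveMask (m.zip (row.map fun b => b.headD false))) (row.map List.tail)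
      (by simp [hm]) (by
        have := length_enc_tail row
        rw [enc_append, List.length_append] at hZ ⊢
        omega) (by simp [hm] at *; omega) h
    exact (Exec.loop_cons (x := Instr.bit) _ _ (by funext k; cases k <;> rfl) rfl h1 h2).mono
      (by linarith)

theorem exec_obey_passes (N T R : ℕ) (k : ℕ → ℕ) (bs : List (List Bool)) (n Z t : ℕ)
    (ht : T ≤ t) (hR : (t + R) * N ≤ bs.length) (hZ : (enc bs).length ≤ Z) (hN : N ≤ Z) :
    Exec (M := M) (each .prog obey)
      { nn := n
        mask := maskAt M N T k bs t
        inp := enc (bs.drop (t * N))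
        prog := List.replicate R .pass }
      { nn := n, mask := maskAt M N T k bs (t + R), inp := enc (bs.drop ((t + R) * N)) }
      (R * (20 * Z + 11) + 1) := by
  induction R generalizing t with
  | zero => exact Exec.of (Exec.loop_nil rfl) rfl (by omega)
  | succ R ih =>
    have hl : (maskAt M N T k bs t).length = N := length_maskAt (by nlinarith)
    have h1 := exec_batonPass (M := M) (maskAt M N T k bs t) (rowOf N t bs)
      (bs.drop ((t + 1) * N)) n Z (List.replicate R .pass)
      (by rw [hl, length_rowOf (by nlinarith)])
      (by rw [rowOf_append_drop]; exact (length_enc_drop _ _).trans hZ) (by omega)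
    have h2 := ih (t + 1) (by omega) (by rw [show t + 1 + R = t + (R + 1) by ring]; exact hR)
    rw [rowOf_append_drop] at h1
    rw [show t + 1 + R = t + (R + 1) by ring, maskAt, if_neg (by omega)] at h2
    exact (Exec.loop_cons (x := Instr.pass) _ _ (by funext k; cases k <;> rfl) rfl h1 h2).mono
      (by linarith)

theorem exec_obey (N T R : ℕ) (k : ℕ → ℕ) (bs : List (List Bool)) (n Z d : ℕ)
    (hd : d ≤ T) (hR : (T + R) * N ≤ bs.length) (hZ : (enc bs).length ≤ Z) (hN : N ≤ Z) :
    Exec (M := M) (each .prog obey)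
      { nn := n
        mask := maskAt M N T k bs (T - d)
        inp := enc (bs.drop ((T - d) * N))
        prog := roundsWord k T d ++ List.replicate R .pass }
      { nn := n, mask := maskAt M N T k bs (T + R), inp := enc (bs.drop ((T + R) * N)) }
      (((roundsWord k T d).length + R) * (20 * Z + 11) + 1) := by
  induction d with
  | zero =>
    have := exec_obey_passes (M := M) N T R k bs n Z T le_rfl hR hZ hN
    simpa [roundsWord] using this
  | succ d ih =>
    obtain ⟨t, ht⟩ : ∃ t, t = T - (d + 1) := ⟨_, rfl⟩
    have htT : t + 1 ≤ T := by omega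
    have hle : (t + 1) * N ≤ bs.length := (Nat.mul_le_mul_right N (by omega)).trans hR
    have hl : (maskAt M N T k bs t).length = N := length_maskAt (by nlinarith)
    have h2 := ih (by omega)
    rw [show T - d = t + 1 by omega, maskAt, if_pos (by omega)] at h2
    have h1 := exec_obey_bits (M := M) (k t) (maskAt M N T k bs t) (rowOf N t bs)
      (bs.drop ((t + 1) * N)) n Z _ _ _ (by rw [hl, length_rowOf hle])
      (by rw [rowOf_append_drop]; exact (length_enc_drop _ _).trans hZ) (by omega) h2
    rw [rowOf_append_drop] at h1
    simp only [← ht, roundsWord]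
    refine Exec.mono (by simpa using h1) ?_
    simp only [List.length_append, List.length_replicate, List.length_cons]
    apply le_of_eq
    ring

/-- Read `n` and count the blocks. -/
def readSizes : Cmd (Sym M) :=
  seq (loop .inp Option.isNone fun _ => push .nn ()) <|
  seq (each .inp fun o => seq (push .aux o)
    (if o = none then seq (push .cnt ()) (push .a ()) else skip)) <|
  each .aux fun o => push .inp o

theorem exec_readSizes (n : ℕ) (bs : List (List Bool)) :
    Exec (M := M) readSizes { inp := List.replicate n (some true) ++ none :: enc bs }
      { nn := n, inp := enc bs, cnt := bs.length, a := bs.length }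
      (2 * n + 7 * (enc bs).length + 3) := by
  have h1 : ∀ i, Exec (M := M) (loop .inp Option.isNone fun _ => push .nn ())
      { nn := i, inp := List.replicate n (some true) ++ none :: enc bs }
      { nn := n + i, inp := enc bs } (2 * n + 1) := by
    induction n with
    | zero =>
      intro i
      exact Exec.of (Exec.loop_halt (x := none) (s' := { nn := i, inp := enc bs })
        (by funext k; cases k <;> rfl) rfl) (by simp) (by omega)
    | succ n ih =>
      intro i
      exact Exec.of (Exec.loop_cons (x := some true)
        { nn := i, inp := List.replicate n (some true) ++ none :: enc bs } _
        (by funext k; cases k <;> rfl) rfl (.push (by funext k; cases k <;> rfl)) (ih (i + 1)))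
        (by congr 1; omega) (by omega)
  have h2 := Exec.each_list (k := .inp) (M := M) (α := List (Option Bool) × ℕ)
    (body := fun o => seq (push .aux o)
      (if o = none then seq (push .cnt ()) (push .a ()) else skip))
    (fun l y => { nn := n, inp := l, aux := y.1, cnt := y.2, a := y.2 })
    (fun y o => (o :: y.1, if o = none then y.2 + 1 else y.2)) 3
    (fun _ => rfl) (fun x l y => by funext k; cases k <;> rfl)
    (fun x l y => by
      have h1 : Exec (M := M) (push .aux x)
        { nn := n, inp := l, aux := y.1, cnt := y.2, a := y.2 }
        { nn := n, inp := l, aux := x :: y.1, cnt := y.2, a := y.2 } 1 :=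
        .push (by funext k; cases k <;> rfl)
      refine Exec.seq (B' := 2) h1 ?_
      rcases x with _ | b
      · simp only [if_true]
        exact (Exec.push (s' := { nn := n, inp := l, aux := none :: y.1, cnt := y.2 + 1, a := y.2 })
          (by funext k; cases k <;> rfl)).seq (.push (by funext k; cases k <;> rfl))
      · simp only [reduceCtorEq, if_false]
        exact Exec.skip.mono (by omega)) (enc bs) ([], 0)
  have h3 : ∀ (l : List (Option Bool)) (y : List (Option Bool) × ℕ), l.foldl
      (fun (y : List (Option Bool) × ℕ) o => (o :: y.1, if o = none then y.2 + 1 else y.2)) y =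
      (l.reverse ++ y.1, l.count none + y.2) := by
    intro l
    induction l with
    | nil => intro y; simp
    | cons o l ih =>
      intro y
      rw [List.foldl_cons, ih]
      cases o <;> simp <;> omega
  have h4 : ∀ bs : List (List Bool), (enc bs).count none = bs.length := by
    intro bs
    induction bs with
    | nil => rfl
    | cons b bs ih => simp [enc_cons, ih]; rw [List.count_eq_zero]; simp
  rw [h3, h4] at h2
  have h5 := exec_aux_to_inp (M := M) { nn := n, cnt := bs.length, a := bs.length }
    (enc bs).reverse
  simp only [List.append_nil, add_zero] at h2
  refine Exec.of ((h1 0).seq (h2.seq h5)) (by simp) ?_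
  simp only [List.length_reverse]
  omega

/-- Compute the instructions and the number of players. -/
def prepare (c : ℕ) : Cmd (Sym M) :=
  seq log <| seq (push .flag ()) <| seq (plan c) <|
  seq (reps (seq (push .word .pass) (push .tt ())) M) <|
  seq (each .tt fun _ => push .a ()) <| seq log <| seq (push .b ()) <|
  seq (each .word fun i => push .prog i) <|
  seq (each .b fun _ => seq (each .cnt fun _ => push .a ()) <| seq half <|
    seq (each .e fun _ => push .cnt ()) <| pop .prog fun o => match o with
      | none => skip
      | some .bit => skip
      | some i => push .prog i) <|
  each .cnt fun _ => push .mask .wait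

theorem exec_prepare (c n ℓ Z : ℕ) (i : List (Option Bool)) (hZ : ℓ ≤ Z) :
    Exec (M := M) (prepare c) { nn := n, inp := i, cnt := ℓ, a := ℓ }
      { nn := n
        inp := i
        mask := List.replicate (players c M ℓ) .wait
        prog := roundsWord (halvings c M ℓ) (rounds c ℓ) (rounds c ℓ) ++
          List.replicate M .pass }
      (1000 * (Z + c + M + 1) ^ 2) := by
  have hT := level_le_zero (c := c) (ℓ := ℓ) le_rfl
  have hL0 : level c ℓ 0 = Nat.log 2 (ℓ + 1) := rfl
  have hlog : Nat.log 2 (ℓ + 1) ≤ ℓ := by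
    have := Nat.log_lt_self 2 (x := ℓ + 1) (by omega)
    omega
  set T := rounds c ℓ with hTd
  set w := roundsWord (fun t => level c ℓ t - level c ℓ (t + 1)) T T with hw
  -- A round contributes the difference of two levels and one `.next`; the differences telescope.
  have hwl : w.length ≤ T + level c ℓ 0 := by
    have : ∀ d ≤ T, (roundsWord (fun t => level c ℓ t - level c ℓ (t + 1)) T d).length ≤
        d + level c ℓ (T - d) := by
      intro d
      induction d with
      | zero => simp [roundsWord]
      | succ d ih =>
        intro hd
        have h := ih (by omega)
        have h1 := level_lt (c := c) (ℓ := ℓ) (t := T - (d + 1)) (by omega)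
        rw [roundsWord, List.length_append, List.length_replicate, List.length_cons]
        rw [show T - d = T - (d + 1) + 1 by omega] at h
        omega
    simpa using this T le_rfl
  have h1 := exec_log (M := M) ℓ { nn := n, inp := i, cnt := ℓ } rfl
  simp only [zero_add, ← hL0] at h1
  have h2 : Exec (M := M) (push .flag ()) { nn := n, inp := i, cnt := ℓ, b := level c ℓ 0 }
      { nn := n, inp := i, cnt := ℓ, b := level c ℓ 0, flag := 1 } 1 :=
    .push (by funext k; cases k <;> rfl)
  have h3 := exec_plan (M := M) c ℓ T le_rfl { nn := n, inp := i, cnt := ℓ } rfl rfl rfl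
  simp only [← hTd, ← hw, Nat.sub_self, zero_add, List.append_nil] at h3
  have h4 := exec_reps (M := M) (T := 2) (c := seq (push .word .pass) (push .tt ()))
    (fun j => { nn := n, inp := i, cnt := ℓ, tt := T + j,
                word := List.replicate j .pass ++ w.reverse })
    (fun j => (Exec.push (s' := { nn := n, inp := i, cnt := ℓ, tt := T + j,
                                  word := List.replicate (j + 1) .pass ++ w.reverse })
        (by funext k; cases k <;> rfl)).seq (.push (by funext k; cases k <;> rfl))) M 0
  simp only [zero_add, add_zero, List.replicate_zero, List.nil_append] at h4
  have h5 := Exec.each_count (M := M) (k := .tt) () (body := fun _ => push .a ())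
    (fun j y => { nn := n, inp := i, cnt := ℓ, tt := j, a := y,
                  word := List.replicate M .pass ++ w.reverse }) (· + 1) 1 (fun _ => rfl)
    (fun n y => by funext k; cases k <;> rfl)
    (fun n y => .push (by funext k; cases k <;> rfl)) (T + M) 0
  simp only [add_right_iterate, zero_add, smul_eq_mul, mul_one] at h5
  have h6 := exec_log (M := M) (T + M)
    { nn := n, inp := i, cnt := ℓ, word := List.replicate M .pass ++ w.reverse } rfl
  simp only [zero_add] at h6
  have h7 : Exec (M := M) (push .b ())
      { nn := n, inp := i, cnt := ℓ, b := Nat.log 2 (T + M + 1),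
        word := List.replicate M .pass ++ w.reverse }
      { nn := n, inp := i, cnt := ℓ, b := logRows c M ℓ,
        word := List.replicate M .pass ++ w.reverse } 1 :=
    .push (by funext k; cases k <;> rfl)
  have h8 := Exec.each_list (M := M) (k := .word) (body := fun i => push .prog i)
    (fun l y => { nn := n, inp := i, cnt := ℓ, b := logRows c M ℓ, word := l, prog := y })
    (fun y o => o :: y) 1 (fun _ => rfl) (fun x l y => by funext k; cases k <;> rfl)
    (fun x l y => .push (by funext k; cases k <;> rfl)) (List.replicate M .pass ++ w.reverse) []
  rw [List.foldl_flip_cons_eq_append', List.reverse_append, List.reverse_reverse,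
    List.reverse_replicate, List.append_nil] at h8
  have hcnt : ∀ (s : Mem M) (j : ℕ), Exec (each .cnt fun _ => push .a ())
      { s with cnt := j, a := 0 } { s with cnt := 0, a := j } (2 * j + 1) := by
    intro s j
    have := Exec.each_count (M := M) (k := .cnt) () (body := fun _ => push .a ())
      (fun j y => { s with cnt := j, a := y }) (· + 1) 1 (fun _ => rfl)
      (fun n y => by funext k; cases k <;> rfl)
      (fun n y => .push (by funext k; cases k <;> rfl)) j 0
    exact this.of (by simp) (by omega)
  have hecnt : ∀ (s : Mem M) (j : ℕ), Exec (each .e fun _ => push .cnt ())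
      { s with e := j, cnt := 0 } { s with e := 0, cnt := j } (2 * j + 1) := by
    intro s j
    have := Exec.each_count (M := M) (k := .e) () (body := fun _ => push .cnt ())
      (fun j y => { s with e := j, cnt := y }) (· + 1) 1 (fun _ => rfl)
      (fun n y => by funext k; cases k <;> rfl)
      (fun n y => .push (by funext k; cases k <;> rfl)) j 0
    exact this.of (by simp) (by omega)
  -- Each turn of the loop on `b` halves `cnt` and deletes one halving, so `logRows` turns produce
  -- the number of players and the shortened first round together.
  have h9 : ∀ τ j (p : List Instr), j ≤ Z → Exec (M := M)
      (each .b fun _ => seq (each .cnt fun _ => push .a ()) <| seq half <|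
        seq (each .e fun _ => push .cnt ()) <| pop .prog fun o => match o with
        | none => skip
        | some .bit => skip
        | some i => push .prog i)
      { nn := n, inp := i, cnt := j, b := τ, prog := p }
      { nn := n, inp := i, cnt := j / 2 ^ τ, prog := dropBit^[τ] p } (τ * (8 * Z + 8) + 1) := by
    intro τ
    induction τ with
    | zero => intro j p _; exact Exec.of (Exec.loop_nil rfl) (by simp) (by omega)
    | succ τ ih =>
      intro j p hj
      have e1 := hcnt { nn := n, inp := i, b := τ, prog := p } j
      have e2 := exec_half (M := M) j { nn := n, inp := i, b := τ, prog := p }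
      have e3 := hecnt { nn := n, inp := i, b := τ, prog := p } (j / 2)
      simp only [zero_add] at e2
      have e4 : Exec (M := M) (pop .prog fun o => match o with
        | none => skip
        | some .bit => skip
        | some i => push .prog i)
        { nn := n, inp := i, cnt := j / 2, b := τ, prog := p }
        { nn := n, inp := i, cnt := j / 2, b := τ, prog := dropBit p } 2 := by
        rcases p with _ | ⟨x, p⟩
        · exact Exec.pop_nil rfl .skip
        · refine Exec.pop_cons (x := x) { nn := n, inp := i, cnt := j / 2, b := τ, prog := p }
            (by funext k; cases k <;> rfl) ?_
          rcases x with _ | _ | _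
          · exact .skip
          · exact .push (by funext k; cases k <;> rfl)
          · exact .push (by funext k; cases k <;> rfl)
      have e5 := ih (j / 2) (dropBit p) (by omega)
      refine Exec.of (Exec.loop_cons (x := ())
        { nn := n, inp := i, cnt := j, b := τ, prog := p } _ (by funext k; cases k <;> rfl) rfl
        (e1.seq (e2.seq (e3.seq e4))) e5) ?_ ?_
      · simp [pow_succ', Nat.div_div_eq_div_mul]
      · have : (τ + 1) * (8 * Z + 8) = τ * (8 * Z + 8) + (8 * Z + 8) := by ring
        omega
  have h10 := h9 (logRows c M ℓ) ℓ (w ++ List.replicate M .pass) hZ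
  rw [dropBit_iterate_word] at h10
  have h11 := Exec.each_count (M := M) (k := .cnt) () (body := fun _ => push .mask .wait)
    (fun j y => { nn := n, inp := i, cnt := j, mask := y,
                  prog := roundsWord (halvings c M ℓ) T T ++ List.replicate M .pass })
    (fun y => .wait :: y) 1 (fun _ => rfl)
    (fun n y => by funext k; cases k <;> rfl)
    (fun n y => .push (by funext k; cases k <;> rfl)) (players c M ℓ) []
  have hit : ∀ n (w : List Mark), (fun y => Mark.wait :: y)^[n] w = List.replicate n .wait ++ w := by
    intro n
    induction n with
    | zero => simp
    | succ n ih => intro w; rw [iterate_succ_apply', ih]; rfl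
  rw [hit, List.append_nil] at h11
  refine (h1.seq (h2.seq (h3.seq (h4.seq (h5.seq (h6.seq (h7.seq (h8.seq (h10.seq
    h11))))))))).mono ?_
  have hτ : logRows c M ℓ ≤ T + M + 1 := by
    have := Nat.log_lt_self 2 (x := T + M + 1) (by omega)
    rw [logRows, ← hTd]
    omega
  have hN : players c M ℓ ≤ ℓ := Nat.div_le_self _ _
  simp only [List.length_append, List.length_replicate, List.length_reverse]
  set L := level c ℓ 0
  have a1 : (T + 1) * (70 * (L + c + 1) + 20) ≤ (Z + 1) * (70 * (Z + c + 1) + 20) :=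
    Nat.mul_le_mul (by omega) (by omega)
  have a2 : logRows c M ℓ * (8 * Z + 8) ≤ (Z + M + 1) * (8 * Z + 8) :=
    Nat.mul_le_mul_right _ (by omega)
  have a3 : (Z + 1) * (70 * (Z + c + 1) + 20) + (Z + M + 1) * (8 * Z + 8) + 100 * (Z + c + M + 1) ≤
    1000 * (Z + c + M + 1) ^ 2 := by nlinarith [Nat.zero_le (Z * M), Nat.zero_le (Z * c), Nat.zero_le (c * M)]
  omega

end Cmd
end ONOSF

/-! ### Finding the leader, writing the output, and explicitness. -/

namespace ONOSF
open Function
variable {M : ℕ}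

theorem holdPosAux_le (m : List Mark) (i p : ℕ) (h : p ≤ i) : holdPosAux i p m ≤ i + m.length := by
  induction m generalizing i p with
  | nil => simpa [holdPosAux]
  | cons x m ih =>
    have := ih (i + 1) (if x = .hold then i else p) (by split <;> omega)
    rw [holdPosAux, List.length_cons]
    omega

theorem length_enc_le (bs : List (List Bool)) (n : ℕ) (h : ∀ b ∈ bs, b.length = n) :
    (enc bs).length = (n + 1) * bs.length := by
  induction bs with
  | nil => simp
  | cons b bs ih =>
    rw [enc_cons, List.length_append, List.length_cons, ih fun b hb => h b (by simp [hb]),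
      List.length_map, h b (by simp), List.length_cons]
    ring

/-- The first block of a list of blocks, completed to `n` bits if the list is empty. -/
def firstBlock (n : ℕ) (bs : List (List Bool)) : List Bool :=
  bs.headD (List.replicate n false)

/-- The last of these rows is reserved for the output: it has to come after everything that decides
who the leader is. -/
theorem rows_mul_players_le (c M ℓ : ℕ) : (rounds c ℓ + M + 1) * players c M ℓ ≤ ℓ := by
  have h : rounds c ℓ + M + 1 ≤ 2 ^ logRows c M ℓ := (Nat.lt_pow_succ_log_self (by norm_num) _).le
  exact (Nat.mul_le_mul_right _ h).trans (Nat.mul_div_le _ _)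

theorem firstBlock_drop_leaderIdx (c M ℓ n : ℕ) (x : Fin ℓ → Block n) :
    firstBlock n ((blocks x).drop (leaderIdx c M x)) = List.ofFn (ext c M ℓ n x) := by
  unfold ext
  split
  · next h =>
    rw [List.drop_eq_getElem_cons (by simpa [blocks] using h)]
    simp [firstBlock, blocks]
  · next h =>
    rw [List.drop_eq_nil_of_le (by simp [blocks]; omega)]
    simp [firstBlock]

namespace Cmd
variable {c d : Cmd (Sym M)} {s s' s'' : Mem M} {B B' : ℕ}

/-- Find the holder of the baton. -/
def findHolder : Cmd (Sym M) :=
  each .mask fun m => seq (if m = .hold then each .a fun _ => push .e () else skip) (push .a ())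

/-- The sum of `a` and `e` is the current position, and `e` is the position of the last holder met;
at a holder, `a` is emptied into `e`. What remains in `a` is cleared later. -/
theorem exec_findHolder (m : List Mark) (i p : ℕ) (hp : p ≤ i) (s : Mem M) :
    Exec findHolder { s with mask := m, a := i - p, e := p }
      { s with mask := [], a := i + m.length - holdPosAux i p m, e := holdPosAux i p m }
      (m.length * (2 * (i + m.length) + 3) + 1) := by
  induction m generalizing i p with
  | nil => exact Exec.of (Exec.loop_nil rfl) rfl (by omega)
  | cons x m ih =>
    have h1 : Exec (if x = .hold then each .a fun _ => push .e () else skip)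
        { s with mask := m, a := i - p, e := p }
        { s with
          mask := m
          a := i - (if x = .hold then i else p)
          e := if x = .hold then i else p } (2 * i + 1) := by
      by_cases hx : x = .hold
      · simp only [hx, if_true]
        have := Exec.each_count (M := M) (k := .a) () (body := fun _ => push .e ())
          (fun j y => { s with mask := m, a := j, e := y }) (· + 1) 1 (fun _ => rfl)
          (fun n y => by funext k; cases k <;> rfl)
          (fun n y => .push (by funext k; cases k <;> rfl)) (i - p) p
        refine Exec.of this ?_ (by omega)
        rw [add_right_iterate, Nat.sub_self]
        congr 1
        simp
        omega
      · simp only [hx, if_false]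
        exact Exec.skip.mono (by omega)
    have hle : (if x = .hold then i else p) ≤ i := by split <;> omega
    have h2 : Exec (push .a ())
        { s with
          mask := m
          a := i - (if x = .hold then i else p)
          e := if x = .hold then i else p }
        { s with
          mask := m
          a := i + 1 - (if x = .hold then i else p)
          e := if x = .hold then i else p } 1 := by
      rw [Nat.sub_add_comm hle]
      exact .push (by funext k; cases k <;> rfl)
    have h3 := ih (i + 1) (if x = .hold then i else p) (by omega)
    refine Exec.of (Exec.loop_cons (x := x) { s with mask := m, a := i - p, e := p } _
      (by funext k; cases k <;> rfl) rfl (h1.seq h2) h3) ?_ ?_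
    · simp only [holdPosAux, List.length_cons]
      congr 1
      omega
    · simp only [List.length_cons]
      nlinarith

theorem exec_dropBlocks (j Z : ℕ) (bs : List (List Bool)) (s : Mem M)
    (hZ : (enc bs).length ≤ Z) :
    Exec (each .e fun _ => dropBlock) { s with e := j, inp := enc bs }
      { s with e := 0, inp := enc (bs.drop j) } (j * (2 * Z + 2) + 1) := by
  induction j generalizing bs with
  | zero => exact Exec.of (Exec.loop_nil rfl) rfl (by omega)
  | succ j ih =>
    have h1 := exec_dropBlock bs { s with e := j }
    have h2 := ih bs.tail (by simpa using (length_enc_drop 1 bs).trans hZ)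
    refine Exec.of (Exec.loop_cons (x := ()) { s with e := j, inp := enc bs } _
      (by funext k; cases k <;> rfl) rfl h1 h2) (by simp) ?_
    have : (bs.headD []).length ≤ Z := by
      rcases bs with _ | ⟨b, bs⟩
      · simp
      · refine le_trans ?_ hZ
        simp [enc_cons]
    nlinarith

/-- Output `n` bits. -/
def emit : Cmd (Sym M) :=
  seq (each .nn fun _ => pop .inp fun o => push .aux (some ((o.getD none).getD false)))
    (each .aux fun o => push .out (o.getD false))

theorem exec_emit (n Z a : ℕ) (bs : List (List Bool)) (h : ∀ b ∈ bs, b.length = n)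
    (hZ : (enc bs).length ≤ Z) :
    ∃ i : List (Option Bool), i.length ≤ Z ∧
      Exec (M := M) emit { nn := n, a := a, inp := enc bs }
        { inp := i, a := a, out := firstBlock n bs } (5 * n + 2) := by
  have step : ∀ (o : Option Bool) (i y : List (Option Bool)) (j : ℕ) (f : Option (Option Bool) → Bool),
      Exec (M := M) (push .aux (some (f (some o)))) { nn := j, a := a, inp := i, aux := y }
        { nn := j, a := a, inp := i, aux := some (f (some o)) :: y } 1 :=
    fun o i y j f => .push (by funext k; cases k <;> rfl)
  have h1 : ∃ i : List (Option Bool), i.length ≤ Z ∧ Exec (M := M)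
      (each .nn fun _ => pop .inp fun o => push .aux (some ((o.getD none).getD false)))
      { nn := n, a := a, inp := enc bs }
      { inp := i, a := a, aux := ((firstBlock n bs).map some).reverse } (3 * n + 1) := by
    rcases bs with _ | ⟨b, bs⟩
    · refine ⟨[], by simp, ?_⟩
      have : ∀ y, Exec (M := M)
          (each .nn fun _ => pop .inp fun o => push .aux (some ((o.getD none).getD false)))
          { nn := n, a := a, aux := y }
          { a := a, aux := List.replicate n (some false) ++ y } (3 * n + 1) := by
        clear h hZ
        induction n with
        | zero => intro y; exact Exec.of (Exec.loop_nil rfl) rfl (by omega)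
        | succ n ih =>
          intro y
          have e : Exec (M := M) (push .aux (some false)) { nn := n, a := a, aux := y }
              { nn := n, a := a, aux := some false :: y } 1 :=
            .push (by funext k; cases k <;> rfl)
          refine Exec.of (Exec.loop_cons (x := ()) { nn := n, a := a, aux := y } _
            (by funext k; cases k <;> rfl) rfl (Exec.pop_nil rfl e) (ih _)) ?_ (by omega)
          simp [List.replicate_succ', List.append_assoc]
      simpa [firstBlock] using this []
    · refine ⟨none :: enc bs, ?_, ?_⟩
      · refine le_trans ?_ hZ
        simp [enc_cons]
      have hb : b.length = n := h b (by simp)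
      have : ∀ y, Exec (M := M)
          (each .nn fun _ => pop .inp fun o => push .aux (some ((o.getD none).getD false)))
          { nn := n, a := a, inp := b.map some ++ none :: enc bs, aux := y }
          { inp := none :: enc bs, a := a, aux := (b.map some).reverse ++ y } (3 * n + 1) := by
        subst hb
        clear h hZ
        induction b with
        | nil => intro y; exact Exec.of (Exec.loop_nil rfl) rfl (by simp)
        | cons x b ih =>
          intro y
          have e : Exec (M := M) (push .aux (some x))
              { nn := b.length, a := a, inp := b.map some ++ none :: enc bs, aux := y }
              { nn := b.length, a := a, inp := b.map some ++ none :: enc bs, aux := some x :: y } 1 :=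
            .push (by funext k; cases k <;> rfl)
          refine Exec.of (Exec.loop_cons (x := ())
            { nn := b.length, a := a, inp := some x :: (b.map some ++ none :: enc bs), aux := y } _
            (by funext k; cases k <;> rfl) rfl (Exec.pop_cons (x := some x)
            { nn := b.length, a := a, inp := b.map some ++ none :: enc bs, aux := y }
            (by funext k; cases k <;> rfl) e) (ih _)) ?_ ?_
          · simp
          · simp only [List.length_cons]
            omega
      simpa [firstBlock, enc_cons] using this []
  obtain ⟨i, hi, h1⟩ := h1
  refine ⟨i, hi, ?_⟩
  have h2 := Exec.each_list (M := M) (k := .aux) (body := fun o => push .out (o.getD false))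
    (fun l y => { inp := i, a := a, aux := l, out := y }) (fun y o => o.getD false :: y) 1
    (fun _ => rfl) (fun x l y => by funext k; cases k <;> rfl)
    (fun x l y => .push (by funext k; cases k <;> rfl)) ((firstBlock n bs).map some).reverse []
  have hl : (firstBlock n bs).length = n := by
    rcases bs with _ | ⟨b, bs⟩
    · simp [firstBlock]
    · simpa [firstBlock] using h b (by simp)
  refine Exec.of (h1.seq h2) ?_ ?_
  · rw [List.foldl_reverse]
    congr 1
    generalize firstBlock n bs = l
    induction l with
    | nil => rfl
    | cons x l ih => simp [ih]
  · simp only [List.length_reverse, List.length_map, hl]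
    omega

theorem exec_clear_inp (s : Mem M) (i : List (Option Bool)) :
    Exec (each .inp fun _ => skip) { s with inp := i } { s with inp := [] } (2 * i.length + 1) :=
  Exec.of (Exec.each_list (k := .inp) (fun l (_ : Unit) => { s with inp := l }) (fun y _ => y)
    1 (fun _ => rfl) (fun x l y => by funext k; cases k <;> rfl)
    (fun x l y => .skip) i ()) rfl (by omega)

theorem exec_clear_a (s : Mem M) (i : ℕ) :
    Exec (each .a fun _ => skip) { s with a := i } { s with a := 0 } (2 * i + 1) :=
  Exec.of (Exec.each_count (k := .a) () (fun l (_ : Unit) => { s with a := l }) id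
    1 (fun _ => rfl) (fun x y => by funext k; cases k <;> rfl)
    (fun x y => .skip) i ()) rfl (by omega)

/-- The program that computes the extractor. -/
def extProg (c M : ℕ) : Cmd (Sym M) :=
  seq readSizes <| seq (prepare c) <| seq (each .prog obey) <| seq findHolder <|
  seq (each .e fun _ => dropBlock) <| seq emit <|
  seq (each .inp fun _ => skip) (each .a fun _ => skip)

theorem exec_extProg (c M ℓ n : ℕ) (x : Fin ℓ → Block n) :
    Exec (extProg c M) { inp := List.replicate n (some true) ++ none :: enc (blocks x) }
      { out := List.ofFn (ext c M ℓ n x) }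
      (3000 * ((n + 1) * (ℓ + 1) + c + M + 1) ^ 2) := by
  have hlen : (blocks x).length = ℓ := by simp [blocks]
  have hb : ∀ b ∈ blocks x, b.length = n := by
    simp [blocks]
  have henc := length_enc_le (blocks x) n hb
  rw [hlen] at henc
  set Z := (n + 1) * (ℓ + 1) with hZ
  have hZn : n + 1 ≤ Z := Nat.le_mul_of_pos_right _ (by omega)
  have hZl : ℓ + 1 ≤ Z := Nat.le_mul_of_pos_left _ (by omega)
  have hZe : (enc (blocks x)).length ≤ Z := by rw [henc, hZ]; gcongr; omega
  have hrows := rows_mul_players_le c M ℓ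
  have hN : players c M ℓ ≤ ℓ := Nat.div_le_self _ _
  set N := players c M ℓ with hNd
  have h1 := exec_readSizes (M := M) n (blocks x)
  rw [hlen] at h1
  have h2 := exec_prepare (M := M) c n ℓ Z (enc (blocks x)) (by omega)
  rw [← hNd] at h2
  have h3 := exec_obey (M := M) N (rounds c ℓ) M (halvings c M ℓ) (blocks x) n Z (rounds c ℓ) le_rfl
    (by rw [hlen]; nlinarith) hZe (by omega)
  simp only [Nat.sub_self, zero_mul, List.drop_zero, maskAt] at h3
  set m := maskAt M N (rounds c ℓ) (halvings c M ℓ) (blocks x) (rounds c ℓ + M) with hm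
  have hml : m.length = N := length_maskAt (by rw [hlen]; nlinarith)
  have hpos : holdPosAux 0 0 m ≤ N := by
    have := holdPosAux_le m 0 0 le_rfl
    omega
  have h4 := exec_findHolder (M := M) m 0 0 le_rfl
    { nn := n, inp := enc ((blocks x).drop ((rounds c ℓ + M) * N)) }
  simp only [Nat.sub_self, zero_add, hml] at h4
  have hZe' : (enc ((blocks x).drop ((rounds c ℓ + M) * N))).length ≤ Z :=
    (length_enc_drop _ _).trans hZe
  have h5 := exec_dropBlocks (M := M) (holdPosAux 0 0 m) Z
    ((blocks x).drop ((rounds c ℓ + M) * N)) { nn := n, a := N - holdPosAux 0 0 m } hZe'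
  rw [List.drop_drop] at h5
  have hidx : (rounds c ℓ + M) * N + holdPosAux 0 0 m = leaderIdx c M x := rfl
  rw [hidx] at h5
  obtain ⟨i, hi, h6⟩ := exec_emit (M := M) n Z (N - holdPosAux 0 0 m)
    ((blocks x).drop (leaderIdx c M x)) (fun b hb' => hb b (List.mem_of_mem_drop hb'))
    ((length_enc_drop _ _).trans hZe)
  rw [firstBlock_drop_leaderIdx] at h6
  have h7 := exec_clear_inp (M := M)
    { a := N - holdPosAux 0 0 m, out := List.ofFn (ext c M ℓ n x) } i
  have h8 := exec_clear_a (M := M) { out := List.ofFn (ext c M ℓ n x) } (N - holdPosAux 0 0 m)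
  refine (h1.seq (h2.seq (h3.seq (h4.seq (h5.seq (h6.seq (h7.seq h8))))))).mono ?_
  have hT := level_le_zero (c := c) (ℓ := ℓ) le_rfl
  have hlog : level c ℓ 0 ≤ ℓ := by
    have := Nat.log_lt_self 2 (x := ℓ + 1) (by omega)
    have h0 : level c ℓ 0 = Nat.log 2 (ℓ + 1) := rfl
    omega
  have hw : (roundsWord (halvings c M ℓ) (rounds c ℓ) (rounds c ℓ)).length ≤ 2 * Z := by
    have : ∀ d ≤ rounds c ℓ, (roundsWord (halvings c M ℓ) (rounds c ℓ) d).length ≤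
        d + level c ℓ (rounds c ℓ - d) := by
      intro d
      induction d with
      | zero => simp [roundsWord]
      | succ d ih =>
        intro hd
        have h := ih (by omega)
        have h1 := level_lt (c := c) (ℓ := ℓ) (t := rounds c ℓ - (d + 1)) (by omega)
        rw [roundsWord, List.length_append, List.length_replicate, List.length_cons, halvings]
        rw [show rounds c ℓ - d = rounds c ℓ - (d + 1) + 1 by omega] at h
        omega
    have h := this _ le_rfl
    rw [Nat.sub_self] at h
    omega
  have a1 : ((roundsWord (halvings c M ℓ) (rounds c ℓ) (rounds c ℓ)).length + M) * (20 * Z + 11) ≤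
      (2 * Z + M) * (20 * Z + 11) := Nat.mul_le_mul_right _ (by omega)
  have a2 : N * (2 * N + 3) ≤ Z * (2 * Z + 3) := Nat.mul_le_mul (by omega) (by omega)
  have a3 : holdPosAux 0 0 m * (2 * Z + 2) ≤ Z * (2 * Z + 2) := Nat.mul_le_mul_right _ (by omega)
  have a4 : (2 * Z + M) * (20 * Z + 11) + Z * (2 * Z + 3) + Z * (2 * Z + 2) + 100 * (Z + c + M + 1) ≤
      2000 * (Z + c + M + 1) ^ 2 := by
    nlinarith [Nat.zero_le (Z * M), Nat.zero_le (Z * c), Nat.zero_le (c * M)]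
  have a5 : 1000 * (Z + c + M + 1) ^ 2 + 2000 * (Z + c + M + 1) ^ 2 =
    3000 * (Z + c + M + 1) ^ 2 := by ring
  omega

end Cmd

theorem encodeInput_eq (a : Σ p : ℕ × ℕ, (Fin p.1 → Block p.2)) :
    encodeInput a = List.replicate a.1.2 (some true) ++ none :: enc (blocks a.2) := by
  simp only [encodeInput, enc, blocks, List.append_assoc, List.cons_append, List.nil_append,
    List.flatMap, List.map_ofFn, Function.comp_def]

/-- The extractor is explicit. -/
theorem isExplicit_ext (c M : ℕ) : IsExplicit (ext c M) := by
  refine Cmd.computable_of_runs (Γ := Sym M) .inp .out (Cmd.extProg c M) (Equiv.refl _)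
    (Equiv.refl _) _ _ (3000 * (Polynomial.X + Polynomial.C (c + M + 1)) ^ 2) fun a => ?_
  obtain ⟨t, ht, hr⟩ := Cmd.exec_extProg c M a.1.1 a.1.2 a.2
  refine ⟨t, ?_, ?_⟩
  · have hlen : (encodeInput a).length = (a.1.2 + 1) * (a.1.1 + 1) := by
      rw [encodeInput_eq, List.length_append, List.length_cons,
        length_enc_le (blocks a.2) a.1.2 (by simp [blocks])]
      simp [blocks]
      ring
    rw [hlen]
    simpa [add_assoc] using ht
  · convert hr using 1
    · rw [encodeInput_eq]
      funext k
      cases k <;> first | rfl | simp [Mem.store]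
    · funext k
      cases k <;> first | rfl | simp [Mem.store]

end ONOSF

/-! ### Expectations, and why good blocks are fresh. -/

namespace ONOSF
open Function MeasureTheory ProbabilityTheory

/-- A distribution on `{0,1}^n` of min-entropy `n` is uniform. -/
theorem apply_of_le_minEntropy {n : ℕ} (p : PMF (Block n)) (h : (n : ℝ) ≤ minEntropy p)
    (b : Block n) : (p b).toReal = ((2 : ℝ) ^ n)⁻¹ := by
  have hle : ∀ b, (p b).toReal ≤ ((2 : ℝ) ^ n)⁻¹ := by
    intro b
    by_cases hb : b ∈ p.support
    · have hpos : 0 < (p b).toReal :=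
        ENNReal.toReal_pos ((p.mem_support_iff b).1 hb) (p.apply_ne_top b)
      have h1 : minEntropy p ≤ Real.logb 2 (1 / (p b).toReal) :=
        ciInf_le (Set.finite_range _).bddBelow (⟨b, hb⟩ : p.support)
      have h2 := h.trans h1
      rw [Real.le_logb_iff_rpow_le (by norm_num) (by positivity), Real.rpow_natCast,
        le_div_iff₀ hpos] at h2
      rw [← one_div, le_div_iff₀ (by positivity), mul_comm]
      exact h2
    · rw [(p.apply_eq_zero_iff b).2 hb]
      simp
  have hsum : ∑ b, (p b).toReal = 1 := by
    have := p.tsum_coe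
    rw [tsum_fintype] at this
    rw [← ENNReal.toReal_sum fun a _ => p.apply_ne_top a, this, ENNReal.toReal_one]
  have hsum' : ∑ _b : Block n, ((2 : ℝ) ^ n)⁻¹ = 1 := by
    simp
  -- There are `2 ^ n` masses, none above `2 ^ (-n)`, with sum `1`: a single smaller one would make
  -- the sum too small.
  by_contra hne
  have := Finset.sum_lt_sum (fun b _ => hle b) ⟨b, Finset.mem_univ b, lt_of_le_of_ne (hle b) hne⟩
  linarith

/-- The expectation of `F` under the source `X`. -/
noncomputable def expect {ℓ n : ℕ} (X : PMF (Fin ℓ → Block n)) (F : (Fin ℓ → Block n) → ℝ) : ℝ :=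
  ∑ x, (X x).toReal * F x

/-- `F x` depends only on the first `a` blocks of `x`. -/
def PrefixDet {ℓ n : ℕ} {α : Type*} (a : ℕ) (F : (Fin ℓ → Block n) → α) : Prop :=
  ∀ x y, (∀ i : Fin ℓ, i.val < a → x i = y i) → F x = F y

/-- Block `i` of the source is uniform and independent of the blocks before it. -/
def IsFresh {ℓ n : ℕ} (X : PMF (Fin ℓ → Block n)) (i : Fin ℓ) : Prop :=
  ∀ (x₀ : Fin ℓ → Block n) (b : Block n),
    expect X (fun x => if (∀ j < i, x j = x₀ j) ∧ x i = b then 1 else 0) =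
      expect X (fun x => if ∀ j < i, x j = x₀ j then 1 else 0) * ((2 : ℝ) ^ n)⁻¹

section expect

variable {ℓ n : ℕ} {X : PMF (Fin ℓ → Block n)}

theorem expect_mono {F F' : (Fin ℓ → Block n) → ℝ} (h : ∀ x, F x ≤ F' x) :
    expect X F ≤ expect X F' :=
  Finset.sum_le_sum fun x _ => mul_le_mul_of_nonneg_left (h x) ENNReal.toReal_nonneg

theorem expect_const (c : ℝ) : expect X (fun _ => c) = c := by
  have h : ∑ x, (X x).toReal = 1 := by
    have := X.tsum_coe
    rw [tsum_fintype] at this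
    rw [← ENNReal.toReal_sum fun a _ => X.apply_ne_top a, this, ENNReal.toReal_one]
  rw [expect, ← Finset.sum_mul, h, one_mul]

theorem expect_add (F F' : (Fin ℓ → Block n) → ℝ) :
    expect X (fun x => F x + F' x) = expect X F + expect X F' := by
  simp only [expect, mul_add, Finset.sum_add_distrib]

theorem expect_sum {ι : Type*} (s : Finset ι) (F : ι → (Fin ℓ → Block n) → ℝ) :
    expect X (fun x => ∑ i ∈ s, F i x) = ∑ i ∈ s, expect X (F i) := by
  simp only [expect, Finset.mul_sum]
  exact Finset.sum_comm

/-- A block that is fresh can be averaged over. -/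
theorem IsFresh.expect_eq {i : Fin ℓ} (hi : IsFresh X i) {F : (Fin ℓ → Block n) → ℝ}
    (hF : PrefixDet (i.val + 1) F) :
    expect X F = expect X fun x => ((2 : ℝ) ^ n)⁻¹ * ∑ b, F (update x i b) := by
  classical
  -- The sum is split by the value `u` of the blocks before `i`. Given `u`, the function `F` depends
  -- on block `i` alone; `ex u` is an arbitrary completion of `u`.
  let π : (Fin ℓ → Block n) → ({j : Fin ℓ // j < i} → Block n) := fun x j => x j
  let ex : ({j : Fin ℓ // j < i} → Block n) → (Fin ℓ → Block n) :=
    fun u j => if h : j < i then u ⟨j, h⟩ else fun _ => false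
  have hex : ∀ x u, π x = u ↔ ∀ j < i, x j = ex u j := by
    intro x u
    constructor
    · rintro rfl j hj
      simp [ex, π, hj]
    · intro h
      funext j
      have := h j.1 j.2
      simpa [ex, π, j.2] using this
  have key : ∀ u b, (∑ x, (X x).toReal * if π x = u ∧ x i = b then 1 else 0) =
      (∑ x, (X x).toReal * if π x = u then 1 else 0) * ((2 : ℝ) ^ n)⁻¹ := by
    intro u b
    have := hi (ex u) b
    simpa only [expect, hex] using this
  have hval : ∀ x u b, π x = u → F (update x i b) = F (update (ex u) i b) := by
    intro x u b h
    apply hF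
    intro j hj
    by_cases hji : j = i
    · simp [hji]
    · have hlt : j < i := lt_of_le_of_ne (Fin.le_def.2 (Nat.lt_succ_iff.1 hj)) hji
      simp only [update_of_ne hji]
      exact (hex x u).1 h j hlt
  have h1 : ∀ x, F x = ∑ u, ∑ b, (if π x = u ∧ x i = b then 1 else 0) * F (update (ex u) i b) := by
    intro x
    rw [Finset.sum_eq_single (π x), Finset.sum_eq_single (x i)]
    · rw [← hval x _ _ rfl]
      simp
    · intro b _ hb
      simp [hb.symm]
    · simp
    · intro u _ hu
      simp [hu.symm]
    · simp
  have h2 : ∀ x, ((2 : ℝ) ^ n)⁻¹ * ∑ b, F (update x i b) =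
      ∑ u, ∑ b, (if π x = u then 1 else 0) * (((2 : ℝ) ^ n)⁻¹ * F (update (ex u) i b)) := by
    intro x
    rw [Finset.sum_eq_single (π x), Finset.mul_sum]
    · refine Finset.sum_congr rfl fun b _ => ?_
      rw [← hval x _ _ rfl]
      simp
    · intro u _ hu
      simp [hu.symm]
    · simp
  have h3 : expect X F = ∑ u, ∑ b,
      (∑ x, (X x).toReal * if π x = u ∧ x i = b then 1 else 0) * F (update (ex u) i b) := by
    unfold expect
    rw [Finset.sum_congr rfl fun x _ => congrArg _ (h1 x)]
    simp only [Finset.mul_sum, Finset.sum_mul, ← mul_assoc]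
    rw [Finset.sum_comm]
    exact Finset.sum_congr rfl fun u _ => Finset.sum_comm
  have h4 : expect X (fun x => ((2 : ℝ) ^ n)⁻¹ * ∑ b, F (update x i b)) = ∑ u, ∑ b,
      (∑ x, (X x).toReal * if π x = u then 1 else 0) *
        (((2 : ℝ) ^ n)⁻¹ * F (update (ex u) i b)) := by
    unfold expect
    rw [Finset.sum_congr rfl fun x _ => congrArg _ (h2 x)]
    simp only [Finset.mul_sum, Finset.sum_mul, ← mul_assoc]
    rw [Finset.sum_comm]
    exact Finset.sum_congr rfl fun u _ => Finset.sum_comm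
  rw [h3, h4]
  simp only [key, mul_assoc]

/-- The block at an index that earlier blocks determine can be averaged over if it is fresh. -/
theorem expect_fresh_block {G : Finset (Fin ℓ)} (hG : ∀ i ∈ G, IsFresh X i) (a : ℕ)
    (J : (Fin ℓ → Block n) → Fin ℓ) (hJ : PrefixDet a J) (haJ : ∀ x, a ≤ (J x).val)
    (H : (Fin ℓ → Block n) → Block n → ℝ) (hH : PrefixDet a H) :
    expect X (fun x => if J x ∈ G then H x (x (J x)) else 0) =
      expect X fun x => if J x ∈ G then ((2 : ℝ) ^ n)⁻¹ * ∑ b, H x b else 0 := by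
  classical
  -- On the part where the index equals a fixed `i`, block `i` can be averaged over: neither the
  -- index nor `H` looks at it, since both are decided by blocks before `a ≤ i`.
  have h1 : ∀ i ∈ G, expect X (fun x => if J x = i then H x (x i) else 0) =
      expect X fun x => if J x = i then ((2 : ℝ) ^ n)⁻¹ * ∑ b, H x b else 0 := by
    intro i hi
    by_cases hai : a ≤ i.val
    · have hupd : ∀ (x : Fin ℓ → Block n) (b : Block n) (j : Fin ℓ), j.val < a →
          update x i b j = x j := by
        intro x b j hj
        exact update_of_ne (fun h => by subst h; omega) _ _
      rw [(hG i hi).expect_eq]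
      · congr 1
        funext x
        simp only [update_self]
        rw [Finset.sum_congr rfl fun b _ => by
          rw [hJ _ x (hupd x b), hH _ x (hupd x b)]]
        split <;> simp
      · intro x y hxy
        have h : ∀ j : Fin ℓ, j.val < a → x j = y j := fun j hj => hxy j (by omega)
        simp only [hJ x y h, hH x y h, hxy i (by omega)]
    · have : ∀ x, J x ≠ i := by
        rintro x rfl
        exact hai (haJ x)
      simp [this]
  have h2 : ∀ F : (Fin ℓ → Block n) → Fin ℓ → ℝ, (fun x => if J x ∈ G then F x (J x) else 0) =
      fun x => ∑ i ∈ G, if J x = i then F x i else 0 := by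
    intro F
    funext x
    rw [Finset.sum_ite_eq]
  rw [h2 fun x i => H x (x i), expect_sum, h2 fun x _ => ((2 : ℝ) ^ n)⁻¹ * ∑ b, H x b, expect_sum]
  exact Finset.sum_congr rfl h1

end expect

/-- The good blocks of a uniform source are fresh. -/
theorem IsUniformONOSF.exists_fresh {g ℓ n : ℕ} {X : PMF (Fin ℓ → Block n)}
    (h : IsUniformONOSF g ℓ n X) : ∃ G : Finset (Fin ℓ), G.card = g ∧ ∀ i ∈ G, IsFresh X i := by
  classical
  obtain ⟨G, hcard, hind, hent, hbad⟩ := h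
  refine ⟨G, hcard, fun i hi x₀ b => ?_⟩
  choose! f hf using hbad
  have hP : ∀ A : Set (Fin ℓ → Block n), (X.toMeasure A).toReal =
      expect X fun x => if x ∈ A then 1 else 0 := by
    intro A
    rw [PMF.toMeasure_apply_fintype, ENNReal.toReal_sum]
    · refine Finset.sum_congr rfl fun x _ => ?_
      by_cases hx : x ∈ A <;> simp [Set.indicator, hx]
    · intro x _
      by_cases hx : x ∈ A <;> simp [Set.indicator, hx, X.apply_ne_top]
  have hmarg : ∀ (j : G) (v : Block n),
      (X.toMeasure ((fun x : Fin ℓ → Block n => x j) ⁻¹' {v})).toReal = ((2 : ℝ) ^ n)⁻¹ := by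
    intro j v
    rw [← apply_of_le_minEntropy _ (hent j j.2) v, ← PMF.toMeasure_apply_singleton _ v (by simp),
      PMF.toMeasure_map_apply _ _ _ (measurable_pi_apply _) (by simp)]
  have hjoint : ∀ (S : Finset G) (v : Fin ℓ → Block n),
      expect X (fun x => if ∀ j ∈ S, x j = v j then 1 else 0) = (((2 : ℝ) ^ n)⁻¹) ^ S.card := by
    intro S v
    have h := hind.measure_inter_preimage_eq_mul S (sets := fun j => {v j}) (fun j _ => by simp)
    have h' := congrArg ENNReal.toReal h
    rw [ENNReal.toReal_prod, Finset.prod_congr rfl fun j _ => hmarg j (v j), hP,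
      Finset.prod_const] at h'
    rw [← h']
    congr 1
    funext x
    simp
  let S : Finset G := Finset.univ.filter fun j => j.1 < i
  by_cases hx : ∃ x₁ ∈ X.support, ∀ j < i, x₁ j = x₀ j
  · obtain ⟨x₁, hx₁, hx₁0⟩ := hx
    -- Bad blocks are functions of earlier blocks. Hence two points of the support with the same
    -- good blocks before `i` agree on all blocks before `i`, by induction on the position, and the
    -- event involves only independent uniform blocks.
    have hext : ∀ x ∈ X.support, (∀ j < i, x j = x₀ j) ↔ ∀ j ∈ S, x j.1 = x₀ j := by
      intro x hxs
      refine ⟨fun h j hj => h j (by simpa [S] using hj), fun h j => ?_⟩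
      induction j using WellFoundedLT.induction with
      | _ j ih =>
        intro hj
        by_cases hjG : j ∈ G
        · exact h ⟨j, hjG⟩ (by simpa [S] using hj)
        · rw [hf j hjG x hxs, ← hx₁0 j hj, hf j hjG x₁ hx₁]
          congr 1
          funext k
          rw [hx₁0 _ (k.2.trans hj)]
          exact ih k k.2 (k.2.trans hj)
    have hcongr : ∀ F F' : (Fin ℓ → Block n) → ℝ, (∀ x ∈ X.support, F x = F' x) →
        expect X F = expect X F' := by
      intro F F' h
      refine Finset.sum_congr rfl fun x _ => ?_
      by_cases hx : x ∈ X.support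
      · rw [h x hx]
      · rw [(X.apply_eq_zero_iff x).2 hx]
        simp
    have hiS : (⟨i, hi⟩ : G) ∉ S := by simp [S]
    have e1 := hjoint S x₀
    have e2 := hjoint (insert ⟨i, hi⟩ S) (update x₀ i b)
    rw [Finset.card_insert_of_notMem hiS, pow_succ] at e2
    have d1 : expect X (fun x => if ∀ j < i, x j = x₀ j then 1 else 0) =
        expect X (fun x => if ∀ j ∈ S, x j.1 = x₀ j then 1 else 0) := by
      apply hcongr
      intro x hx
      simp only [hext x hx]
    have d2 : expect X (fun x => if (∀ j < i, x j = x₀ j) ∧ x i = b then 1 else 0) =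
        expect X (fun x => if ∀ j ∈ insert ⟨i, hi⟩ S, x j.1 = update x₀ i b j then 1 else 0) := by
      apply hcongr
      intro x hx
      congr 1
      rw [hext x hx]
      simp only [Finset.mem_insert, forall_eq_or_imp, update_self, eq_iff_iff]
      rw [and_comm]
      refine and_congr Iff.rfl (forall₂_congr fun j hj => ?_)
      rw [update_of_ne]
      rintro h
      exact hiS (by convert hj using 1; exact Subtype.ext h.symm)
    rw [d1, d2, e1, e2]
  -- This prefix has probability `0`, and both sides vanish.
  · push Not at hx
    have h0 : ∀ F : (Fin ℓ → Block n) → ℝ, (∀ x ∈ X.support, F x = 0) → expect X F = 0 := by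
      intro F h
      refine Finset.sum_eq_zero fun x _ => ?_
      by_cases hx : x ∈ X.support
      · rw [h x hx, mul_zero]
      · rw [(X.apply_eq_zero_iff x).2 hx]
        simp
    rw [h0, h0, zero_mul]
    · intro x hxs
      obtain ⟨j, hj, hne⟩ := hx x hxs
      exact if_neg fun h => hne (h j hj)
    · intro x hxs
      obtain ⟨j, hj, hne⟩ := hx x hxs
      exact if_neg fun h => hne (h.1 j hj)

end ONOSF

/-! ### Combinatorics of the minority vote and of picking a player. -/

namespace ONOSF
open Function

/-- The positions of the waiting players. -/
def waiting (m : List Mark) : Finset ℕ := (Finset.range m.length).filter fun j => m[j]? = some .wait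

theorem mem_waiting {m : List Mark} {j : ℕ} : j ∈ waiting m ↔ m[j]? = some .wait := by
  rw [waiting, Finset.mem_filter, Finset.mem_range, and_iff_right_iff_imp]
  intro h
  exact (List.getElem?_eq_some_iff.1 h).1

theorem card_filter_getElem? {α : Type*} [DecidableEq α] (m : List α) (a : α) :
    ((Finset.range m.length).filter fun j => m[j]? = some a).card = m.count a := by
  induction m with
  | nil => simp
  | cons x m ih =>
    rw [Finset.card_filter] at ih ⊢
    rw [List.length_cons, Finset.sum_range_succ', List.count_cons, ← ih]
    simp

theorem card_waiting (m : List Mark) : (waiting m).card = m.count .wait :=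
  card_filter_getElem? m _

/-- Invariant of the ballot stack: it holds copies of a single bit, and the excess of `true` over
`false` changes by the excess among the votes read. The identity is written without subtraction. -/
theorem foldl_balStep (z : List (Mark × Bool)) (d : ℕ) (b : Bool) :
    ∃ d' b', z.foldl (fun D p => if p.1 = .wait then balStep D p.2 else D) (List.replicate d b) =
      List.replicate d' b' ∧
      (List.replicate d' b').count true + (List.replicate d b).count false + z.count (.wait, false) =
      (List.replicate d' b').count false + (List.replicate d b).count true +
        z.count (.wait, true) := by
  induction z generalizing d b with
  | nil => exact ⟨d, b, rfl, by simp [add_comm]⟩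
  | cons p z ih =>
    obtain ⟨x, v⟩ := p
    by_cases hx : x = .wait
    · subst hx
      have hstep : ∃ d₁ b₁, balStep (List.replicate d b) v = List.replicate d₁ b₁ ∧
          (List.replicate d₁ b₁).count true + (List.replicate d b).count false + [v].count false =
          (List.replicate d₁ b₁).count false + (List.replicate d b).count true +
            [v].count true := by
        rcases d with _ | d
        · refine ⟨1, v, rfl, ?_⟩
          cases v <;> simp
        · by_cases hbv : b = v
          · subst hbv
            refine ⟨d + 2, b, by simp [balStep, List.replicate_succ], ?_⟩
            cases b <;> simp [List.count_replicate]
          · refine ⟨d, b, by simp [balStep, List.replicate_succ, hbv], ?_⟩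
            cases b <;> cases v <;> simp [List.count_replicate] at hbv ⊢
      obtain ⟨d₁, b₁, h₁, e₁⟩ := hstep
      obtain ⟨d₂, b₂, h₂, e₂⟩ := ih d₁ b₁
      refine ⟨d₂, b₂, by simpa [h₁] using h₂, ?_⟩
      simp only [List.count_cons, List.count_nil] at e₁ ⊢
      cases v <;> simp at e₁ ⊢ <;> omega
    · obtain ⟨d₂, b₂, h₂, e₂⟩ := ih d b
      refine ⟨d₂, b₂, by simpa [hx] using h₂, ?_⟩
      simpa [List.count_cons, hx] using e₂

/-- A bit on the stack at the end has the strict majority, so its negation is the minority. An empty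
stack means a tie, and then `false` has exactly half of the votes. -/
theorem count_minority_le (z : List (Mark × Bool)) :
    2 * z.count (.wait, minority (surplus z)) ≤
      z.count (.wait, true) + z.count (.wait, false) := by
  obtain ⟨d, b, h, e⟩ := foldl_balStep z 0 false
  rw [surplus, show ([] : List Bool) = List.replicate 0 false from rfl, h]
  rcases d with _ | d
  · simp [minority] at e ⊢
    omega
  · cases b <;> simp [minority, List.replicate_succ, List.count_replicate] at e ⊢ <;> omega

theorem getElem?_halveMask_zip (m : List Mark) (votes : List Bool) (j : ℕ) :
    (halveMask (m.zip votes))[j]? = some .wait ↔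
      m[j]? = some .wait ∧ votes[j]? = some (minority (surplus (m.zip votes))) := by
  simp only [halveMask, List.getElem?_map, Option.map_eq_some_iff, Prod.exists,
    List.getElem?_zip_eq_some]
  constructor
  · rintro ⟨x, v, h, hw⟩
    split at hw <;> simp_all
  · rintro ⟨h₁, h₂⟩
    exact ⟨_, _, ⟨h₁, h₂⟩, by simp⟩

theorem count_zip_wait (m : List Mark) (votes : List Bool) (h : m.length = votes.length) :
    (m.zip votes).count (.wait, true) + (m.zip votes).count (.wait, false) = m.count .wait := by
  induction m generalizing votes with
  | nil => simp
  | cons x m ih =>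
    rcases votes with _ | ⟨v, votes⟩
    · simp at h
    · have := ih votes (by simpa using h)
      rw [List.zip_cons_cons, List.count_cons, List.count_cons, List.count_cons]
      cases x <;> cases v <;> simp <;> omega

theorem count_halveMask_zip_le (m : List Mark) (votes : List Bool) (h : m.length = votes.length) :
    2 * (halveMask (m.zip votes)).count .wait ≤ m.count .wait := by
  rw [← count_zip_wait m votes h]
  refine le_trans (Nat.mul_le_mul_left 2 ?_) (count_minority_le _)
  refine le_of_eq ?_
  rw [halveMask, List.count, List.countP_map, List.count]
  congr 1
  funext p
  obtain ⟨x, v⟩ := p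
  by_cases h : x = .wait ∧ v = minority (surplus (m.zip votes)) <;> simp_all

/-- The halvings of a row keep the waiting players whose blocks start with some `w`, and at most
a fraction of `2 ^ (-k)` of the players. -/
theorem exists_shrink (k : ℕ) (m : List Mark) (row : List (List Bool)) (h : m.length = row.length)
    (hk : ∀ b ∈ row, k ≤ b.length) :
    ∃ w : List Bool, w.length = k ∧
      (∀ j : ℕ, (shrink k m row)[j]? = some .wait ↔
        m[j]? = some .wait ∧ ∃ b, row[j]? = some b ∧ b.take k = w) ∧
      2 ^ k * (shrink k m row).count .wait ≤ m.count .wait := by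
  induction k generalizing m row with
  | zero =>
    refine ⟨[], rfl, fun j => ?_, by simp [shrink]⟩
    rw [shrink, iff_self_and]
    intro hj
    have hlt := (List.getElem?_eq_some_iff.1 hj).1
    exact ⟨row[j], List.getElem?_eq_getElem (h ▸ hlt), by simp⟩
  | succ k ih =>
    have hv : m.length = (row.map fun b => b.headD false).length := by simpa using h
    obtain ⟨w, hw, hiff, hcount⟩ := ih (halveMask (m.zip (row.map fun b => b.headD false)))
      (row.map List.tail) (by simp [h]) (by
        intro b hb
        obtain ⟨b', hb', rfl⟩ := List.mem_map.1 hb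
        have := hk b' hb'
        simp
        omega)
    -- The word `w` collects the successive minority votes.
    refine ⟨minority (surplus (m.zip (row.map fun b => b.headD false))) :: w, by simp [hw],
      fun j => ?_, ?_⟩
    · rw [shrink, hiff, getElem?_halveMask_zip, and_assoc]
      refine and_congr_right fun _ => ?_
      simp only [List.getElem?_map, Option.map_eq_some_iff]
      constructor
      · rintro ⟨⟨b, hb, hb1⟩, _, ⟨b', hb', rfl⟩, h2⟩
        obtain rfl : b = b' := by simpa [hb] using hb'
        refine ⟨b, hb, ?_⟩
        have := hk b (List.mem_of_getElem? hb)
        rcases b with _ | ⟨v, b⟩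
        · simp at this
        · simp at hb1 h2
          simp [hb1, h2]
      · rintro ⟨b, hb, hb1⟩
        have := hk b (List.mem_of_getElem? hb)
        rcases b with _ | ⟨v, b⟩
        · simp at this
        · simp at hb1
          exact ⟨⟨_, hb, by simp [hb1]⟩, _, ⟨_, hb, rfl⟩, by simp [hb1]⟩
    · have := count_halveMask_zip_le m _ hv
      rw [shrink, pow_succ]
      nlinarith

theorem getElem?_pick_none (m : List Mark) (j : ℕ) :
    (pick none m)[j]? = m[j]?.map fun x => if x = .wait then .wait else .idle := by
  induction m generalizing j with
  | nil => simp [pick]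
  | cons x m ih => cases x <;> cases j <;> simp [pick, ih]

/-- Picking player `v` gives it the baton and retires the players that do not wait. -/
theorem exists_pick (m : List Mark) (v : ℕ) (hv : v < m.count .wait) :
    ∃ j : ℕ, m[j]? = some .wait ∧ ((waiting m).filter (· < j)).card = v ∧
      ∀ i : ℕ, (pick (some v) m)[i]? = if i = j then some .hold else
        m[i]?.map fun x => if x = .wait then .wait else .idle := by
  have : ∃ j : ℕ, m[j]? = some .wait ∧ (m.take j).count .wait = v ∧
      ∀ i : ℕ, (pick (some v) m)[i]? = if i = j then some .hold else
        m[i]?.map fun x => if x = .wait then .wait else .idle := by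
    induction m generalizing v with
    | nil => simp at hv
    | cons x m ih =>
      by_cases hx : x = .wait
      · subst hx
        rcases v with _ | v
        · refine ⟨0, by simp, by simp, fun i => ?_⟩
          cases i <;> simp [pick, getElem?_pick_none]
        · obtain ⟨j, h1, h2, h3⟩ := ih v (by simpa using hv)
          refine ⟨j + 1, by simpa using h1, by simpa using h2, fun i => ?_⟩
          cases i <;> simp [pick, h3]
      · obtain ⟨j, h1, h2, h3⟩ := ih v (by simpa [List.count_cons, hx] using hv)
        refine ⟨j + 1, by simpa using h1, by simpa [List.count_cons, hx] using h2, fun i => ?_⟩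
        have hp : pick (some v) (x :: m) = .idle :: pick (some v) m := by
          cases x <;> first | exact absurd rfl hx | (cases v <;> rfl)
        cases i <;> simp [hp, h3, hx]
  obtain ⟨j, h1, h2, h3⟩ := this
  refine ⟨j, h1, ?_, h3⟩
  rw [← h2, ← card_waiting]
  congr 1
  ext i
  simp only [Finset.mem_filter, mem_waiting, List.getElem?_take]
  by_cases hij : i < j <;> simp [hij]

end ONOSF

/-! ### Averaging products over the fresh blocks of a row. -/

namespace ONOSF
open Function

/-- The block number `i`, if there is one. -/
def blockAt {ℓ n : ℕ} (x : Fin ℓ → Block n) (i : ℕ) : Block n :=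
  if h : i < ℓ then x ⟨i, h⟩ else fun _ => false

open Classical in
/-- The probability of `p` under the source `X`. -/
noncomputable def prob {ℓ n : ℕ} (X : PMF (Fin ℓ → Block n)) (p : (Fin ℓ → Block n) → Prop) : ℝ :=
  expect X fun x => if p x then 1 else 0

/-- Block number `i` exists and is fresh. -/
def IsFreshAt {ℓ n : ℕ} (X : PMF (Fin ℓ → Block n)) (i : ℕ) : Prop :=
  ∃ h : i < ℓ, IsFresh X ⟨i, h⟩

section

variable {ℓ n : ℕ} {X : PMF (Fin ℓ → Block n)}

theorem PrefixDet.mono {α : Type*} {a b : ℕ} {F : (Fin ℓ → Block n) → α} (hF : PrefixDet a F)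
    (hab : a ≤ b) : PrefixDet b F :=
  fun x y h => hF x y fun i hi => h i (by omega)

theorem PrefixDet.comp {α β : Type*} {a : ℕ} {F : (Fin ℓ → Block n) → α} (hF : PrefixDet a F)
    (f : α → β) : PrefixDet a fun x => f (F x) :=
  fun x y h => congrArg f (hF x y h)

theorem PrefixDet.comp₂ {α β γ : Type*} {a : ℕ} {F : (Fin ℓ → Block n) → α}
    {F' : (Fin ℓ → Block n) → β} (hF : PrefixDet a F) (hF' : PrefixDet a F') (f : α → β → γ) :
    PrefixDet a fun x => f (F x) (F' x) :=
  fun x y h => congrArg₂ f (hF x y h) (hF' x y h)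

theorem prefixDet_blockAt {a i : ℕ} (h : i < a) :
    PrefixDet a fun x : Fin ℓ → Block n => blockAt x i := by
  intro x y hxy
  unfold blockAt
  split
  · exact hxy _ h
  · rfl

theorem prefixDet_prod {a : ℕ} (s : Finset ℕ) {F : ℕ → (Fin ℓ → Block n) → ℝ}
    (h : ∀ j ∈ s, PrefixDet a (F j)) : PrefixDet a fun x => ∏ j ∈ s, F j x :=
  fun x y hxy => Finset.prod_congr rfl fun j hj => h j hj x y hxy

/-- In an expectation, the factors that depend on the single blocks of a row can be replaced by
bounds for their averages. -/
theorem expect_prod_le {a u : ℕ} {P : Finset ℕ} (hP : ∀ j ∈ P, IsFreshAt X (a + j))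
    {S : (Fin ℓ → Block n) → Finset ℕ} (hS : PrefixDet a S) (hSP : ∀ x, S x ⊆ P)
    {ψ : Block n → ℝ} (hψ : ∀ b, 0 ≤ ψ b) {q : ℝ} (hq : ((2 : ℝ) ^ n)⁻¹ * ∑ b, ψ b ≤ q)
    {A : (Fin ℓ → Block n) → ℝ} (hA : PrefixDet a A) (hA0 : ∀ x, 0 ≤ A x) :
    expect X (fun x => A x * ∏ j ∈ Finset.range u, if j ∈ S x then ψ (blockAt x (a + j)) else 1) ≤
      expect X fun x => A x * ∏ j ∈ Finset.range u, if j ∈ S x then q else 1 := by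
  have hq0 : 0 ≤ q := le_trans (mul_nonneg (by positivity) (Finset.sum_nonneg fun b _ => hψ b)) hq
  induction u generalizing A with
  | zero => simp
  | succ u ih =>
    -- The last block of the row is averaged first, with everything before it fixed; its bound `q`
    -- then joins the factor `A`. Bad blocks of the row may depend on the good ones before them, but
    -- they never occur in a factor, since `S x` lies in `P`.
    have ih' := ih (A := fun x => A x * if u ∈ S x then q else 1)
      (hA.comp₂ hS fun r s => r * if u ∈ s then q else 1)
      (fun x => mul_nonneg (hA0 x) (by split <;> simp [hq0]))
    set B : (Fin ℓ → Block n) → ℝ := fun x => A x * ∏ j ∈ Finset.range u,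
      if j ∈ S x then ψ (blockAt x (a + j)) else 1 with hB
    have hB0 : ∀ x, 0 ≤ B x := fun x =>
      mul_nonneg (hA0 x) (Finset.prod_nonneg fun j _ => by split <;> simp [hψ])
    have hBp : PrefixDet (a + u) B := by
      refine (hA.mono (by omega)).comp₂ (prefixDet_prod _ fun j hj => ?_) (· * ·)
      have := Finset.mem_range.1 hj
      exact (hS.mono (by omega)).comp₂ (prefixDet_blockAt (show a + j < a + u by omega))
        fun s b => if j ∈ s then ψ b else 1
    have key : expect X (fun x => B x * if u ∈ S x then ψ (blockAt x (a + u)) else 1) ≤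
        expect X fun x => B x * if u ∈ S x then q else 1 := by
      by_cases hu : u ∈ P
      · obtain ⟨hlt, hfr⟩ := hP u hu
        rw [hfr.expect_eq]
        · refine expect_mono fun x => ?_
          have hupd : ∀ (b : Block n) (j : Fin ℓ), j.val < a + u →
              update x ⟨a + u, hlt⟩ b j = x j := by
            intro b j hj
            exact update_of_ne (fun h => by subst h; simp at hj) _ _
          have hb : ∀ b : Block n, blockAt (update x ⟨a + u, hlt⟩ b) (a + u) = b := by
            intro b
            simp [blockAt, hlt]
          rw [Finset.sum_congr rfl fun b _ => by
            rw [hBp _ x (hupd b), hS _ x fun j hj => hupd b j (by omega), hb b]]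
          rw [← Finset.mul_sum, mul_left_comm]
          refine mul_le_mul_of_nonneg_left ?_ (hB0 x)
          by_cases h : u ∈ S x
          · simpa [h] using hq
          · simp [h]
        · refine (hBp.mono (by simp)).comp₂ ?_ (· * ·)
          exact (hS.mono (by simp; omega)).comp₂ (prefixDet_blockAt (by simp))
            fun s b => if u ∈ s then ψ b else 1
      · have : ∀ x, u ∉ S x := fun x h => hu (hSP x h)
        simp [this]
    calc _ = expect X (fun x => B x * if u ∈ S x then ψ (blockAt x (a + u)) else 1) := by
          simp only [Finset.prod_range_succ, hB, mul_assoc]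
      _ ≤ _ := key
      _ = expect X (fun x => (A x * if u ∈ S x then q else 1) * ∏ j ∈ Finset.range u,
            if j ∈ S x then ψ (blockAt x (a + j)) else 1) := by
          simp only [hB]
          congr 1
          funext x
          ring
      _ ≤ _ := ih'
      _ = _ := by
          congr 1
          funext x
          rw [Finset.prod_range_succ]
          ring

end

/-- The number of blocks with given first bits. -/
theorem sum_take_eq {k n : ℕ} (hk : k ≤ n) (w : List Bool) (hw : w.length = k) :
    ∑ b : Block n, (if (List.ofFn b).take k = w then 1 else 0 : ℝ) = 2 ^ (n - k) := by
  obtain ⟨r, rfl⟩ := Nat.exists_eq_add_of_le hk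
  subst hw
  have e : ∀ (u : Fin w.length → Bool) (v : Fin r → Bool),
      ((List.ofFn (Fin.append u v)).take w.length = w) ↔ u = w.get := by
    intro u v
    rw [List.ofFn_fin_append, List.take_left' (by simp)]
    constructor
    · intro h
      apply List.ofFn_injective
      rw [h, List.ofFn_get]
    · rintro rfl
      rw [List.ofFn_get]
  rw [← (Fin.appendEquiv w.length r).sum_comp, Fintype.sum_prod_type]
  simp only [Fin.appendEquiv, Equiv.coe_fn_mk, e]
  simp

/-- Indeed `(1 + δ + δ²/2) (1 - δ + δ²/2) = 1 + δ⁴/4 ≥ 1`, and the first factor is at most `exp δ`.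
-/
theorem exp_neg_le {δ : ℝ} (h : 0 ≤ δ) : Real.exp (-δ) ≤ 1 - δ + δ ^ 2 / 2 := by
  have h1 := Real.quadratic_le_exp_of_nonneg h
  rw [Real.exp_neg, inv_le_comm₀ (Real.exp_pos _) (by nlinarith [sq_nonneg (δ - 1)])]
  refine le_trans ?_ h1
  rw [inv_le_iff_one_le_mul₀ (by nlinarith [sq_nonneg (δ - 1)])]
  nlinarith [sq_nonneg (δ ^ 2)]

end ONOSF

/-! ### One round of halving preserves the share of good players. -/

namespace ONOSF
open Function

section

variable {ℓ n : ℕ} {X : PMF (Fin ℓ → Block n)}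

theorem getElem?_blocks (x : Fin ℓ → Block n) {i : ℕ} (h : i < ℓ) :
    (blocks x)[i]? = some (List.ofFn (blockAt x i)) := by
  rw [blocks, List.getElem?_ofFn, dif_pos h, blockAt, dif_pos h]

theorem length_blocks (x : Fin ℓ → Block n) : (blocks x).length = ℓ := by
  simp [blocks]

theorem getElem?_rowOf (x : Fin ℓ → Block n) {N t j : ℕ} (h : (t + 1) * N ≤ ℓ) (hj : j < N) :
    (rowOf N t (blocks x))[j]? = some (List.ofFn (blockAt x (t * N + j))) := by
  rw [rowOf, List.getElem?_take_of_lt hj, List.getElem?_drop, getElem?_blocks]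
  nlinarith

theorem prefixDet_rowOf (N t : ℕ) :
    PrefixDet ((t + 1) * N) fun x : Fin ℓ → Block n => rowOf N t (blocks x) := by
  intro x y h
  refine List.ext_getElem? fun j => ?_
  simp only [rowOf]
  rw [List.getElem?_take, List.getElem?_take]
  split
  · rename_i hj
    rw [List.getElem?_drop, List.getElem?_drop, blocks, blocks, List.getElem?_ofFn,
      List.getElem?_ofFn]
    split
    · rw [h _ (by simp only; nlinarith)]
    · rfl
  · rfl

/-- The state before row `t` is decided by the rows before it. Fresh blocks of row `t` are therefore
still uniform given the state; here the online order of the source is used. -/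
theorem prefixDet_maskAt (M N T : ℕ) (k : ℕ → ℕ) (t : ℕ) :
    PrefixDet (t * N) fun x : Fin ℓ → Block n => maskAt M N T k (blocks x) t := by
  induction t with
  | zero => exact fun x y _ => rfl
  | succ t ih =>
    have := (ih.mono (show t * N ≤ (t + 1) * N by nlinarith)).comp₂ (prefixDet_rowOf N t)
      fun m row => if t < T then shrink (k t) m row else passBaton M m row
    exact this

/-- A halved committee keeps about its share of good players. -/
theorem prob_shrink_le {N t k : ℕ} (hk : k ≤ n) (ht : (t + 1) * N ≤ ℓ) {P : Finset ℕ}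
    (hP : ∀ j ∈ P, IsFreshAt X (t * N + j)) {m : (Fin ℓ → Block n) → List Mark}
    (hm : PrefixDet (t * N) m) (hlen : ∀ x, (m x).length = N) {g₀ δ : ℝ}
    (hδ0 : 0 ≤ δ) (hδ1 : δ ≤ 1) :
    prob X (fun x => ((waiting (shrink k (m x) (rowOf N t (blocks x))) ∩ P).card : ℝ) <
        (1 - δ) * (g₀ / 2 ^ k)) ≤
      prob X (fun x => ((waiting (m x) ∩ P).card : ℝ) < g₀) +
        2 ^ k * Real.exp (-(δ ^ 2 * (g₀ / 2 ^ k) / 2)) := by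
  classical
  set a := t * N with ha
  let S : (Fin ℓ → Block n) → Finset ℕ := fun x => waiting (m x) ∩ P
  have hS : PrefixDet a S := hm.comp fun m => waiting m ∩ P
  have hSN : ∀ x, S x ⊆ Finset.range N := by
    intro x j hj
    have := Finset.mem_of_mem_filter j (Finset.mem_inter.1 hj).1
    rwa [hlen] at this
  let θ := (1 - δ) * (g₀ / 2 ^ k)
  -- Exponential Markov inequality for the lower tail, with the deviation `δ` itself as parameter:
  -- `A` carries the factor `exp (δ θ)` and vanishes where the committee already has too few good
  -- members, while `ψ w` contributes `exp (-δ)` for every good member that chooses `w`.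
  let A : (Fin ℓ → Block n) → ℝ :=
    fun x => if ((S x).card : ℝ) < g₀ then 0 else Real.exp (δ * θ)
  have hA : PrefixDet a A := hS.comp fun s => if (s.card : ℝ) < g₀ then 0 else Real.exp (δ * θ)
  have hA0 : ∀ x, 0 ≤ A x := fun x => by
    simp only [A]
    split <;> positivity
  let ψ : List.Vector Bool k → Block n → ℝ :=
    fun w b => if (List.ofFn b).take k = w.1 then Real.exp (-δ) else 1
  have hψ0 : ∀ w b, 0 ≤ ψ w b := fun w b => by
    simp only [ψ]
    split <;> positivity
  set q : ℝ := 1 - (2 ^ k)⁻¹ * (1 - Real.exp (-δ)) with hqdef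
  have hψ : ∀ w, ((2 : ℝ) ^ n)⁻¹ * ∑ b, ψ w b ≤ q := by
    intro w
    have h1 : ∀ b : Block n, ψ w b =
        1 - (1 - Real.exp (-δ)) * (if (List.ofFn b).take k = w.1 then 1 else 0) := by
      intro b
      simp only [ψ]
      split <;> ring
    rw [Finset.sum_congr rfl fun b _ => h1 b, Finset.sum_sub_distrib, ← Finset.mul_sum,
      sum_take_eq hk w.1 w.2]
    obtain ⟨r, rfl⟩ := Nat.exists_eq_add_of_le hk
    rw [Nat.add_sub_cancel_left]
    apply le_of_eq
    simp only [Finset.sum_const, Finset.card_univ, Fintype.card_pi_const, Fintype.card_bool,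
      nsmul_eq_mul, Nat.cast_pow, Nat.cast_ofNat, mul_one, hqdef]
    field_simp
    ring
  have hq : q ≤ Real.exp (-((2 ^ k)⁻¹ * (δ - δ ^ 2 / 2))) := by
    have h1 := exp_neg_le hδ0
    have h2 := Real.add_one_le_exp (-(((2 : ℝ) ^ k)⁻¹ * (δ - δ ^ 2 / 2)))
    have h3 : ((2 : ℝ) ^ k)⁻¹ * (δ - δ ^ 2 / 2) ≤ (2 ^ k)⁻¹ * (1 - Real.exp (-δ)) :=
      mul_le_mul_of_nonneg_left (by linarith) (by positivity)
    linarith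
  have hq0 : 0 ≤ q := le_trans (mul_nonneg (by positivity) (Finset.sum_nonneg fun b _ =>
    hψ0 (List.Vector.replicate k false) b)) (hψ _)
  have hrow : ∀ w, expect X (fun x => A x * ∏ j ∈ Finset.range N,
      if j ∈ S x then ψ w (blockAt x (a + j)) else 1) ≤
      Real.exp (-(δ ^ 2 * (g₀ / 2 ^ k) / 2)) := by
    intro w
    refine (expect_prod_le hP hS (fun x => Finset.inter_subset_right) (hψ0 w) (hψ w) hA hA0).trans ?_
    rw [← expect_const (X := X) (Real.exp _)]
    refine expect_mono fun x => ?_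
    rw [← Finset.prod_filter, Finset.filter_mem_eq_inter, Finset.inter_eq_right.2 (hSN x),
      Finset.prod_const]
    simp only [A]
    split
    · rw [zero_mul]
      positivity
    · rename_i hg
      push Not at hg
      calc Real.exp (δ * θ) * q ^ (S x).card
          ≤ Real.exp (δ * θ) * Real.exp (-((2 ^ k)⁻¹ * (δ - δ ^ 2 / 2))) ^ (S x).card :=
            mul_le_mul_of_nonneg_left (pow_le_pow_left₀ hq0 hq _) (by positivity)
        _ ≤ _ := by
            rw [← Real.exp_nat_mul, ← Real.exp_add, Real.exp_le_exp]
            have h1 : (0 : ℝ) ≤ (2 ^ k)⁻¹ * (δ - δ ^ 2 / 2) :=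
              mul_nonneg (by positivity) (by nlinarith)
            have h2 := mul_le_mul_of_nonneg_right hg h1
            -- The terms linear in `δ` cancel, and `-δ² + δ²/2` remains.
            have h3 : δ * θ - g₀ * ((2 ^ k)⁻¹ * (δ - δ ^ 2 / 2)) =
                -(δ ^ 2 * (g₀ / 2 ^ k) / 2) := by
              simp only [θ]
              field_simp
              ring
            linarith
  -- The winning word depends on the whole row, bad votes included, so the moments of all `2 ^ k`
  -- words are added. No independence from the bad votes is needed.
  have hpt : prob X (fun x =>
      ((waiting (shrink k (m x) (rowOf N t (blocks x))) ∩ P).card : ℝ) < θ) ≤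
      expect X fun x => (if ((waiting (m x) ∩ P).card : ℝ) < g₀ then 1 else 0) +
        ∑ w, A x * ∏ j ∈ Finset.range N, if j ∈ S x then ψ w (blockAt x (a + j)) else 1 := by
    refine expect_mono fun x => ?_
    have hnn : ∀ w, 0 ≤ A x * ∏ j ∈ Finset.range N,
        if j ∈ S x then ψ w (blockAt x (a + j)) else 1 := fun w =>
      mul_nonneg (hA0 x) (Finset.prod_nonneg fun j _ => by split <;> simp [hψ0])
    have hsum := Finset.sum_nonneg fun w (_ : w ∈ Finset.univ) => hnn w
    split
    · rename_i hlt
      by_cases hg : ((waiting (m x) ∩ P).card : ℝ) < g₀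
      · rw [if_pos hg]
        linarith
      · have hrl : (m x).length = (rowOf N t (blocks x)).length := by
          rw [length_rowOf (by rwa [length_blocks]), hlen]
        have hbl : ∀ j < N, ∀ b, (rowOf N t (blocks x))[j]? = some b ↔
            b = List.ofFn (blockAt x (a + j)) := by
          intro j hj b
          rw [getElem?_rowOf x ht hj, Option.some.injEq, eq_comm]
        obtain ⟨w, hw, hiff, -⟩ := exists_shrink k (m x) _ hrl (by
          intro b hb
          obtain ⟨j, hj⟩ := List.getElem?_of_mem hb
          have hjN : j < N := by
            have := (List.getElem?_eq_some_iff.1 hj).1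
            rwa [← hrl, hlen] at this
          rw [(hbl j hjN b).1 hj, List.length_ofFn]
          exact hk)
        rw [if_neg hg, zero_add]
        refine le_trans ?_ (Finset.single_le_sum (fun w _ => hnn w) (Finset.mem_univ ⟨w, hw⟩))
        have hset : waiting (shrink k (m x) (rowOf N t (blocks x))) ∩ P =
            (S x).filter fun j => (List.ofFn (blockAt x (a + j))).take k = w := by
          ext j
          simp only [S, Finset.mem_inter, Finset.mem_filter, mem_waiting, hiff]
          constructor
          · rintro ⟨⟨h1, b, h2, h3⟩, h4⟩
            have hjN : j < N := by
              have := (List.getElem?_eq_some_iff.1 h1).1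
              rwa [hlen] at this
            rw [(hbl j hjN b).1 h2] at h3
            exact ⟨⟨h1, h4⟩, h3⟩
          · rintro ⟨⟨h1, h4⟩, h3⟩
            have hjN : j < N := by
              have := (List.getElem?_eq_some_iff.1 h1).1
              rwa [hlen] at this
            exact ⟨⟨h1, _, (hbl j hjN _).2 rfl, h3⟩, h4⟩
        rw [hset] at hlt
        rw [← Finset.prod_filter, Finset.filter_mem_eq_inter, Finset.inter_eq_right.2 (hSN x)]
        simp only [ψ]
        rw [← Finset.prod_filter, Finset.prod_const, ← Real.exp_nat_mul]
        simp only [A]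
        rw [if_neg hg, ← Real.exp_add, Real.one_le_exp_iff]
        nlinarith
    · have : (0 : ℝ) ≤ if ((waiting (m x) ∩ P).card : ℝ) < g₀ then 1 else 0 := by
        split <;> simp
      linarith
  refine hpt.trans ?_
  rw [expect_add, expect_sum]
  refine add_le_add le_rfl ?_
  refine (Finset.sum_le_sum fun w _ => hrow w).trans ?_
  rw [Finset.sum_const, Finset.card_univ, card_vector, Fintype.card_bool, nsmul_eq_mul]
  push_cast
  exact le_rfl

end

end ONOSF

/-! ### The sizes of the committees. -/

namespace ONOSF
open Function

/-- The expected size of the committee after `t` rounds. -/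
noncomputable def size (c M ℓ t : ℕ) : ℝ :=
  players c M ℓ / 2 ^ (∑ s ∈ Finset.range t, halvings c M ℓ s)

theorem size_succ (c M ℓ t : ℕ) :
    size c M ℓ (t + 1) = size c M ℓ t / 2 ^ halvings c M ℓ t := by
  rw [size, size, Finset.sum_range_succ, pow_add, div_div]

section

variable {c M ℓ : ℕ}

theorem size_nonneg (t : ℕ) : 0 ≤ size c M ℓ t := by
  unfold size
  positivity

/-- The sum telescopes; `hτ` guarantees that the subtraction of `logRows` in the first round is not
truncated. -/
theorem sum_halvings (hτ : level c ℓ 1 + logRows c M ℓ ≤ level c ℓ 0) {t : ℕ}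
    (ht : t + 1 ≤ rounds c ℓ) :
    ∑ s ∈ Finset.range (t + 1), halvings c M ℓ s + logRows c M ℓ + level c ℓ (t + 1) =
      level c ℓ 0 := by
  induction t with
  | zero =>
    simp [halvings]
    omega
  | succ t ih =>
    have h1 := ih (by omega)
    have h2 : level c ℓ (t + 1 + 1) < level c ℓ (t + 1) := level_lt (by omega)
    rw [Finset.sum_range_succ, halvings, if_neg (by omega)]
    omega

theorem size_mul (hτ : level c ℓ 1 + logRows c M ℓ ≤ level c ℓ 0) {t : ℕ}
    (ht : t + 1 ≤ rounds c ℓ) :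
    size c M ℓ (t + 1) * 2 ^ level c ℓ 0 =
      players c M ℓ * 2 ^ logRows c M ℓ * 2 ^ level c ℓ (t + 1) := by
  rw [← sum_halvings hτ ht, size, pow_add, pow_add]
  field_simp

theorem level_zero_bounds (c ℓ : ℕ) : 2 ^ level c ℓ 0 ≤ ℓ + 1 ∧ ℓ + 1 < 2 ^ (level c ℓ 0 + 1) :=
  ⟨Nat.pow_log_le_self 2 (by omega), Nat.lt_pow_succ_log_self (by norm_num) _⟩

/-- Up to rounding, `players * 2 ^ logRows` is `ℓ`, and `2 ^ level c ℓ 0` is `ℓ + 1` within a factor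
`2`. So the size follows `2 ^ level` within a factor `2`, from above here and from below in
`le_size`. -/
theorem size_le (hτ : level c ℓ 1 + logRows c M ℓ ≤ level c ℓ 0) {t : ℕ}
    (ht : t + 1 ≤ rounds c ℓ) : size c M ℓ (t + 1) ≤ 2 * 2 ^ level c ℓ (t + 1) := by
  have h1 : players c M ℓ * 2 ^ logRows c M ℓ ≤ 2 * 2 ^ level c ℓ 0 := by
    have := (level_zero_bounds c ℓ).2
    rw [pow_succ] at this
    have := Nat.div_mul_le_self ℓ (2 ^ logRows c M ℓ)
    unfold players
    omega
  have h1' : (players c M ℓ * 2 ^ logRows c M ℓ : ℝ) ≤ 2 * 2 ^ level c ℓ 0 := by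
    exact_mod_cast h1
  have h2 := size_mul hτ ht
  refine le_of_mul_le_mul_right ?_ (show (0 : ℝ) < 2 ^ level c ℓ 0 by positivity)
  rw [h2]
  nlinarith [mul_le_mul_of_nonneg_right h1' (show (0 : ℝ) ≤ 2 ^ level c ℓ (t + 1) by positivity)]

theorem le_size (hτ : level c ℓ 1 + logRows c M ℓ ≤ level c ℓ 0) (h2 : 2 ≤ level c ℓ 1) {t : ℕ}
    (ht : t + 1 ≤ rounds c ℓ) : 2 ^ level c ℓ (t + 1) ≤ 2 * size c M ℓ (t + 1) := by
  have h1 : 2 ^ level c ℓ 0 ≤ 2 * (players c M ℓ * 2 ^ logRows c M ℓ) := by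
    have h3 := (level_zero_bounds c ℓ).1
    have h4 := Nat.div_add_mod ℓ (2 ^ logRows c M ℓ)
    have h5 := Nat.mod_lt ℓ (show 0 < 2 ^ logRows c M ℓ by positivity)
    have h6 : 4 * 2 ^ logRows c M ℓ ≤ 2 ^ level c ℓ 0 := by
      rw [show 4 = 2 ^ 2 by norm_num, ← pow_add]
      exact Nat.pow_le_pow_right (by norm_num) (by omega)
    have h7 : 1 ≤ 2 ^ logRows c M ℓ := Nat.one_le_two_pow
    unfold players
    rw [mul_comm (ℓ / _)]
    omega
  have h1' : (2 ^ level c ℓ 0 : ℝ) ≤ 2 * (players c M ℓ * 2 ^ logRows c M ℓ) := by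
    exact_mod_cast h1
  have h2 := size_mul hτ ht
  refine le_of_mul_le_mul_right ?_ (show (0 : ℝ) < 2 ^ level c ℓ 0 by positivity)
  rw [mul_assoc, h2]
  nlinarith [mul_le_mul_of_nonneg_right h1' (show (0 : ℝ) ≤ 2 ^ level c ℓ (t + 1) by positivity)]

theorem halvings_le_level (t : ℕ) : halvings c M ℓ t ≤ level c ℓ t - level c ℓ (t + 1) :=
  Nat.sub_le _ _

theorem le_level_succ (t : ℕ) : 3 * c ≤ level c ℓ (t + 1) := by
  rw [level_succ, nextLevel]
  omega

/-- A block must have enough bits for all votes of a round; `n ≥ log ℓ` provides them. -/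
theorem halvings_le {n : ℕ} (hc : 1 ≤ c) (hn : ℓ ≤ 2 ^ n) {t : ℕ} (ht : t < rounds c ℓ) :
    halvings c M ℓ t ≤ n := by
  have h1 := halvings_le_level (c := c) (M := M) (ℓ := ℓ) t
  have h2 := le_level_succ (c := c) (ℓ := ℓ) t
  have h3 := level_le_zero ht.le
  have h4 := (level_zero_bounds c ℓ).1
  have h5 : level c ℓ 0 < n + 1 + 1 := by
    rw [← Nat.pow_lt_pow_iff_right (a := 2) (by norm_num), pow_succ, pow_succ]
    have := Nat.one_le_two_pow (n := n)
    omega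
  omega

end

end ONOSF

/-! ### The committees over all rounds of halving. -/

namespace ONOSF
open Function

section

variable {c M ℓ n : ℕ} {X : PMF (Fin ℓ → Block n)}

theorem maskOf_succ_of_lt (x : Fin ℓ → Block n) {t : ℕ} (ht : t < rounds c ℓ) :
    maskOf c M x (t + 1) = shrink (halvings c M ℓ t) (maskOf c M x t)
      (rowOf (players c M ℓ) t (blocks x)) := by
  rw [maskOf, maskAt, if_pos ht, maskOf]

theorem succ_mul_players_le {t : ℕ} (ht : t ≤ rounds c ℓ + M) :
    (t + 1) * players c M ℓ ≤ ℓ :=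
  (Nat.mul_le_mul_right _ (by omega)).trans (rows_mul_players_le c M ℓ)

theorem length_maskOf (x : Fin ℓ → Block n) {t : ℕ} (ht : t ≤ rounds c ℓ + M) :
    (maskOf c M x t).length = players c M ℓ := by
  apply length_maskAt
  rw [length_blocks]
  have := succ_mul_players_le ht
  nlinarith

theorem prefixDet_maskOf (c M t : ℕ) :
    PrefixDet (t * players c M ℓ) fun x : Fin ℓ → Block n => maskOf c M x t :=
  prefixDet_maskAt M _ _ _ t

/-- This upper bound holds for every input: the minority rule shrinks the committee no matter how
the bad players vote. -/
theorem card_waiting_le_size (hc : 1 ≤ c) (hn : ℓ ≤ 2 ^ n) (x : Fin ℓ → Block n) {t : ℕ}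
    (ht : t ≤ rounds c ℓ) : ((waiting (maskOf c M x t)).card : ℝ) ≤ size c M ℓ t := by
  induction t with
  | zero => simp [card_waiting, maskOf, maskAt, size]
  | succ t ih =>
    have hlt : t < rounds c ℓ := by omega
    have hl : (t + 1) * players c M ℓ ≤ (blocks x).length := by
      rw [length_blocks]
      exact succ_mul_players_le (by omega)
    obtain ⟨w, -, -, h⟩ := exists_shrink (halvings c M ℓ t) (maskOf c M x t)
      (rowOf (players c M ℓ) t (blocks x))
      (by rw [length_maskOf x (by omega), length_rowOf hl]) (by
        intro b hb
        obtain ⟨i, rfl⟩ := List.mem_ofFn.1 (List.mem_of_mem_drop (List.mem_of_mem_take hb))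
        rw [List.length_ofFn]
        exact halvings_le hc hn hlt)
    rw [maskOf_succ_of_lt x hlt, size_succ, le_div_iff₀ (by positivity), mul_comm, card_waiting]
    refine le_trans ?_ (ih (by omega))
    rw [card_waiting]
    exact_mod_cast h

/-- A bound for the loss of good players in `t` rounds. -/
noncomputable def loss (c ℓ t : ℕ) : ℝ := if t = 0 then 0 else 2 / 2 ^ (level c ℓ t / 3)

theorem level_succ_div (t : ℕ) : level c ℓ (t + 1) / 3 = Nat.log 2 (level c ℓ t + 1) + c := by
  rw [level_succ, nextLevel]
  omega

/-- From the first round on the levels are multiples of `3`, so a decrease lowers `level / 3` by at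
least one. The losses thus grow at least geometrically, and twice the last one bounds their sum. -/
theorem loss_add_le {t : ℕ} (ht : t < rounds c ℓ) :
    loss c ℓ t + 1 / 2 ^ (level c ℓ (t + 1) / 3) ≤ loss c ℓ (t + 1) := by
  have h : loss c ℓ t ≤ 1 / 2 ^ (level c ℓ (t + 1) / 3) := by
    unfold loss
    split
    · positivity
    · rename_i h0
      obtain ⟨s, rfl⟩ := Nat.exists_eq_succ_of_ne_zero h0
      have h1 := level_lt ht
      rw [Nat.succ_eq_add_one] at *
      have h2 : level c ℓ (s + 1 + 1) / 3 + 1 ≤ level c ℓ (s + 1) / 3 := by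
        rw [level_succ c ℓ (s + 1), level_succ c ℓ s, nextLevel, nextLevel] at h1 ⊢
        omega
      rw [div_le_div_iff₀ (by positivity) (by positivity), one_mul, mul_comm, ← pow_succ]
      exact pow_le_pow_right₀ (by norm_num) h2
  rw [loss.eq_def c ℓ (t + 1), if_neg (by omega)]
  have : (2 : ℝ) / 2 ^ (level c ℓ (t + 1) / 3) = 1 / 2 ^ (level c ℓ (t + 1) / 3) +
    1 / 2 ^ (level c ℓ (t + 1) / 3) := by ring
  linarith

theorem loss_nonneg (t : ℕ) : 0 ≤ loss c ℓ t := by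
  unfold loss
  split <;> positivity

theorem loss_le (hc : 6 ≤ c) (t : ℕ) : loss c ℓ t ≤ 1 / 4 := by
  unfold loss
  split
  · norm_num
  · rename_i h0
    obtain ⟨s, rfl⟩ := Nat.exists_eq_succ_of_ne_zero h0
    have : c ≤ level c ℓ (s + 1) / 3 := by
      rw [level_succ_div]
      omega
    rw [div_le_div_iff₀ (by positivity) (by norm_num)]
    have := pow_le_pow_right₀ (show (1 : ℝ) ≤ 2 by norm_num) (show 3 ≤ level c ℓ (s + 1) / 3 by omega)
    norm_num at this ⊢
    linarith

theorem exp_neg_nat_le (k : ℕ) : Real.exp (-(k : ℝ)) ≤ 1 / 2 ^ k := by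
  rw [Real.exp_neg, ← one_div]
  refine one_div_le_one_div_of_le (by positivity) ?_
  have := Real.add_one_le_exp 1
  calc (2 : ℝ) ^ k ≤ Real.exp 1 ^ k := pow_le_pow_left₀ (by norm_num) (by linarith) k
    _ = _ := by rw [← Real.exp_nat_mul, mul_one]

/-- With `level c ℓ (t + 1) = 3 m`, the new committee has size at least `8^m / 2`, of which a share
`γ ≥ 1/2` is expected to be good; the squared deviation `4^(-m)` leaves an exponent of at least `2^m
/ 8`. As `c ≥ 6`, `2^m` is at least `32 (L + 1)` for the old level `L`, so the exponent exceeds `2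
L` and pays for the at most `2^L` words. -/
theorem round_error_le (hc : 6 ≤ c) (hτ : level c ℓ 1 + logRows c M ℓ ≤ level c ℓ 0) {t : ℕ}
    (ht : t < rounds c ℓ) {γ : ℝ} (hγ : 1 / 2 ≤ γ) :
    2 ^ halvings c M ℓ t * Real.exp (-((1 / 2 ^ (level c ℓ (t + 1) / 3)) ^ 2 *
      (γ * size c M ℓ t / 2 ^ halvings c M ℓ t) / 2)) ≤ 1 / 2 ^ level c ℓ t := by
  set m := level c ℓ (t + 1) / 3 with hm
  have h3 : level c ℓ (t + 1) = 3 * m := by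
    rw [hm, level_succ, nextLevel]
    omega
  have hsz := le_size hτ (by have : 3 * c ≤ level c ℓ 1 := le_level_succ 0; omega)
    (show t + 1 ≤ rounds c ℓ by omega)
  rw [size_succ, h3, pow_mul] at hsz
  have hm2 : 64 * (level c ℓ t + 1) ≤ 2 * 2 ^ m := by
    have h1 := Nat.lt_pow_succ_log_self (b := 2) (by norm_num) (level c ℓ t + 1)
    have h2 := Nat.pow_le_pow_right (n := 2) (by norm_num) hc
    rw [hm, level_succ_div, pow_add]
    rw [pow_succ] at h1
    calc 64 * (level c ℓ t + 1) ≤ 64 * (2 ^ Nat.log 2 (level c ℓ t + 1) * 2) := by omega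
      _ ≤ 2 ^ c * (2 ^ Nat.log 2 (level c ℓ t + 1) * 2) := Nat.mul_le_mul_right _ h2
      _ = _ := by ring
  have hm2' : (64 * (level c ℓ t + 1) : ℝ) ≤ 2 * 2 ^ m := by exact_mod_cast hm2
  have hexp : ((2 * level c ℓ t : ℕ) : ℝ) ≤ (1 / 2 ^ m) ^ 2 *
      (γ * size c M ℓ t / 2 ^ halvings c M ℓ t) / 2 := by
    have h4 : (2 : ℝ) ^ m / 4 ≤ (1 / 2 ^ m) ^ 2 * (γ * size c M ℓ t / 2 ^ halvings c M ℓ t) := by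
      have h5 : ((2 : ℝ) ^ 3) ^ m / 4 ≤ γ * size c M ℓ t / 2 ^ halvings c M ℓ t := by
        rw [mul_div_assoc]
        have : 0 ≤ size c M ℓ t / 2 ^ halvings c M ℓ t := by
          rw [← size_succ]
          exact size_nonneg _
        nlinarith
      calc (2 : ℝ) ^ m / 4 = (1 / 2 ^ m) ^ 2 * (((2 : ℝ) ^ 3) ^ m / 4) := by
            rw [← pow_mul, mul_comm 3 m, pow_mul]
            field_simp
        _ ≤ _ := mul_le_mul_of_nonneg_left h5 (by positivity)
    push_cast
    linarith
  calc _ ≤ 2 ^ level c ℓ t * (1 / 2 ^ (2 * level c ℓ t) : ℝ) := by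
        refine mul_le_mul ?_ ?_ (by positivity) (by positivity)
        · exact pow_le_pow_right₀ (by norm_num)
            ((halvings_le_level t).trans (Nat.sub_le _ _))
        · exact (Real.exp_le_exp.2 (neg_le_neg hexp)).trans (exp_neg_nat_le _)
    _ = _ := by
        rw [two_mul, pow_add]
        field_simp

/-- The committees keep about their share of good players. -/
theorem prob_committee_le (hc : 6 ≤ c) (hn : ℓ ≤ 2 ^ n)
    (hτ : level c ℓ 1 + logRows c M ℓ ≤ level c ℓ 0) {P : Finset ℕ}
    (hPN : P ⊆ Finset.range (players c M ℓ))
    (hP : ∀ t < rounds c ℓ, ∀ j ∈ P, IsFreshAt X (t * players c M ℓ + j)) {β : ℝ} (hβ0 : 0 ≤ β)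
    (hβ1 : β ≤ 1 / 4) (hβ : (1 - β) * players c M ℓ ≤ P.card) {t : ℕ} (ht : t ≤ rounds c ℓ) :
    prob X (fun x => ((waiting (maskOf c M x t) ∩ P).card : ℝ) <
      (1 - β - loss c ℓ t) * size c M ℓ t) ≤ 1 / 2 ^ level c ℓ t := by
  induction t with
  | zero =>
    have h : ∀ x : Fin ℓ → Block n, waiting (maskOf c M x 0) ∩ P = P := by
      intro x
      refine Finset.inter_eq_right.2 (hPN.trans ?_)
      intro j hj
      rw [mem_waiting, maskOf, maskAt, List.getElem?_replicate, if_pos (Finset.mem_range.1 hj)]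
    have h' : ∀ x : Fin ℓ → Block n, ¬ ((waiting (maskOf c M x 0) ∩ P).card : ℝ) <
        (1 - β - loss c ℓ 0) * size c M ℓ 0 := by
      intro x
      simpa [h, loss, size] using hβ
    simp [prob, h', expect_const]
  | succ t ih =>
    have hlt : t < rounds c ℓ := by omega
    have hγ : 1 / 2 ≤ 1 - β - loss c ℓ t := by
      have := loss_le (ℓ := ℓ) hc t
      linarith
    have hmain := prob_shrink_le (X := X) (halvings_le (M := M) (by omega) hn hlt)
      (succ_mul_players_le (by omega)) (hP t hlt) (prefixDet_maskOf c M t)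
      (fun x => length_maskOf x (by omega)) (g₀ := (1 - β - loss c ℓ t) * size c M ℓ t)
      (δ := 1 / 2 ^ (level c ℓ (t + 1) / 3)) (by positivity)
      (by rw [div_le_one (by positivity)]; exact one_le_pow₀ (by norm_num))
    have herr := round_error_le hc hτ hlt hγ
    -- Since the level drops, the next bound is at least twice the present one: it absorbs the
    -- accumulated error and the new one.
    have hpow : (1 : ℝ) / 2 ^ level c ℓ t + 1 / 2 ^ level c ℓ t ≤ 1 / 2 ^ level c ℓ (t + 1) := by
      have h1 := level_lt hlt
      rw [← two_mul, mul_one_div, div_le_div_iff₀ (by positivity) (by positivity), one_mul,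
        mul_comm, ← pow_succ]
      exact pow_le_pow_right₀ (by norm_num) h1
    refine le_trans ?_ hpow
    refine le_trans ?_ (add_le_add (ih hlt.le) herr)
    refine le_trans ?_ hmain
    classical
    refine expect_mono fun x => ?_
    have himp : ((waiting (maskOf c M x (t + 1)) ∩ P).card : ℝ) <
        (1 - β - loss c ℓ (t + 1)) * size c M ℓ (t + 1) →
        ((waiting (shrink (halvings c M ℓ t) (maskOf c M x t)
          (rowOf (players c M ℓ) t (blocks x))) ∩ P).card : ℝ) <
        (1 - 1 / 2 ^ (level c ℓ (t + 1) / 3)) *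
          ((1 - β - loss c ℓ t) * size c M ℓ t / 2 ^ halvings c M ℓ t) := by
      intro h
      rw [maskOf_succ_of_lt x hlt] at h
      refine lt_of_lt_of_le h ?_
      rw [mul_div_assoc, ← size_succ, ← mul_assoc]
      refine mul_le_mul_of_nonneg_right ?_ (size_nonneg _)
      have h1 := loss_add_le hlt
      have h2 := loss_nonneg (c := c) (ℓ := ℓ) t
      have h3 : (0 : ℝ) ≤ 1 / 2 ^ (level c ℓ (t + 1) / 3) := by positivity
      nlinarith
    split
    · rename_i h
      rw [if_pos (himp h)]
    · split <;> simp

end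

end ONOSF

/-! ### The holder of the baton, reduction of a block modulo a number, and the weights. -/

namespace ONOSF
open Function

/-- At most one player holds the baton. -/
def UniqueHold (m : List Mark) : Prop :=
  ∀ i j : ℕ, m[i]? = some .hold → m[j]? = some .hold → i = j

theorem holdPosAux_spec (m : List Mark) (i p : ℕ) :
    (.hold ∉ m ∧ holdPosAux i p m = p) ∨ ∃ j : ℕ, m[j]? = some .hold ∧ holdPosAux i p m = i + j := by
  induction m generalizing i p with
  | nil => simp [holdPosAux]
  | cons x m ih =>
    rw [holdPosAux]
    rcases ih (i + 1) (if x = .hold then i else p) with ⟨h1, h2⟩ | ⟨j, h1, h2⟩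
    · by_cases hx : x = .hold
      · exact Or.inr ⟨0, by simp [hx], by rw [h2, if_pos hx, add_zero]⟩
      · exact Or.inl ⟨by simp [h1, Ne.symm hx], by rw [h2, if_neg hx]⟩
    · exact Or.inr ⟨j + 1, by simpa using h1, by rw [h2]; ring⟩

theorem holdPos_lt {m : List Mark} (h : 0 < m.length) : holdPos m < m.length := by
  rw [holdPos]
  rcases holdPosAux_spec m 0 0 with ⟨-, h2⟩ | ⟨j, h1, h2⟩
  · omega
  · have := (List.getElem?_eq_some_iff.1 h1).1
    omega

theorem UniqueHold.holdPos_eq {m : List Mark} (hm : UniqueHold m) {j : ℕ}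
    (hj : m[j]? = some .hold) : holdPos m = j := by
  rw [holdPos]
  rcases holdPosAux_spec m 0 0 with ⟨h1, -⟩ | ⟨i, h1, h2⟩
  · exact absurd (List.mem_of_getElem? hj) h1
  · rw [h2, zero_add, hm i j h1 hj]

theorem heldBits_of_notMem {m : List Mark} (row : List (List Bool)) (h : .hold ∉ m) :
    heldBits m row = [] := by
  rw [heldBits, List.flatMap_eq_nil_iff]
  intro p hp
  rw [if_neg]
  rintro h'
  exact h (h' ▸ (List.of_mem_zip (show (p.1, p.2) ∈ _ from hp)).1)

theorem UniqueHold.heldBits_eq {m : List Mark} (hm : UniqueHold m) {row : List (List Bool)} {j : ℕ}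
    {b : List Bool} (hj : m[j]? = some .hold) (hb : row[j]? = some b) : heldBits m row = b := by
  induction m generalizing row j with
  | nil => simp at hj
  | cons x m ih =>
    rcases row with _ | ⟨b', row⟩
    · simp at hb
    · rcases j with _ | j
      · simp only [List.getElem?_cons_zero, Option.some.injEq] at hj hb
        have hno : .hold ∉ m := by
          intro h
          obtain ⟨i, hi⟩ := List.getElem?_of_mem h
          have := hm 0 (i + 1) (by simp [hj]) (by simpa using hi)
          omega
        have := heldBits_of_notMem row hno
        rw [heldBits] at this ⊢
        simp [hj, hb, this]
      · rw [List.getElem?_cons_succ] at hj hb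
        have hx : x ≠ .hold := by
          intro hx
          have := hm 0 (j + 1) (by simp [hx]) (by simpa using hj)
          omega
        have := ih (fun i k hi hk => by
          have := hm (i + 1) (k + 1) (by simpa using hi) (by simpa using hk)
          omega) hj hb
        rw [heldBits] at this ⊢
        simp [hx, this]

theorem sum_range_mul_two (g : ℕ → ℝ) (k : ℕ) :
    ∑ v ∈ Finset.range k, (g (2 * v) + g (2 * v + 1)) = ∑ v ∈ Finset.range (2 * k), g v := by
  induction k with
  | zero => simp
  | succ k ih =>
    rw [Finset.sum_range_succ, ih, mul_add, mul_one, Finset.sum_range_succ, Finset.sum_range_succ]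
    ring

/-- The blocks are the binary numbers. -/
theorem sum_bitsVal (n : ℕ) (g : ℕ → ℝ) :
    ∑ b : Block n, g (bitsVal (List.ofFn b)) = ∑ v ∈ Finset.range (2 ^ n), g v := by
  induction n generalizing g with
  | zero => simp [bitsVal]
  | succ n ih =>
    rw [← (Fin.snocEquiv fun _ => Bool).sum_comp, Fintype.sum_prod_type_right]
    rw [pow_succ', ← sum_range_mul_two, ← ih fun v => g (2 * v) + g (2 * v + 1)]
    refine Finset.sum_congr rfl fun u _ => ?_
    have h : ∀ v : Bool, bitsVal (List.ofFn ((Fin.snocEquiv fun _ => Bool) (v, u))) =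
        2 * bitsVal (List.ofFn u) + v.toNat := by
      intro v
      rw [List.ofFn_succ', bitsVal, bitsVal, List.concat_eq_append, List.foldl_append]
      simp [Fin.snocEquiv]
    simp only [h, Fintype.sum_bool]
    simp [add_comm]

/-- Each residue occurs once in every full period; the incomplete last period is discarded. -/
theorem le_sum_mod (B : Finset ℕ) (r k : ℕ) (hB : B ⊆ Finset.range r) :
    (B.card : ℝ) * (k / r : ℕ) ≤ ∑ v ∈ Finset.range k, if v % r ∈ B then 1 else 0 := by
  have h : ∀ q, ∑ v ∈ Finset.range (r * q), (if v % r ∈ B then 1 else 0 : ℝ) = B.card * q := by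
    intro q
    induction q with
    | zero => simp
    | succ q ih =>
      rw [mul_add, mul_one, Finset.sum_range_add, ih]
      have : ∀ v ∈ Finset.range r, (if (r * q + v) % r ∈ B then 1 else 0 : ℝ) =
          if v ∈ B then 1 else 0 := by
        intro v hv
        rw [Nat.mul_add_mod, Nat.mod_eq_of_lt (Finset.mem_range.1 hv)]
      rw [Finset.sum_congr rfl this, Finset.sum_ite_mem, Finset.inter_eq_right.2 hB]
      simp
      ring
  rw [← h]
  refine Finset.sum_le_sum_of_subset_of_nonneg ?_ fun v _ _ => by split <;> simp
  exact Finset.range_subset_range.2 (Nat.mul_div_le k r)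

/-- The weight of a bad waiting player in the presence of `s` good ones. -/
noncomputable def weight (s : ℕ) : ℝ := 6 * ((s : ℝ) + 1) ^ (-(3 / 4) : ℝ)

theorem weight_nonneg (s : ℕ) : 0 ≤ weight s := by
  unfold weight
  positivity

/-- The hypothesis gives `6 a ≤ (s + 2)^(3/4) ≤ s + 2`, hence `a + s + 1 ≤ (7 s + 8) / 6`.
Bernoulli's inequality bounds the ratio of the weights by `1 + (3/4) / (s + 1)`. The constants fit
because `(7/8) * (6/7) = 3/4`: after clearing denominators the terms in `s²` and `s` agree, and `77
≤ 128` remains. -/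
theorem weight_succ (s : ℕ) {a : ℕ} (ha : (a : ℝ) * weight (s + 1) ≤ 1) :
    weight s * (1 - 7 / 8 / ((a : ℝ) + (s + 1))) ≤ weight (s + 1) := by
  have hs : (0 : ℝ) < (s : ℝ) + 1 := by positivity
  have hs2 : (0 : ℝ) < (s : ℝ) + 2 := by positivity
  unfold weight at *
  push_cast at *
  rw [show (s : ℝ) + 1 + 1 = s + 2 by ring] at *
  have ha' : (a : ℝ) ≤ (s + 2) / 6 := by
    have h1 : ((s : ℝ) + 2) ^ (3 / 4 : ℝ) ≤ s + 2 := by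
      conv_rhs => rw [← Real.rpow_one ((s : ℝ) + 2)]
      exact Real.rpow_le_rpow_of_exponent_le (by linarith) (by norm_num)
    rw [Real.rpow_neg hs2.le] at ha
    have h2 : (0 : ℝ) < ((s : ℝ) + 2) ^ (3 / 4 : ℝ) := by positivity
    have h3 : (a : ℝ) * 6 ≤ ((s : ℝ) + 2) ^ (3 / 4 : ℝ) := by
      have := mul_le_mul_of_nonneg_right ha h2.le
      field_simp at this
      linarith
    linarith
  have hber : (((s : ℝ) + 2) / (s + 1)) ^ (3 / 4 : ℝ) ≤ 1 + 3 / 4 * (1 / (s + 1)) := by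
    have := rpow_one_add_le_one_add_mul_self (s := 1 / ((s : ℝ) + 1)) (p := 3 / 4)
      (by have : (0 : ℝ) ≤ 1 / (s + 1) := by positivity
          linarith) (by norm_num) (by norm_num)
    convert this using 2
    field_simp
    ring
  have hfac : ((s : ℝ) + 1) ^ (-(3 / 4) : ℝ) =
      (((s : ℝ) + 2) / (s + 1)) ^ (3 / 4 : ℝ) * ((s : ℝ) + 2) ^ (-(3 / 4) : ℝ) := by
    rw [Real.div_rpow hs2.le hs.le, Real.rpow_neg hs.le, Real.rpow_neg hs2.le]
    field_simp
  have hkey : (1 + 3 / 4 * (1 / ((s : ℝ) + 1))) * (1 - 7 / 8 / ((a : ℝ) + (s + 1))) ≤ 1 := by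
    have hden : (a : ℝ) + (s + 1) ≤ (7 * s + 8) / 6 := by linarith
    have h1 : 7 / 8 / ((7 * (s : ℝ) + 8) / 6) ≤ 7 / 8 / ((a : ℝ) + (s + 1)) :=
      div_le_div_of_nonneg_left (by norm_num) (by positivity) hden
    have h2 : (1 + 3 / 4 * (1 / ((s : ℝ) + 1))) * (1 - 7 / 8 / ((7 * (s : ℝ) + 8) / 6)) ≤ 1 := by
      have : (1 + 3 / 4 * (1 / ((s : ℝ) + 1))) * (1 - 7 / 8 / ((7 * (s : ℝ) + 8) / 6)) =
          ((4 * s + 7) * (28 * s + 11)) / (16 * (s + 1) * (7 * s + 8)) := by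
        field_simp
        ring
      rw [this, div_le_one (by positivity)]
      nlinarith
    refine le_trans (mul_le_mul_of_nonneg_left ?_ (by positivity)) h2
    linarith
  have hnn : (0 : ℝ) ≤ 1 - 7 / 8 / ((a : ℝ) + (s + 1)) := by
    rw [sub_nonneg, div_le_one (by positivity)]
    have : (0 : ℝ) ≤ a := by positivity
    have : (0 : ℝ) ≤ s := by positivity
    linarith
  rw [hfac, mul_assoc, mul_assoc]
  refine mul_le_mul_of_nonneg_left ?_ (by norm_num)
  have h5 : (0 : ℝ) ≤ ((s : ℝ) + 2) ^ (-(3 / 4) : ℝ) := by positivity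
  calc _ = ((((s : ℝ) + 2) / (s + 1)) ^ (3 / 4 : ℝ) * (1 - 7 / 8 / ((a : ℝ) + (s + 1)))) *
        ((s : ℝ) + 2) ^ (-(3 / 4) : ℝ) := by ring
    _ ≤ 1 * ((s : ℝ) + 2) ^ (-(3 / 4) : ℝ) := by
        refine mul_le_mul_of_nonneg_right (le_trans ?_ hkey) h5
        exact mul_le_mul_of_nonneg_right hber hnn
    _ = _ := one_mul _

end ONOSF

/-! ### The risk while the baton is passed. -/

namespace ONOSF
open Function

/-- A good player holds the baton. -/
def GoodHold (P : Finset ℕ) (m : List Mark) : Prop := ∃ j ∈ P, m[j]? = some .hold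

open Classical in
/-- A bound for the probability that the last holder of the baton is bad. -/
noncomputable def risk (P : Finset ℕ) (m : List Mark) : ℝ :=
  -- A state without a good holder is charged as if a good player had just been named, whence the
  -- index lowered by one: naming a bad player instead only reduces the number of bad players. With
  -- no good player waiting it counts as lost. When nobody waits, the risk is `0` or `1` according
  -- to whether the last holder is good.
  if GoodHold P m then min 1 ((waiting m \ P).card * weight (waiting m ∩ P).card)
  else if (waiting m ∩ P).card = 0 then 1
  else min 1 ((waiting m \ P).card * weight ((waiting m ∩ P).card - 1))

theorem risk_nonneg (P : Finset ℕ) (m : List Mark) : 0 ≤ risk P m := by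
  have := weight_nonneg
  unfold risk
  split
  · exact le_min zero_le_one (mul_nonneg (by positivity) (this _))
  · split
    · exact zero_le_one
    · exact le_min zero_le_one (mul_nonneg (by positivity) (this _))

theorem risk_le_one (P : Finset ℕ) (m : List Mark) : risk P m ≤ 1 := by
  unfold risk
  split
  · exact min_le_left _ _
  · split
    · exact le_rfl
    · exact min_le_left _ _

theorem pick_facts (m : List Mark) (v : ℕ) (hv : v < m.count .wait) :
    ∃ j ∈ waiting m, ((waiting m).filter (· < j)).card = v ∧
      waiting (pick (some v) m) = (waiting m).erase j ∧
      ∀ i : ℕ, (pick (some v) m)[i]? = some .hold ↔ i = j := by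
  obtain ⟨j, h1, h2, h3⟩ := exists_pick m v hv
  refine ⟨j, mem_waiting.2 h1, h2, ?_, fun i => ?_⟩
  · ext i
    rw [Finset.mem_erase, mem_waiting, mem_waiting, h3]
    by_cases hi : i = j
    · simp [hi]
    · rw [if_neg hi, Option.map_eq_some_iff]
      constructor
      · rintro ⟨x, hx, h⟩
        split at h <;> simp_all
      · rintro ⟨-, h⟩
        exact ⟨_, h, by simp⟩
  · rw [h3]
    by_cases hi : i = j
    · simp [hi]
    · rw [if_neg hi, Option.map_eq_some_iff]
      simp only [hi, iff_false]
      rintro ⟨x, hx, h⟩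
      split at h <;> simp at h

theorem uniqueHold_pick (m : List Mark) (v : ℕ) (hv : v < m.count .wait) :
    UniqueHold (pick (some v) m) := by
  obtain ⟨j, -, -, -, h⟩ := pick_facts m v hv
  intro i k hi hk
  rw [(h i).1 hi, (h k).1 hk]

section

variable {P : Finset ℕ} {m : List Mark} {v j : ℕ}

theorem risk_pick_good (hj : j ∈ waiting m) (hjP : j ∈ P)
    (hw : waiting (pick (some v) m) = (waiting m).erase j)
    (hh : ∀ i : ℕ, (pick (some v) m)[i]? = some .hold ↔ i = j) :
    risk P (pick (some v) m) =
      min 1 ((waiting m \ P).card * weight ((waiting m ∩ P).card - 1)) := by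
  have h1 : (waiting m).erase j \ P = waiting m \ P := by
    ext i
    simp only [Finset.mem_sdiff, Finset.mem_erase]
    constructor
    · rintro ⟨⟨-, h⟩, h'⟩
      exact ⟨h, h'⟩
    · rintro ⟨h, h'⟩
      exact ⟨⟨fun e => h' (e ▸ hjP), h⟩, h'⟩
  have h2 : ((waiting m).erase j ∩ P).card = (waiting m ∩ P).card - 1 := by
    rw [Finset.erase_inter, Finset.card_erase_of_mem (Finset.mem_inter.2 ⟨hj, hjP⟩)]
  rw [risk, if_pos ⟨j, hjP, (hh j).2 rfl⟩, hw, h1, h2]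

theorem risk_pick_bad (hj : j ∈ waiting m) (hjP : j ∉ P)
    (hw : waiting (pick (some v) m) = (waiting m).erase j)
    (hh : ∀ i : ℕ, (pick (some v) m)[i]? = some .hold ↔ i = j) :
    risk P (pick (some v) m) = if (waiting m ∩ P).card = 0 then 1 else
      min 1 (((waiting m \ P).card - 1 : ℝ) * weight ((waiting m ∩ P).card - 1)) := by
  have h1 : (((waiting m).erase j \ P).card : ℝ) = (waiting m \ P).card - 1 := by
    rw [Finset.erase_sdiff_comm, Finset.cast_card_erase_of_mem (Finset.mem_sdiff.2 ⟨hj, hjP⟩)]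
  have h2 : (waiting m).erase j ∩ P = waiting m ∩ P := by
    ext i
    simp only [Finset.mem_inter, Finset.mem_erase]
    constructor
    · rintro ⟨⟨-, h⟩, h'⟩
      exact ⟨h, h'⟩
    · rintro ⟨h, h'⟩
      exact ⟨⟨fun e => hjP (e ▸ h'), h⟩, h'⟩
  rw [risk, if_neg, hw, h1, h2]
  rintro ⟨i, hi, h⟩
  exact hjP ((hh i).1 h ▸ hi)

/-- A bad holder of the baton has no influence on the risk. -/
theorem risk_pick_le (hg : ¬ GoodHold P m) (hv : v < m.count .wait) :
    risk P (pick (some v) m) ≤ risk P m := by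
  obtain ⟨j, hj, -, hw, hh⟩ := pick_facts m v hv
  rw [risk.eq_def P m, if_neg hg]
  by_cases hjP : j ∈ P
  · have : (waiting m ∩ P).card ≠ 0 :=
      Finset.card_ne_zero_of_mem (Finset.mem_inter.2 ⟨hj, hjP⟩)
    rw [risk_pick_good hj hjP hw hh, if_neg this]
  · rw [risk_pick_bad hj hjP hw hh]
    split
    · exact le_rfl
    · exact min_le_min le_rfl (mul_le_mul_of_nonneg_right (by linarith) (weight_nonneg _))

/-- The ranks of the bad waiting players. -/
def badRanks (P : Finset ℕ) (m : List Mark) : Finset ℕ :=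
  (waiting m \ P).image fun j => ((waiting m).filter (· < j)).card

theorem rank_lt_rank {W : Finset ℕ} {i j : ℕ} (hi : i ∈ W) (hij : i < j) :
    (W.filter (· < i)).card < (W.filter (· < j)).card := by
  apply Finset.card_lt_card
  rw [Finset.ssubset_iff_of_subset]
  · exact ⟨i, by simp [hi, hij], by simp⟩
  · intro k
    simp only [Finset.mem_filter]
    rintro ⟨h1, h2⟩
    exact ⟨h1, h2.trans hij⟩

theorem rank_inj {W : Finset ℕ} {i j : ℕ} (hi : i ∈ W) (hj : j ∈ W)
    (h : (W.filter (· < i)).card = (W.filter (· < j)).card) : i = j := by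
  rcases lt_trichotomy i j with hij | hij | hij
  · have := rank_lt_rank hi hij
    omega
  · exact hij
  · have := rank_lt_rank hj hij
    omega

theorem card_badRanks : (badRanks P m).card = (waiting m \ P).card := by
  apply Finset.card_image_of_injOn
  intro i hi j hj h
  exact rank_inj (Finset.mem_sdiff.1 hi).1 (Finset.mem_sdiff.1 hj).1 h

theorem badRanks_subset : badRanks P m ⊆ Finset.range (m.count .wait) := by
  intro v hv
  obtain ⟨j, hj, rfl⟩ := Finset.mem_image.1 hv
  rw [Finset.mem_range, ← card_waiting]
  apply Finset.card_lt_card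
  rw [Finset.ssubset_iff_of_subset (Finset.filter_subset _ _)]
  exact ⟨j, (Finset.mem_sdiff.1 hj).1, by simp⟩

/-- Naming a bad player uses up one bad player. On average this gain compensates the loss of a good
one. -/
theorem risk_pick_le_weight (hv : v < m.count .wait) (hs : (waiting m ∩ P).card ≠ 0) :
    risk P (pick (some v) m) ≤ weight ((waiting m ∩ P).card - 1) *
      ((waiting m \ P).card - if v ∈ badRanks P m then 1 else 0) := by
  obtain ⟨j, hj, hr, hw, hh⟩ := pick_facts m v hv
  by_cases hjP : j ∈ P
  · have hb : v ∉ badRanks P m := by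
      intro h
      obtain ⟨i, hi, hir⟩ := Finset.mem_image.1 h
      rw [Finset.mem_sdiff] at hi
      rw [← hr] at hir
      exact hi.2 (rank_inj hi.1 hj hir ▸ hjP)
    rw [risk_pick_good hj hjP hw hh, if_neg hb, sub_zero, mul_comm (weight _)]
    exact min_le_right _ _
  · have hb : v ∈ badRanks P m := Finset.mem_image.2 ⟨j, Finset.mem_sdiff.2 ⟨hj, hjP⟩, hr⟩
    rw [risk_pick_bad hj hjP hw hh, if_pos hb, if_neg hs, mul_comm (weight _)]
    exact min_le_right _ _

/-- The risk does not grow on the average when a good player passes the baton. -/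
theorem avg_risk_pick_le (hg : GoodHold P m) (hr : 0 < m.count .wait) {n : ℕ}
    (hn : 8 * m.count .wait ≤ 2 ^ n) :
    ((2 : ℝ) ^ n)⁻¹ * ∑ b : Block n,
      risk P (pick (some (bitsVal (List.ofFn b) % m.count .wait)) m) ≤ risk P m := by
  have hcard : (waiting m ∩ P).card + (waiting m \ P).card = m.count .wait := by
    rw [← card_waiting, Finset.card_inter_add_card_sdiff]
  set r := m.count .wait with hrdef
  set s := (waiting m ∩ P).card with hs
  set a := (waiting m \ P).card with ha
  rw [risk.eq_def P m, if_pos hg, ← hs, ← ha]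
  have hpow : (0 : ℝ) < 2 ^ n := by positivity
  refine le_min ?_ ?_
  · calc _ ≤ ((2 : ℝ) ^ n)⁻¹ * ∑ _b : Block n, 1 :=
          mul_le_mul_of_nonneg_left (Finset.sum_le_sum fun b _ => risk_le_one _ _) (by positivity)
      _ = 1 := by simp
  -- If the claimed bound is at least `1` there is nothing to show. Otherwise the bad players are
  -- few, which is what `weight_succ` needs; moreover some good player waits, because `weight 0 =
  -- 6`.
  · by_cases h1 : 1 ≤ (a : ℝ) * weight s
    · refine le_trans ?_ h1
      calc _ ≤ ((2 : ℝ) ^ n)⁻¹ * ∑ _b : Block n, 1 :=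
            mul_le_mul_of_nonneg_left (Finset.sum_le_sum fun b _ => risk_le_one _ _) (by positivity)
        _ = 1 := by simp
    · push Not at h1
      have hs0 : s ≠ 0 := by
        intro h0
        have ha1 : (1 : ℝ) ≤ a := by exact_mod_cast (show 1 ≤ a by omega)
        rw [h0, weight] at h1
        norm_num at h1
        linarith
      rw [sum_bitsVal n fun v => risk P (pick (some (v % r)) m)]
      have h2 : ∑ v ∈ Finset.range (2 ^ n), risk P (pick (some (v % r)) m) ≤
          weight (s - 1) * (2 ^ n * a - a * (2 ^ n / r : ℕ)) := by
        calc _ ≤ ∑ v ∈ Finset.range (2 ^ n),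
              weight (s - 1) * (a - if v % r ∈ badRanks P m then 1 else 0) :=
              Finset.sum_le_sum fun v _ => risk_pick_le_weight (Nat.mod_lt _ hr) hs0
          _ = weight (s - 1) * (2 ^ n * a - ∑ v ∈ Finset.range (2 ^ n),
              if v % r ∈ badRanks P m then 1 else 0) := by
              rw [← Finset.mul_sum, Finset.sum_sub_distrib]
              simp
          _ ≤ _ := by
              refine mul_le_mul_of_nonneg_left ?_ (weight_nonneg _)
              have := le_sum_mod (badRanks P m) r (2 ^ n) badRanks_subset
              rw [card_badRanks, ← ha] at this
              linarith
      -- Rounding down `2^n / r` loses less than `1`, which is at most an eighth of `2^n / r`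
      -- because `8 r ≤ 2^n`. This is the source of the constant `7/8`.
      have h3 : (2 : ℝ) ^ n * (7 / 8 / r) ≤ (2 ^ n / r : ℕ) := by
        have h4 : 2 ^ n < r * (2 ^ n / r + 1) := Nat.lt_mul_div_succ _ hr
        have h4' : (2 : ℝ) ^ n ≤ r * ((2 ^ n / r : ℕ) + 1) := by exact_mod_cast h4.le
        have hn' : (8 * r : ℝ) ≤ 2 ^ n := by exact_mod_cast hn
        have hr' : (0 : ℝ) < r := by exact_mod_cast hr
        rw [div_div, ← mul_div_assoc, div_le_iff₀ (by positivity)]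
        nlinarith
      obtain ⟨s', hs'⟩ := Nat.exists_eq_succ_of_ne_zero hs0
      rw [hs', Nat.succ_eq_add_one] at h1 h2 ⊢
      rw [Nat.add_sub_cancel] at h2
      have h5 := weight_succ s' h1.le
      have hrr : (a : ℝ) + (s' + 1) = r := by
        have : a + (s' + 1) = r := by omega
        exact_mod_cast this
      rw [hrr] at h5
      rw [inv_mul_le_iff₀ hpow]
      calc _ ≤ _ := h2
        _ ≤ weight s' * (2 ^ n * a - a * (2 ^ n * (7 / 8 / r))) :=
            mul_le_mul_of_nonneg_left
              (sub_le_sub_left (mul_le_mul_of_nonneg_left h3 (by positivity)) _) (weight_nonneg _)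
        _ = 2 ^ n * (a * (weight s' * (1 - 7 / 8 / r))) := by ring
        _ ≤ _ := mul_le_mul_of_nonneg_left (mul_le_mul_of_nonneg_left h5 (by positivity))
            hpow.le

end

end ONOSF

/-! ### From the passes of the baton to the distance from uniform. -/

namespace ONOSF
open Function

theorem hold_notMem_shrink (k : ℕ) (m : List Mark) (row : List (List Bool)) (h : .hold ∉ m) :
    .hold ∉ shrink k m row := by
  induction k generalizing m row with
  | zero => exact h
  | succ k ih =>
    refine ih _ _ ?_
    rw [halveMask, List.mem_map]
    rintro ⟨p, -, hp⟩
    split at hp <;> simp at hp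

theorem passBaton_eq_self {M : ℕ} {m : List Mark} (h : m.count .wait = 0)
    (row : List (List Bool)) : passBaton M m row = m := by
  rw [passBaton, if_pos (by omega)]

theorem passBaton_eq_pick {M : ℕ} {m : List Mark} (h0 : 0 < m.count .wait)
    (hM : m.count .wait ≤ M) (row : List (List Bool)) :
    passBaton M m row = pick (some (bitsVal (heldBits m row) % m.count .wait)) m := by
  rw [passBaton, if_neg (by omega), min_eq_left hM,
    Nat.mod_mod_of_dvd _ (Nat.dvd_factorial h0 hM)]

theorem count_passBaton_le {M : ℕ} {m : List Mark} (hM : m.count .wait ≤ M)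
    (row : List (List Bool)) : (passBaton M m row).count .wait ≤ m.count .wait - 1 := by
  rcases Nat.eq_zero_or_pos (m.count .wait) with h0 | h0
  · rw [passBaton_eq_self h0, h0]
  · obtain ⟨j, hj, -, hw, -⟩ := pick_facts m _ (Nat.mod_lt (bitsVal (heldBits m row)) h0)
    rw [passBaton_eq_pick h0 hM, ← card_waiting, hw, Finset.card_erase_of_mem hj, card_waiting]

theorem UniqueHold.passBaton {M : ℕ} {m : List Mark} (hm : UniqueHold m) (hM : m.count .wait ≤ M)
    (row : List (List Bool)) : UniqueHold (passBaton M m row) := by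
  rcases Nat.eq_zero_or_pos (m.count .wait) with h0 | h0
  · rwa [passBaton_eq_self h0]
  · rw [passBaton_eq_pick h0 hM]
    exact uniqueHold_pick m _ (Nat.mod_lt _ h0)

section

variable {c M ℓ n : ℕ} {X : PMF (Fin ℓ → Block n)}

theorem maskOf_succ_of_le (x : Fin ℓ → Block n) {t : ℕ} (ht : rounds c ℓ ≤ t) :
    maskOf c M x (t + 1) = passBaton M (maskOf c M x t) (rowOf (players c M ℓ) t (blocks x)) := by
  rw [maskOf, maskAt, if_neg (by omega), maskOf]

theorem hold_notMem_maskOf (x : Fin ℓ → Block n) {t : ℕ} (ht : t ≤ rounds c ℓ) :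
    .hold ∉ maskOf c M x t := by
  induction t with
  | zero => simp [maskOf, maskAt]
  | succ t ih =>
    rw [maskOf_succ_of_lt x (by omega)]
    exact hold_notMem_shrink _ _ _ (ih (by omega))

/-- Every pass takes one player out of the waiting ones, so `M` passes exhaust a committee of at
most `M` players; further passes change nothing. -/
theorem baton_invariant (x : Fin ℓ → Block n)
    (hM : (maskOf c M x (rounds c ℓ)).count .wait ≤ M) (i : ℕ) :
    UniqueHold (maskOf c M x (rounds c ℓ + i)) ∧
      (maskOf c M x (rounds c ℓ + i)).count .wait ≤ M - i := by
  induction i with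
  | zero =>
    refine ⟨fun i j hi _ => ?_, hM⟩
    exact absurd (List.mem_of_getElem? hi) (hold_notMem_maskOf x le_rfl)
  | succ i ih =>
    rw [← add_assoc, maskOf_succ_of_le x (by omega)]
    refine ⟨ih.1.passBaton (by omega) _, ?_⟩
    have := count_passBaton_le (M := M) (m := maskOf c M x (rounds c ℓ + i)) (by omega)
      (rowOf (players c M ℓ) (rounds c ℓ + i) (blocks x))
    omega

/-- The index of the block of the holder of the baton in the next row. -/
def holderIdx (c M : ℕ) {ℓ n : ℕ} (x : Fin ℓ → Block n) (t : ℕ) : ℕ :=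
  t * players c M ℓ + holdPos (maskOf c M x t)

theorem holderIdx_lt (hℓ : 0 < ℓ) (x : Fin ℓ → Block n) {t : ℕ}
    (ht : t ≤ rounds c ℓ + M) : holderIdx c M x t < ℓ := by
  have h1 := succ_mul_players_le ht
  have h2 := length_maskOf x ht
  rw [holderIdx]
  rw [add_mul, one_mul] at h1
  rcases Nat.eq_zero_or_pos (players c M ℓ) with h0 | h0
  -- Without players the mask is empty and the index is `0`.
  · rw [h0, List.length_eq_zero_iff] at h2
    rw [h0, h2]
    simpa [holdPos, holdPosAux] using hℓ
  · have h3 := holdPos_lt (m := maskOf c M x t) (by omega)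
    omega

/-- The averaging over the block of the holder of the baton. -/
theorem expect_holder (hℓ : 0 < ℓ) {t : ℕ} (ht : t ≤ rounds c ℓ + M)
    (H : (Fin ℓ → Block n) → Block n → ℝ) (hH : PrefixDet (t * players c M ℓ) H)
    (hfr : ∀ x, H x ≠ 0 → IsFreshAt X (holderIdx c M x t)) :
    expect X (fun x => H x (blockAt x (holderIdx c M x t))) =
      expect X fun x => ((2 : ℝ) ^ n)⁻¹ * ∑ b, H x b := by
  classical
  let G : Finset (Fin ℓ) := Finset.univ.filter fun i => IsFresh X i
  let J : (Fin ℓ → Block n) → Fin ℓ := fun x => ⟨holderIdx c M x t, holderIdx_lt hℓ x ht⟩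
  have hJ : PrefixDet (t * players c M ℓ) J := by
    intro x y h
    simp only [J, holderIdx, prefixDet_maskOf c M t x y h]
  have hmain := expect_fresh_block (X := X) (G := G) (fun i hi => (Finset.mem_filter.1 hi).2)
    (t * players c M ℓ) J hJ (fun x => Nat.le_add_right _ _) H hH
  have hne : ∀ x, J x ∉ G → H x = 0 := by
    intro x hx
    by_contra h
    obtain ⟨h1, h2⟩ := hfr x h
    exact hx (Finset.mem_filter.2 ⟨Finset.mem_univ _, h2⟩)
  have hb : ∀ x, blockAt x (holderIdx c M x t) = x (J x) := fun x => by
    rw [blockAt, dif_pos (holderIdx_lt hℓ x ht)]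
  convert hmain using 2
  · funext x
    rw [hb]
    split
    · rfl
    · rename_i h
      rw [hne x h]
      rfl
  · funext x
    split
    · rfl
    · rename_i h
      simp [hne x h]

variable {P : Finset ℕ}

theorem expect_risk_succ_le (hℓ : 0 < ℓ) (hn : 8 * M ≤ 2 ^ n)
    (hPN : P ⊆ Finset.range (players c M ℓ))
    (hP : ∀ t ≤ rounds c ℓ + M, ∀ j ∈ P, IsFreshAt X (t * players c M ℓ + j))
    (hM : ∀ x : Fin ℓ → Block n, (maskOf c M x (rounds c ℓ)).count .wait ≤ M) {i : ℕ}
    (hi : i < M) :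
    expect X (fun x => risk P (maskOf c M x (rounds c ℓ + i + 1))) ≤
      expect X fun x => risk P (maskOf c M x (rounds c ℓ + i)) := by
  classical
  set t := rounds c ℓ + i with ht
  have inv := fun x => baton_invariant x (hM x) i
  rw [← ht] at inv
  -- The risk after the pass is split: `H` is the case of a good holder, whose fresh block can be
  -- averaged over, and `R` the remaining cases, where the risk does not grow on any input.
  let H : (Fin ℓ → Block n) → Block n → ℝ := fun x b =>
    if GoodHold P (maskOf c M x t) ∧ 0 < (maskOf c M x t).count .wait then
      risk P (pick (some (bitsVal (List.ofFn b) % (maskOf c M x t).count .wait)) (maskOf c M x t))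
    else 0
  let R : (Fin ℓ → Block n) → ℝ := fun x =>
    if GoodHold P (maskOf c M x t) ∧ 0 < (maskOf c M x t).count .wait then 0
    else risk P (maskOf c M x t)
  have hH : PrefixDet (t * players c M ℓ) H := (prefixDet_maskOf c M t).comp fun m b =>
    if GoodHold P m ∧ 0 < m.count .wait then
      risk P (pick (some (bitsVal (List.ofFn b) % m.count .wait)) m) else 0
  have hidx : ∀ x : Fin ℓ → Block n, ∀ j ∈ P, (maskOf c M x t)[j]? = some .hold →
      holderIdx c M x t = t * players c M ℓ + j := by
    intro x j hj h
    rw [holderIdx, (inv x).1.holdPos_eq h]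
  have hfr : ∀ x, H x ≠ 0 → IsFreshAt X (holderIdx c M x t) := by
    intro x hx
    have hg : GoodHold P (maskOf c M x t) := by
      by_contra hg
      exact hx (by funext b; simp [H, hg])
    obtain ⟨j, hj, h⟩ := hg
    rw [hidx x j hj h]
    exact hP t (by omega) j hj
  have hexp := expect_holder hℓ (by omega) H hH hfr
  calc expect X (fun x => risk P (maskOf c M x (t + 1)))
      ≤ expect X (fun x => H x (blockAt x (holderIdx c M x t)) + R x) := by
        refine expect_mono fun x => ?_
        rw [maskOf_succ_of_le x (by omega)]
        have hMx : (maskOf c M x t).count .wait ≤ M := by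
          have := (inv x).2
          omega
        rcases Nat.eq_zero_or_pos ((maskOf c M x t).count .wait) with h0 | h0
        · rw [passBaton_eq_self h0]
          simp only [H, R, h0, lt_irrefl, and_false, if_false, zero_add]
          exact le_rfl
        · rw [passBaton_eq_pick h0 hMx]
          by_cases hg : GoodHold P (maskOf c M x t)
          · obtain ⟨j, hj, h⟩ := id hg
            have hjN := Finset.mem_range.1 (hPN hj)
            rw [(inv x).1.heldBits_eq h (getElem?_rowOf x (succ_mul_players_le (by omega)) hjN),
              ← hidx x j hj h]
            simp only [H, R, hg, h0, and_self, if_true, add_zero]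
            exact le_rfl
          · simp only [H, R, hg, false_and, if_false, zero_add]
            exact risk_pick_le hg (Nat.mod_lt _ h0)
    _ = expect X (fun x => ((2 : ℝ) ^ n)⁻¹ * ∑ b, H x b + R x) := by
        rw [expect_add, hexp, ← expect_add]
    _ ≤ _ := by
        refine expect_mono fun x => ?_
        by_cases hg : GoodHold P (maskOf c M x t) ∧ 0 < (maskOf c M x t).count .wait
        · simp only [H, R, if_pos hg, add_zero]
          refine avg_risk_pick_le hg.1 hg.2 ?_
          have := (inv x).2
          omega
        · simp only [H, R, if_neg hg, Finset.sum_const_zero, mul_zero, zero_add]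
          exact le_rfl

/-- The probability that the last holder of the baton is not good. -/
theorem prob_not_goodHold_le (hℓ : 0 < ℓ) (hn : 8 * M ≤ 2 ^ n)
    (hPN : P ⊆ Finset.range (players c M ℓ))
    (hP : ∀ t ≤ rounds c ℓ + M, ∀ j ∈ P, IsFreshAt X (t * players c M ℓ + j))
    (hM : ∀ x : Fin ℓ → Block n, (maskOf c M x (rounds c ℓ)).count .wait ≤ M) :
    prob X (fun x => ¬ GoodHold P (maskOf c M x (rounds c ℓ + M))) ≤
      expect X fun x => risk P (maskOf c M x (rounds c ℓ)) := by
  classical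
  have h1 : ∀ i ≤ M, expect X (fun x => risk P (maskOf c M x (rounds c ℓ + i))) ≤
      expect X fun x => risk P (maskOf c M x (rounds c ℓ)) := by
    intro i hi
    induction i with
    | zero => exact le_rfl
    | succ i ih =>
      exact (expect_risk_succ_le hℓ hn hPN hP hM (by omega)).trans (ih (by omega))
  refine le_trans (expect_mono fun x => ?_) (h1 M le_rfl)
  have h0 := (baton_invariant x (hM x) M).2
  rw [Nat.sub_self, Nat.le_zero, ← card_waiting, Finset.card_eq_zero] at h0
  split
  · rename_i hg
    rw [risk, if_neg hg, h0]
    simp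
  · exact risk_nonneg _ _

theorem map_apply_toReal (f : (Fin ℓ → Block n) → Block n) (b : Block n) :
    ((X.map f) b).toReal = expect X fun x => if f x = b then 1 else 0 := by
  classical
  rw [PMF.map_apply, tsum_fintype, ENNReal.toReal_sum]
  · refine Finset.sum_congr rfl fun x _ => ?_
    by_cases h : f x = b
    · simp [h]
    · simp [h, Ne.symm h]
  · intro x _
    split
    · exact X.apply_ne_top x
    · simp

theorem ext_eq_blockAt (x : Fin ℓ → Block n) :
    ext c M ℓ n x = blockAt x (holderIdx c M x (rounds c ℓ + M)) := rfl

/-- The output is as close to uniform as the probability that its index is not fresh. -/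
theorem statDist_ext_le (hℓ : 0 < ℓ) :
    statDist (X.map (ext c M ℓ n)) (PMF.uniformOfFintype (Block n)) ≤
      prob X fun x => ¬ IsFreshAt X (holderIdx c M x (rounds c ℓ + M)) := by
  classical
  set p : Block n → ℝ := fun b => ((X.map (ext c M ℓ n)) b).toReal with hp
  have hq : ∀ b : Block n, (PMF.uniformOfFintype (Block n) b).toReal = ((2 : ℝ) ^ n)⁻¹ := by
    intro b
    simp [PMF.uniformOfFintype_apply]
  have hpsum : ∑ b, p b = 1 := by
    simp only [hp, map_apply_toReal, ← expect_sum]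
    simp [expect_const]
  have hqsum : ∑ _b : Block n, ((2 : ℝ) ^ n)⁻¹ = 1 := by simp
  -- The distance is attained on the set of values that are too likely. It suffices to bound the
  -- probability of this one event.
  let A : Finset (Block n) := Finset.univ.filter fun b => ((2 : ℝ) ^ n)⁻¹ < p b
  have h1 : statDist (X.map (ext c M ℓ n)) (PMF.uniformOfFintype (Block n)) =
      ∑ b ∈ A, p b - A.card * ((2 : ℝ) ^ n)⁻¹ := by
    have h2 : ∀ b, |p b - ((2 : ℝ) ^ n)⁻¹| =
        2 * (if ((2 : ℝ) ^ n)⁻¹ < p b then p b - ((2 : ℝ) ^ n)⁻¹ else 0) -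
          (p b - ((2 : ℝ) ^ n)⁻¹) := by
      intro b
      split
      · rw [abs_of_pos (by linarith)]
        ring
      · rw [abs_of_nonpos (by linarith)]
        ring
    simp only [statDist, hq]
    rw [Finset.sum_congr rfl fun b _ => h2 b, Finset.sum_sub_distrib, ← Finset.mul_sum,
      Finset.sum_sub_distrib, hpsum, hqsum, ← Finset.sum_filter, Finset.sum_sub_distrib,
      Finset.sum_const, nsmul_eq_mul]
    ring
  have h3 : ∑ b ∈ A, p b = expect X fun x => if ext c M ℓ n x ∈ A then 1 else 0 := by
    simp only [hp, map_apply_toReal, ← expect_sum]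
    congr 1
    funext x
    rw [Finset.sum_ite_eq]
  let J : (Fin ℓ → Block n) → ℕ := fun x => holderIdx c M x (rounds c ℓ + M)
  let H : (Fin ℓ → Block n) → Block n → ℝ := fun x b =>
    if IsFreshAt X (J x) then (if b ∈ A then 1 else 0) else 0
  have hJ : PrefixDet ((rounds c ℓ + M) * players c M ℓ) J :=
    (prefixDet_maskOf c M (rounds c ℓ + M)).comp fun m =>
      (rounds c ℓ + M) * players c M ℓ + holdPos m
  have hH : PrefixDet ((rounds c ℓ + M) * players c M ℓ) H := hJ.comp
    fun i (b : Block n) => if IsFreshAt X i then (if b ∈ A then (1 : ℝ) else 0) else 0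
  have hfr : ∀ x, H x ≠ 0 → IsFreshAt X (holderIdx c M x (rounds c ℓ + M)) := by
    intro x hx
    by_contra hg
    exact hx (by funext b; simp [H, J, hg])
  have hexp := expect_holder hℓ le_rfl H hH hfr
  -- If the index is not fresh, the output is allowed to lie in `A` always; if it is fresh, the
  -- output is averaged and hits `A` with the uniform probability.
  have h4 : (expect X fun x => if ext c M ℓ n x ∈ A then 1 else 0) ≤
      expect X fun x => H x (blockAt x (holderIdx c M x (rounds c ℓ + M))) +
        if IsFreshAt X (holderIdx c M x (rounds c ℓ + M)) then 0 else 1 := by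
    refine expect_mono fun x => ?_
    rw [ext_eq_blockAt]
    by_cases h : IsFreshAt X (holderIdx c M x (rounds c ℓ + M))
    · simp [H, J, h]
    · simp only [H, J, h, if_false]
      split <;> norm_num
  have h5 : expect X (fun x => ((2 : ℝ) ^ n)⁻¹ * ∑ b, H x b) ≤ A.card * ((2 : ℝ) ^ n)⁻¹ := by
    rw [← expect_const (X := X) (A.card * ((2 : ℝ) ^ n)⁻¹)]
    refine expect_mono fun x => ?_
    rw [mul_comm]
    refine mul_le_mul_of_nonneg_right ?_ (by positivity)
    simp only [H]
    split
    · simp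
    · simp
  have h6 : (prob X fun x => ¬ IsFreshAt X (holderIdx c M x (rounds c ℓ + M))) =
      expect X fun x => if IsFreshAt X (holderIdx c M x (rounds c ℓ + M)) then 0 else 1 := by
    unfold prob
    congr 1
    funext x
    by_cases h : IsFreshAt X (holderIdx c M x (rounds c ℓ + M)) <;> simp [h]
  rw [h1, h3, h6]
  rw [expect_add, hexp] at h4
  linarith

end

end ONOSF

/-! ### The error of the extractor on sources with few bad blocks. -/

namespace ONOSF
open Function

section

variable {c M ℓ n : ℕ} {X : PMF (Fin ℓ → Block n)}

open Classical in
/-- The players all of whose blocks are fresh. -/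
noncomputable def goodPlayers (c M : ℕ) {ℓ n : ℕ} (X : PMF (Fin ℓ → Block n)) : Finset ℕ :=
  (Finset.range (players c M ℓ)).filter fun j =>
    ∀ t ≤ rounds c ℓ + M, IsFreshAt X (t * players c M ℓ + j)

/-- A player that is not good owns a bad block, and the index of this block modulo the number of
players gives back the player. -/
theorem players_le_card_goodPlayers {G : Finset (Fin ℓ)} (hG : ∀ i ∈ G, IsFresh X i) :
    players c M ℓ ≤ (goodPlayers c M X).card + (ℓ - G.card) := by
  classical
  have h1 : Finset.range (players c M ℓ) \ goodPlayers c M X ⊆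
      Gᶜ.image fun i => i.val % players c M ℓ := by
    intro j hj
    rw [Finset.mem_sdiff, goodPlayers, Finset.mem_filter, Finset.mem_range] at hj
    obtain ⟨hjN, hj⟩ := hj
    push Not at hj
    obtain ⟨t, ht, hf⟩ := hj hjN
    have h2 := succ_mul_players_le (c := c) (M := M) (ℓ := ℓ) ht
    rw [add_mul, one_mul] at h2
    have hlt : t * players c M ℓ + j < ℓ := by omega
    refine Finset.mem_image.2 ⟨⟨_, hlt⟩, ?_, ?_⟩
    · rw [Finset.mem_compl]
      exact fun h => hf ⟨hlt, hG _ h⟩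
    · simp only
      rw [Nat.mul_add_mod_self_right, Nat.mod_eq_of_lt hjN]
  have h2 := (Finset.card_le_card h1).trans Finset.card_image_le
  rw [Finset.card_compl, Fintype.card_fin] at h2
  have h3 : (goodPlayers c M X) ⊆ Finset.range (players c M ℓ) := Finset.filter_subset _ _
  have h4 := Finset.card_sdiff_add_card_eq_card h3
  rw [Finset.card_range] at h4
  omega

/-- The claim is `7200 * 4^m ≤ s^(3/4)`, with `7200 = 36 * 200`. In fourth powers it follows from
`7200^4 * 2^(8m) ≤ 2^(9(m-1))`, which for `m = 64` reads `7200^4 ≤ 2^55`. The value `c = 64` makes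
`m` this large. -/
theorem weight_committee_le {m s : ℕ} (hm : 64 ≤ m) (hs : (8 : ℝ) ^ (m - 1) ≤ s) :
    6 * (4 : ℝ) ^ m * weight (s - 1) ≤ 1 / 200 := by
  have h0 : (0 : ℝ) < 8 ^ (m - 1) := by positivity
  have hs0 : (0 : ℝ) < s := h0.trans_le hs
  have hs1 : 1 ≤ s := by exact_mod_cast hs0
  have hcast : ((s - 1 : ℕ) : ℝ) + 1 = s := by
    rw [Nat.cast_sub hs1]
    simp
  rw [weight, hcast, Real.rpow_neg hs0.le]
  have hy : (0 : ℝ) < (s : ℝ) ^ (3 / 4 : ℝ) := by positivity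
  have hkey : 7200 * (4 : ℝ) ^ m ≤ (s : ℝ) ^ (3 / 4 : ℝ) := by
    rw [← pow_le_pow_iff_left₀ (by positivity) hy.le (show 4 ≠ 0 by norm_num)]
    have h1 : ((s : ℝ) ^ (3 / 4 : ℝ)) ^ 4 = (s : ℝ) ^ 3 := by
      rw [← Real.rpow_natCast, ← Real.rpow_mul hs0.le, ← Real.rpow_natCast]
      norm_num
    rw [h1]
    refine le_trans ?_ (pow_le_pow_left₀ h0.le hs 3)
    obtain ⟨r, rfl⟩ := Nat.exists_eq_add_of_le hm
    rw [show 64 + r - 1 = 63 + r by omega, mul_pow, ← pow_mul, ← pow_mul]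
    have e1 : (4 : ℝ) ^ ((64 + r) * 4) = 2 ^ 512 * 2 ^ (8 * r) := by
      rw [show (4 : ℝ) = 2 ^ 2 by norm_num, ← pow_mul, ← pow_add]
      congr 1
      ring
    have e2 : (8 : ℝ) ^ ((63 + r) * 3) = 2 ^ 55 * 2 ^ 512 * (2 ^ (8 * r) * 2 ^ r) := by
      rw [show (8 : ℝ) = 2 ^ 3 by norm_num, ← pow_mul, ← pow_add, ← pow_add, ← pow_add]
      congr 1
      ring
    rw [e1, e2]
    have h2 : (7200 : ℝ) ^ 4 ≤ 2 ^ 55 := by norm_num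
    have h3 : (1 : ℝ) ≤ 2 ^ r := one_le_pow₀ (by norm_num)
    have h4 : (0 : ℝ) < 2 ^ 512 * 2 ^ (8 * r) := by positivity
    calc (7200 : ℝ) ^ 4 * (2 ^ 512 * 2 ^ (8 * r)) ≤ 2 ^ 55 * (2 ^ 512 * 2 ^ (8 * r)) :=
          mul_le_mul_of_nonneg_right h2 h4.le
      _ ≤ 2 ^ 55 * (2 ^ 512 * 2 ^ (8 * r)) * 2 ^ r :=
          le_mul_of_one_le_right (by positivity) h3
      _ = _ := by ring
  have : 6 * (4 : ℝ) ^ m * (6 * ((s : ℝ) ^ (3 / 4 : ℝ))⁻¹) =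
      36 * 4 ^ m / (s : ℝ) ^ (3 / 4 : ℝ) := by ring
  rw [this, div_le_iff₀ hy]
  linarith

/-- The error of the extractor on sources with few bad blocks. -/
theorem statDist_ext_le_of_few_bad (hc : 64 ≤ c) (hℓ : 0 < ℓ) (hn : ℓ ≤ 2 ^ n)
    (hnM : 8 * M ≤ 2 ^ n) (hτ : level c ℓ 1 + logRows c M ℓ ≤ level c ℓ 0)
    (hT : 0 < rounds c ℓ) (hM : 2 * 2 ^ level c ℓ (rounds c ℓ) ≤ M) {G : Finset (Fin ℓ)}
    (hG : ∀ i ∈ G, IsFresh X i)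
    (hcard : 2 ^ (level c ℓ (rounds c ℓ) / 3) * (ℓ - G.card) ≤ players c M ℓ) :
    statDist (X.map (ext c M ℓ n)) (PMF.uniformOfFintype (Block n)) ≤ 1 / 100 := by
  classical
  obtain ⟨T, hTs⟩ := Nat.exists_eq_succ_of_ne_zero hT.ne'
  rw [Nat.succ_eq_add_one] at hTs
  set m := level c ℓ (rounds c ℓ) / 3 with hm
  have hm64 : 64 ≤ m := by
    rw [hm, hTs, level_succ_div]
    omega
  have h3 : level c ℓ (rounds c ℓ) = 3 * m := by
    rw [hm, hTs, level_succ, nextLevel]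
    omega
  have hsz1 := size_le hτ hTs.ge
  have hsz2 := le_size hτ (by have : 3 * c ≤ level c ℓ 1 := le_level_succ 0; omega) hTs.ge
  rw [← hTs, h3, pow_mul, show (2 : ℝ) ^ 3 = 8 by norm_num] at hsz1 hsz2
  set P := goodPlayers c M X with hPdef
  have hPN : P ⊆ Finset.range (players c M ℓ) := Finset.filter_subset _ _
  have hP : ∀ t ≤ rounds c ℓ + M, ∀ j ∈ P, IsFreshAt X (t * players c M ℓ + j) :=
    fun t ht j hj => (Finset.mem_filter.1 hj).2 t ht
  have htot : ∀ x : Fin ℓ → Block n,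
      ((waiting (maskOf c M x (rounds c ℓ))).card : ℝ) ≤ size c M ℓ (rounds c ℓ) :=
    fun x => card_waiting_le_size (by omega) hn x le_rfl
  have hMx : ∀ x : Fin ℓ → Block n, (maskOf c M x (rounds c ℓ)).count .wait ≤ M := by
    intro x
    refine le_trans ?_ hM
    rw [h3, pow_mul, ← card_waiting]
    have := (htot x).trans hsz1
    exact_mod_cast this
  set β : ℝ := 1 / 2 ^ m with hβ
  have hpow : (64 : ℝ) ≤ 2 ^ m :=
    le_trans (by norm_num) (pow_le_pow_right₀ (by norm_num : (1 : ℝ) ≤ 2) (show 6 ≤ m by omega))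
  have hβ0 : 0 ≤ β := by positivity
  have hβ1 : β ≤ 1 / 64 := one_div_le_one_div_of_le (by norm_num) hpow
  have hβc : (1 - β) * players c M ℓ ≤ P.card := by
    have h1 : (players c M ℓ : ℝ) ≤ P.card + (ℓ - G.card : ℕ) := by
      exact_mod_cast players_le_card_goodPlayers (c := c) (M := M) hG
    have h2 : (2 : ℝ) ^ m * (ℓ - G.card : ℕ) ≤ players c M ℓ := by exact_mod_cast hcard
    have h4 : ((ℓ - G.card : ℕ) : ℝ) ≤ β * players c M ℓ := by
      rw [hβ, one_div, le_inv_mul_iff₀ (by positivity)]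
      exact h2
    linarith
  have hcomm := prob_committee_le (X := X) (by omega) hn hτ hPN
    (fun t ht j hj => hP t (by omega) j hj) hβ0 (by linarith) hβc le_rfl
  have hloss : loss c ℓ (rounds c ℓ) = 2 * β := by
    rw [loss, if_neg hT.ne', ← hm, hβ]
    ring
  rw [hloss, h3] at hcomm
  have herr : (1 : ℝ) / 2 ^ (3 * m) ≤ 1 / 200 := by
    refine one_div_le_one_div_of_le (by norm_num) ?_
    exact le_trans (by norm_num)
      (pow_le_pow_right₀ (by norm_num : (1 : ℝ) ≤ 2) (show 8 ≤ 3 * m by omega))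
  -- The error `1/100` has two halves: the committee may have lost too many good players, or the
  -- baton may end with a bad one.
  have hrisk : expect X (fun x => risk P (maskOf c M x (rounds c ℓ))) ≤
      prob X (fun x => ((waiting (maskOf c M x (rounds c ℓ)) ∩ P).card : ℝ) <
        (1 - β - 2 * β) * size c M ℓ (rounds c ℓ)) + 1 / 200 := by
    rw [← expect_const (X := X) (1 / 200), prob, ← expect_add]
    refine expect_mono fun x => ?_
    split
    · have := risk_le_one P (maskOf c M x (rounds c ℓ))
      linarith
    · rename_i hs
      push Not at hs
      set s := (waiting (maskOf c M x (rounds c ℓ)) ∩ P).card with hsdef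
      have hs8 : (8 : ℝ) ^ (m - 1) ≤ s := by
        have e : (8 : ℝ) ^ m = 8 ^ (m - 1) * 8 := by
          rw [← pow_succ]
          congr 1
          omega
        have : 1 / 2 * size c M ℓ (rounds c ℓ) ≤
            (1 - β - 2 * β) * size c M ℓ (rounds c ℓ) :=
          mul_le_mul_of_nonneg_right (by linarith) (size_nonneg _)
        have : (0 : ℝ) < 8 ^ (m - 1) := by positivity
        linarith
      -- The committee never exceeds its size, and at least a share `1 - 3 β` of the size is good
      -- (`β` bad from the start, `2 β` lost by halving); the bad members fill at most the rest.
      have ha : ((waiting (maskOf c M x (rounds c ℓ)) \ P).card : ℝ) ≤ 6 * 4 ^ m := by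
        have h1 : (s : ℝ) + (waiting (maskOf c M x (rounds c ℓ)) \ P).card =
            (waiting (maskOf c M x (rounds c ℓ))).card := by
          exact_mod_cast Finset.card_inter_add_card_sdiff _ _
        have h2 := htot x
        have h4 : 3 * β * size c M ℓ (rounds c ℓ) ≤ 3 * β * (2 * 8 ^ m) :=
          mul_le_mul_of_nonneg_left hsz1 (by positivity)
        have h5 : 3 * β * (2 * 8 ^ m) = 6 * 4 ^ m := by
          rw [hβ, show (8 : ℝ) = 2 * 4 by norm_num, mul_pow]
          field_simp
          ring
        linarith
      have hs0 : s ≠ 0 := by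
        intro h
        rw [h] at hs8
        have : (0 : ℝ) < 8 ^ (m - 1) := by positivity
        simp only [Nat.cast_zero] at hs8
        linarith
      -- Nobody holds the baton yet, so the risk is the one without a good holder.
      rw [risk, if_neg, if_neg hs0, zero_add]
      · refine (min_le_right _ _).trans (le_trans ?_ (weight_committee_le hm64 hs8))
        exact mul_le_mul_of_nonneg_right ha (weight_nonneg _)
      · rintro ⟨j, -, hj⟩
        exact hold_notMem_maskOf x le_rfl (List.mem_of_getElem? hj)
  have hhold := prob_not_goodHold_le (X := X) hℓ hnM hPN hP hMx
  have hfresh : (prob X fun x => ¬ IsFreshAt X (holderIdx c M x (rounds c ℓ + M))) ≤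
      prob X fun x => ¬ GoodHold P (maskOf c M x (rounds c ℓ + M)) := by
    refine expect_mono fun x => ?_
    have : ¬ IsFreshAt X (holderIdx c M x (rounds c ℓ + M)) →
        ¬ GoodHold P (maskOf c M x (rounds c ℓ + M)) := by
      rintro h ⟨j, hj, hjh⟩
      apply h
      rw [holderIdx, (baton_invariant x (hMx x) M).1.holdPos_eq hjh]
      exact hP _ le_rfl j hj
    by_cases h : ¬ IsFreshAt X (holderIdx c M x (rounds c ℓ + M))
    · rw [if_pos h, if_pos (this h)]
    · rw [if_neg h]
      split <;> simp
  have := statDist_ext_le (c := c) (M := M) (X := X) hℓ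
  linarith

/-- The extractor has no error on sources without bad blocks. -/
theorem statDist_ext_le_of_no_bad (hℓ : 0 < ℓ) (hG : ∀ i, IsFresh X i) :
    statDist (X.map (ext c M ℓ n)) (PMF.uniformOfFintype (Block n)) ≤ 0 := by
  refine (statDist_ext_le hℓ).trans (le_of_eq ?_)
  have : ∀ x : Fin ℓ → Block n, IsFreshAt X (holderIdx c M x (rounds c ℓ + M)) :=
    fun x => ⟨holderIdx_lt hℓ x le_rfl, hG _⟩
  simp [prob, this, expect_const]

end

end ONOSF

/-! ### The number of rounds and the iterated logarithm. -/

namespace ONOSF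
open Function

theorem mul_log_le (x : ℕ) : 16 * Nat.log 2 x ≤ x + 48 := by
  rcases Nat.eq_zero_or_pos x with rfl | hx
  · simp
  · have h : ∀ k : ℕ, 16 * k ≤ 2 ^ k + 48 := by
      intro k
      induction k with
      | zero => simp
      | succ k ih =>
        rcases lt_or_ge k 4 with hk | hk
        · interval_cases k <;> simp
        · have := Nat.pow_le_pow_right (n := 2) (by norm_num) hk
          rw [pow_succ]
          omega
    have := Nat.pow_log_le_self 2 hx.ne'
    have := h (Nat.log 2 x)
    omega

/-- One step is about three logarithms plus a constant, the second takes the logarithm of that; by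
`mul_log_le` the result is about `9/16` of `log L` plus a constant, which is below `log L` once `log
L ≥ 545`. -/
theorem nextLevel_nextLevel_le {L : ℕ} (hL : 545 ≤ Nat.log 2 L) :
    nextLevel 64 (nextLevel 64 L) ≤ Nat.log 2 L := by
  have hy : Nat.log 2 (L + 1) ≤ Nat.log 2 L + 1 := by
    have h0 : L ≠ 0 := by
      rintro rfl
      simp at hL
    calc Nat.log 2 (L + 1) ≤ Nat.log 2 (L * 2) := Nat.log_mono_right (by omega)
      _ = _ := Nat.log_mul_base (by norm_num) h0
  have := mul_log_le (nextLevel 64 L + 1)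
  unfold nextLevel at *
  omega

section

variable {ℓ : ℕ}

theorem le_nextLevel_level_rounds (c ℓ : ℕ) :
    level c ℓ (rounds c ℓ) ≤ nextLevel c (level c ℓ (rounds c ℓ)) := by
  rw [← level_succ]
  exact Nat.find_spec (exists_level_le c ℓ)

/-- When the schedule stops, `L ≤ 3 (log (L + 1) + 64)`, which bounds `L`. The last committee has at
most `2 * 2^322 = 2^323` members, whence the choice of `M`. -/
theorem level_rounds_le (ℓ : ℕ) : level 64 ℓ (rounds 64 ℓ) ≤ 322 := by
  have h1 := le_nextLevel_level_rounds 64 ℓ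
  have h2 := mul_log_le (level 64 ℓ (rounds 64 ℓ) + 1)
  unfold nextLevel at h1
  omega

theorem level_add_le {c t s : ℕ} (h : t + s ≤ rounds c ℓ) :
    level c ℓ (t + s) + s ≤ level c ℓ t := by
  induction s with
  | zero => simp
  | succ s ih =>
    have h1 := ih (by omega)
    have h2 := level_lt (show t + s < rounds c ℓ by omega)
    rw [show t + (s + 1) = t + s + 1 by omega]
    omega

/-- While the level is at least `2^545`, two rounds are paid for by one logarithm applied to the
upper bound `x`. Below that, the level still drops by one per round, so at most `2^545` rounds are
left. -/
theorem rounds_le_of_iterate_le {k t : ℕ} {x : ℝ} (ht : t ≤ rounds 64 ℓ)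
    (hx : (level 64 ℓ t : ℝ) ≤ x) (hk : (Real.logb 2)^[k] x ≤ 1) :
    rounds 64 ℓ ≤ t + 2 * k + 2 ^ 545 := by
  induction k generalizing t x with
  | zero =>
    have h1 : level 64 ℓ t ≤ 1 := by exact_mod_cast hx.trans hk
    have h2 := level_add_le (c := 64) (ℓ := ℓ) (t := t) (s := rounds 64 ℓ - t) (by omega)
    have h3 : 1 ≤ 2 ^ 545 := Nat.one_le_two_pow
    omega
  | succ k ih =>
    have hpos : 2 ≤ 2 ^ 545 := Nat.le_self_pow (n := 545) (by omega) 2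
    rcases lt_or_ge (level 64 ℓ t) (2 ^ 545) with hL | hL
    · have h2 := level_add_le (c := 64) (ℓ := ℓ) (t := t) (s := rounds 64 ℓ - t) (by omega)
      omega
    · rcases lt_or_ge (rounds 64 ℓ) (t + 2) with h2 | h2
      · omega
      · have h0 : level 64 ℓ t ≠ 0 := by omega
        have h3 : level 64 ℓ (t + 2) ≤ Nat.log 2 (level 64 ℓ t) := by
          rw [show t + 2 = t + 1 + 1 by ring, level_succ, level_succ]
          exact nextLevel_nextLevel_le ((Nat.le_log_iff_pow_le (by norm_num) h0).2 hL)
        have h4 : (level 64 ℓ (t + 2) : ℝ) ≤ Real.logb 2 x := by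
          have h5 : (2 : ℝ) ^ level 64 ℓ (t + 2) ≤ x := by
            refine le_trans ?_ hx
            have := (Nat.pow_le_pow_right (n := 2) (by norm_num) h3).trans
              (Nat.pow_log_le_self 2 h0)
            exact_mod_cast this
          rw [Real.le_logb_iff_rpow_le (by norm_num) (lt_of_lt_of_le (by positivity) h5),
            Real.rpow_natCast]
          exact h5
        have := ih h2 h4 (by rwa [iterate_succ_apply] at hk)
        omega

/-- Above `1` each logarithm subtracts at least a fixed amount, so iteration reaches `1`; `logStar`
is therefore the infimum of a nonempty set. -/
theorem logb_le_sub {x : ℝ} (hx : 1 < x) : Real.logb 2 x ≤ x - 1 / 4 := by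
  have h1 := Real.log_le_sub_one_of_pos (show 0 < x / (3 / 2) by positivity)
  have h2 := Real.log_le_sub_one_of_pos (show (0 : ℝ) < 3 / 2 by norm_num)
  rw [Real.log_div (by positivity) (by norm_num)] at h1
  have h3 := Real.log_two_gt_d9
  rw [Real.logb, div_le_iff₀ (by linarith)]
  nlinarith

theorem exists_iterate_logb_le (x : ℝ) : ∃ k, (Real.logb 2)^[k] x ≤ 1 := by
  have h : ∀ (N : ℕ) (x : ℝ), x ≤ N / 4 + 1 → ∃ k, (Real.logb 2)^[k] x ≤ 1 := by
    intro N
    induction N with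
    | zero => exact fun x hx => ⟨0, by simpa using hx⟩
    | succ N ih =>
      intro x hx
      rcases le_or_gt x 1 with h1 | h1
      · exact ⟨0, h1⟩
      · push_cast at hx
        obtain ⟨k, hk⟩ := ih (Real.logb 2 x) (by linarith [logb_le_sub h1])
        exact ⟨k + 1, hk⟩
  obtain ⟨N, hN⟩ := exists_nat_ge (4 * x)
  exact h N x (by linarith)

theorem rounds_le_logStar (ℓ : ℕ) : rounds 64 ℓ ≤ 2 * logStar (ℓ : ℝ) + 2 ^ 545 := by
  have h1 : (Real.logb 2)^[logStar (ℓ : ℝ)] ℓ ≤ 1 := Nat.sInf_mem (exists_iterate_logb_le ℓ)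
  have h2 : level 64 ℓ 0 ≤ ℓ := by
    have := Nat.log_lt_self 2 (show ℓ + 1 ≠ 0 by omega)
    rw [level, iterate_zero_apply]
    omega
  have := rounds_le_of_iterate_le (Nat.zero_le _) (by exact_mod_cast h2) h1
  omega

theorem logStar_pos (hℓ : 2 ≤ ℓ) : 1 ≤ logStar (ℓ : ℝ) := by
  rw [Nat.one_le_iff_ne_zero]
  intro h
  have h1 : (Real.logb 2)^[logStar (ℓ : ℝ)] ℓ ≤ 1 := Nat.sInf_mem (exists_iterate_logb_le ℓ)
  rw [h, iterate_zero_apply] at h1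
  have : ℓ ≤ 1 := by exact_mod_cast h1
  omega

theorem two_pow_logRows_le (c M ℓ : ℕ) : 2 ^ logRows c M ℓ ≤ 2 * (rounds c ℓ + M + 1) := by
  rw [logRows, pow_succ, mul_comm]
  exact Nat.mul_le_mul_left 2 (Nat.pow_log_le_self 2 (by omega))

/-- As the number of rounds is at most the initial level, both `level 64 ℓ 1` and `logRows` are a
multiple of the logarithm of that level plus a constant. -/
theorem level_one_add_logRows_le {M : ℕ} (hM : M = 2 ^ 323) (hℓ : 1100 ≤ Nat.log 2 (ℓ + 1)) :
    level 64 ℓ 1 + logRows 64 M ℓ ≤ level 64 ℓ 0 := by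
  have h0 : level 64 ℓ 0 = Nat.log 2 (ℓ + 1) := rfl
  have h1 : level 64 ℓ 1 = 3 * (Nat.log 2 (level 64 ℓ 0 + 1) + 64) := level_succ 64 ℓ 0
  have hT : rounds 64 ℓ ≤ level 64 ℓ 0 := by
    have := level_le_zero (c := 64) (ℓ := ℓ) le_rfl
    omega
  have h2 : logRows 64 M ℓ ≤ Nat.log 2 (level 64 ℓ 0 + 1) + 326 := by
    have h3 : rounds 64 ℓ + M + 1 < 2 ^ (Nat.log 2 (level 64 ℓ 0 + 1) + 325) := by
      have h4 := Nat.lt_pow_succ_log_self (b := 2) (by norm_num) (level 64 ℓ 0 + 1)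
      have h5 : 2 ^ (Nat.log 2 (level 64 ℓ 0 + 1) + 325) =
          2 ^ (Nat.log 2 (level 64 ℓ 0 + 1) + 1) * (2 * M) := by
        rw [hM, ← pow_succ', ← pow_add]
      rw [h5]
      have h6 : 1 ≤ M := hM ▸ Nat.one_le_two_pow
      have h7 : 2 ≤ 2 ^ (Nat.log 2 (level 64 ℓ 0 + 1) + 1) := Nat.le_self_pow (by omega) 2
      obtain ⟨a, ha⟩ := Nat.exists_eq_add_of_le h6
      obtain ⟨b, hb⟩ := Nat.exists_eq_add_of_le h7
      rw [Nat.succ_eq_add_one, hb] at h4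
      rw [hb, ha]
      have h8 : (2 + b) * (2 * (1 + a)) = 4 + 4 * a + 2 * b + 2 * (a * b) := by ring
      rw [h8]
      clear hM ha h5
      omega
    have := Nat.log_lt_of_lt_pow (by omega) h3
    rw [logRows]
    omega
  have h3 := mul_log_le (level 64 ℓ 0 + 1)
  omega

end

end ONOSF

/-! ### The choice of the constants and the theorem. -/

namespace ONOSF

/-- The error of the extractor on sources with a fraction `1 / (C log* ℓ)` of bad blocks. -/
theorem statDist_ext_le_of_logStar {M ℓ n : ℕ} (hM : M = 2 ^ 323) (hℓ : 2 ≤ ℓ) (hn : ℓ ≤ 2 ^ n)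
    {X : PMF (Fin ℓ → Block n)} {G : Finset (Fin ℓ)} (hG : ∀ i ∈ G, IsFresh X i)
    (hbad : (ℓ - G.card) * (2 ^ 1200 * logStar (ℓ : ℝ)) ≤ ℓ) :
    statDist (X.map (ext 64 M ℓ n)) (PMF.uniformOfFintype (Block n)) ≤ 1 / 100 := by
  rcases Nat.eq_zero_or_pos (ℓ - G.card) with h0 | h0
  · have hGu : G = Finset.univ := by
      rw [← Finset.card_eq_iff_eq_univ, Fintype.card_fin]
      have := Finset.card_le_univ G
      rw [Fintype.card_fin] at this
      omega
    have := statDist_ext_le_of_no_bad (c := 64) (M := M) (X := X) (by omega)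
      fun i => hG i (hGu ▸ Finset.mem_univ i)
    linarith
  · have hs := logStar_pos hℓ
    have hT := rounds_le_logStar ℓ
    have hrows := two_pow_logRows_le 64 M ℓ
    generalize logStar (ℓ : ℝ) = s at *
    -- A single bad block is allowed only if `ℓ ≥ C log* ℓ`; so all smaller `ℓ` belong to the case
    -- without bad blocks.
    have hbig : 2 ^ 1200 ≤ ℓ := by
      refine le_trans ?_ hbad
      calc 2 ^ 1200 = 1 * (2 ^ 1200 * 1) := by rw [one_mul, mul_one]
        _ ≤ _ := Nat.mul_le_mul h0 (Nat.mul_le_mul_left _ hs)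
    have hpow : ∀ a b c : ℕ, a + b = c → 2 ^ a * 2 ^ b = 2 ^ c := by
      rintro a b _ rfl
      exact (pow_add 2 a b).symm
    have hlog : 1100 ≤ Nat.log 2 (ℓ + 1) := by
      refine (Nat.le_log_iff_pow_le (by norm_num) (by omega)).2 (le_trans ?_ (Nat.le_succ ℓ))
      exact (Nat.pow_le_pow_right (by norm_num) (by norm_num)).trans hbig
    have hτ := level_one_add_logRows_le hM hlog
    have hL := level_rounds_le ℓ
    refine statDist_ext_le_of_few_bad le_rfl (by omega) hn ?_ hτ ?_ ?_ hG ?_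
    · rw [hM, show 8 = 2 ^ 3 by norm_num, ← pow_add]
      exact (Nat.pow_le_pow_right (by norm_num) (by norm_num)).trans (hbig.trans hn)
    · rw [Nat.pos_iff_ne_zero]
      intro h
      have h1 := Nat.find_spec (exists_level_le 64 ℓ)
      change level 64 ℓ (rounds 64 ℓ) ≤ level 64 ℓ (rounds 64 ℓ + 1) at h1
      rw [h, zero_add] at h1
      have : 1 ≤ logRows 64 M ℓ := Nat.le_add_left _ _
      omega
    · rw [← pow_succ', hM]
      exact Nat.pow_le_pow_right (by norm_num) (by omega)
    · rw [players, Nat.le_div_iff_mul_le (by positivity)]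
      have h1 : 2 ^ logRows 64 M ℓ ≤ 2 ^ 548 * s := by
        have h2 : M ≤ 2 ^ 545 :=
          hM.trans_le (Nat.pow_le_pow_right (by norm_num) (by norm_num))
        have h3 : 3 ≤ 2 ^ 545 :=
          le_trans (by norm_num) (Nat.pow_le_pow_right (n := 2) (by norm_num) (show 2 ≤ 545 by norm_num))
        rw [← hpow 3 545 548 (by norm_num)]
        generalize 2 ^ 545 = B at *
        have h4 : 3 * s ≤ B * s := Nat.mul_le_mul_right s h3
        have h5 : B * 1 ≤ B * s := Nat.mul_le_mul_left B hs
        rw [mul_assoc]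
        generalize B * s = D at *
        clear hM hbad hbig hn
        omega
      -- There are at most `2^548 log* ℓ` times fewer players than blocks, up to rounding, and
      -- `2^652` is a generous bound for the reciprocal of the tolerated share of bad players; `652
      -- + 548 = 1200` gives `C`.
      calc 2 ^ (level 64 ℓ (rounds 64 ℓ) / 3) * (ℓ - G.card) * 2 ^ logRows 64 M ℓ
          ≤ 2 ^ 652 * (ℓ - G.card) * (2 ^ 548 * s) :=
            Nat.mul_le_mul (Nat.mul_le_mul_right _
              (Nat.pow_le_pow_right (by norm_num) (by omega))) h1
        _ = (ℓ - G.card) * (2 ^ 652 * 2 ^ 548 * s) := by ring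
        _ = (ℓ - G.card) * (2 ^ 1200 * s) :=
            congrArg (fun p => (ℓ - G.card) * (p * s)) (hpow 652 548 1200 (by norm_num))
        _ ≤ ℓ := hbad

end ONOSF

theorem mainTheorem9 :
    ∃ C : ℝ, 0 < C ∧
      ∃ Ext : (ℓ n : ℕ) → (Fin ℓ → ONOSF.Block n) → ONOSF.Block n,
        ONOSF.IsExplicit Ext ∧
        ∀ ℓ n g : ℕ, 2 ≤ ℓ → Real.logb 2 (ℓ : ℝ) ≤ (n : ℝ) →
          (ℓ : ℝ) - (ℓ : ℝ) / (C * (ONOSF.logStar (ℓ : ℝ) : ℝ)) ≤ (g : ℝ) →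
          ∀ X : PMF (Fin ℓ → ONOSF.Block n), ONOSF.IsUniformONOSF g ℓ n X →
            ONOSF.statDist (X.map (Ext ℓ n)) (PMF.uniformOfFintype (ONOSF.Block n)) ≤ 1 / 100 := by
  refine ⟨2 ^ 1200, by positivity, ONOSF.ext 64 (2 ^ 323), ONOSF.isExplicit_ext _ _, ?_⟩
  intro ℓ n g hℓ hn hg X hX
  obtain ⟨G, hcard, hG⟩ := hX.exists_fresh
  have hℓ0 : (0 : ℝ) < ℓ := by exact_mod_cast (show 0 < ℓ by omega)
  have hn' : ℓ ≤ 2 ^ n := by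
    rw [Real.logb_le_iff_le_rpow (by norm_num) hℓ0, Real.rpow_natCast] at hn
    exact_mod_cast hn
  refine ONOSF.statDist_ext_le_of_logStar rfl hℓ hn' hG ?_
  have hs : (0 : ℝ) < ONOSF.logStar (ℓ : ℝ) := by exact_mod_cast ONOSF.logStar_pos hℓ
  have hgle : G.card ≤ ℓ := by
    have := Finset.card_le_univ G
    rwa [Fintype.card_fin] at this
  have h1 : ((ℓ - G.card : ℕ) : ℝ) ≤ ℓ / (2 ^ 1200 * (ONOSF.logStar (ℓ : ℝ) : ℝ)) := by
    rw [Nat.cast_sub hgle, hcard]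
    linarith
  rw [le_div_iff₀ (by positivity)] at h1
  exact_mod_cast h1
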